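/- Let $n\ge 2$, $M\ge 1$, let $\Omega\subset\mathbb{R}^n$ be a bounded Lipschitz domain and let $D\subset\Omega$ be Lebesgue measurable with $0\le\mathcal{L}^n(D)<\mathcal{L}^n(\Omega)$. Let $1<\zeta<\infty$, $\lambda>0$ and $f\in L^{\zeta}(\Omega-D)^M$. Let $F:\mathbb{R}^{nM}\to[0,\infty)$ be strictly convex and of class $C^1$ with $F(0)=0$, and suppose that there are constants $\nu_1,\nu_2>0$, $\nu_3\in\mathbb{R}$ with $$|DF(P)|\le\nu_1,\qquad F(P)\ge\nu_2|P|-\nu_3\qquad\text{for all }P\in\mathbb{R}^{nM}.$$ Let $F^{\infty}(P)=\lim_{t\to\infty}F(tP)/t$ be the recession function of $F$. For $w\in BV(\Omega)^M$ write $\nabla w=\nabla^a w\,\mathcal{L}^n+\nabla^s w$ for the Lebesgue decomposition of the tensor-valued gradient measure of $w$. Put $$I[w]=\int_{\Omega}F(\nabla w)\,dx+\frac{\lambda}{\zeta}\int_{\Omega-D}|w-f|^{\zeta}\,dx,\qquad w\in W^{1,1}(\Omega)^M\cap L^{\zeta}(\Omega-D)^M,$$ $$K[w]=\int_{\Omega}F(\nabla^a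 w)\,dx+\int_{\Omega}F^{\infty}\Big(\frac{\nabla^s w}{|\nabla^s w|}\Big)\,d|\nabla^s w|+\frac{\lambda}{\zeta}\int_{\Omega-D}|w-f|^{\zeta}\,dx,\qquad w\in BV(\Omega)^M\cap L^{\zeta}(\Omega-D)^M.$$ Then: (a) $K$ attains its minimum on $BV(\Omega)^M\cap L^{\zeta}(\Omega-D)^M$. (b) If $u$ and $\widetilde u$ are $K$-minimizers in this class, then $u=\widetilde u$ a.e. on $\Omega-D$ and $\nabla^a u=\nabla^a\widetilde u$ a.e. on $\Omega$. (c) $\displaystyle\inf_{W^{1,1}(\Omega)^M\cap L^{\zeta}(\Omega-D)^M}I=\inf_{BV(\Omega)^M\cap L^{\zeta}(\Omega-D)^M}K$. (d) The set of all $L^1(\Omega)^M$-cluster points of $I$-minimizing sequences from $W^{1,1}(\Omega)^M\cap L^{\zeta}(\Omega-D)^M$ coincides with the set of all $K$-minimizers from $BV(\Omega)^M\cap L^{\zeta}(\Omega-D)^M$. -/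

import Mathlib

open MeasureTheory Filter Topology Set
open scoped ContDiff

noncomputable section

namespace Inpainting

/-- The space `ℝᵏ` with its Euclidean norm. -/
abbrev Vec (k : ℕ) : Type := EuclideanSpace ℝ (Fin k)

/-- The space `ℝ^{nM}` of gradient tensors with its Euclidean norm; the entry `(j, i)` belongs to
the `i`-th partial derivative of the `j`-th component. -/
abbrev Tens (n M : ℕ) : Type := EuclideanSpace ℝ (Fin M × Fin n)

/-- Bounded Lipschitz domains: bounded, open, connected sets which near each boundary point, in
some direction `e`, are the strict epigraph of a Lipschitz function of the variables orthogonal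
to `e` (such a function is given by a Lipschitz function on `ℝⁿ` that is constant along `e`). -/
structure IsBoundedLipschitzDomain {n : ℕ} (Ω : Set (Vec n)) : Prop where
  isOpen : IsOpen Ω
  isConnected : IsConnected Ω
  isBounded : Bornology.IsBounded Ω
  boundary : ∀ x ∈ frontier Ω, ∃ (e : Vec n) (γ : Vec n → ℝ) (L : NNReal) (r : ℝ),
    ‖e‖ = 1 ∧ LipschitzWith L γ ∧ (∀ (y : Vec n) (t : ℝ), γ (y + t • e) = γ y) ∧ 0 < r ∧
    ∀ y ∈ Metric.ball x r, y ∈ Ω ↔ γ y < inner ℝ e y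

/-- Test functions of class `C_c^∞(Ω)`. -/
def IsTest {n : ℕ} (Ω : Set (Vec n)) (φ : Vec n → ℝ) : Prop :=
  ContDiff ℝ ∞ φ ∧ HasCompactSupport φ ∧ tsupport φ ⊆ Ω

/-- The partial derivative `∂_i φ`. -/
def partialDeriv {n : ℕ} (i : Fin n) (φ : Vec n → ℝ) (x : Vec n) : ℝ :=
  fderiv ℝ φ x (EuclideanSpace.single i 1)

/-! ### The Sobolev space `W^{1,1}` -/

/-- `G ∈ L¹(Ω)` is the weak gradient of `u` on `Ω`. -/
def IsWeakGrad {n M : ℕ} (Ω : Set (Vec n)) (u : Vec n → Vec M) (G : Vec n → Tens n M) : Prop :=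
  MemLp G 1 (volume.restrict Ω) ∧
  ∀ φ : Vec n → ℝ, IsTest Ω φ → ∀ (j : Fin M) (i : Fin n),
    ∫ x in Ω, u x j * partialDeriv i φ x = - ∫ x in Ω, φ x * G x (j, i)

/-- `u ∈ W^{1,1}(Ω)^M`. -/
def MemW11 {n M : ℕ} (Ω : Set (Vec n)) (u : Vec n → Vec M) : Prop :=
  MemLp u 1 (volume.restrict Ω) ∧ ∃ G, IsWeakGrad Ω u G

open Classical in
/-- The weak gradient of `u` on `Ω`, unique up to null sets if it exists (and `0` otherwise). -/
def weakGrad {n M : ℕ} (Ω : Set (Vec n)) (u : Vec n → Vec M) : Vec n → Tens n M :=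
  if h : ∃ G, IsWeakGrad Ω u G then h.choose else 0

/-! ### Tensor-valued measures -/

/-- The `k`-th component of an `ℝ^ι`-valued measure. -/
def comp {α ι : Type*} [MeasurableSpace α] [Fintype ι]
    (ρ : VectorMeasure α (EuclideanSpace ℝ ι)) (k : ι) : SignedMeasure α :=
  ρ.mapRange (EuclideanSpace.proj k : EuclideanSpace ℝ ι →L[ℝ] ℝ).toLinearMap.toAddMonoidHom
    (EuclideanSpace.proj k : EuclideanSpace ℝ ι →L[ℝ] ℝ).continuous

/-- The `ℝ^ι`-valued measure with given components. -/
def ofComponents {α ι : Type*} [MeasurableSpace α] [Fintype ι] (s : ι → SignedMeasure α) :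
    VectorMeasure α (EuclideanSpace ℝ ι) where
  measureOf' A := WithLp.toLp 2 fun k => s k A
  empty' := by ext k; simp
  not_measurable' A hA := by ext k; simp [(s k).not_measurable hA]
  m_iUnion' A hA hd := by
    have h : HasSum (fun i => fun k => s k (A i)) (fun k => s k (⋃ i, A i)) :=
      Pi.hasSum.2 fun k => (s k).m_iUnion hA hd
    exact h.mapL (PiLp.continuousLinearEquiv 2 ℝ (fun _ : ι => ℝ)).symm.toContinuousLinearMap

/-- The density of `ρ` with respect to a positive measure `μ`, i.e. the density of the part of
`ρ` that is absolutely continuous with respect to `μ`. -/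
def density {α ι : Type*} [MeasurableSpace α] [Fintype ι]
    (ρ : VectorMeasure α (EuclideanSpace ℝ ι)) (μ : Measure α) (x : α) : EuclideanSpace ℝ ι :=
  WithLp.toLp 2 fun k => (comp ρ k).rnDeriv μ x

/-- The part of `ρ` that is singular with respect to `μ`. -/
def singularPart {α ι : Type*} [MeasurableSpace α] [Fintype ι]
    (ρ : VectorMeasure α (EuclideanSpace ℝ ι)) (μ : Measure α) :
    VectorMeasure α (EuclideanSpace ℝ ι) :=
  ofComponents fun k => (comp ρ k).singularPart μ

/-- The density `ρ / |ρ|` of `ρ` with respect to its total variation measure. -/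
def polar {α ι : Type*} [MeasurableSpace α] [Fintype ι]
    (ρ : VectorMeasure α (EuclideanSpace ℝ ι)) : α → EuclideanSpace ℝ ι :=
  density ρ ρ.variation

/-! ### The space `BV` -/

/-- The finite tensor-valued Borel measure `ρ`, concentrated on `Ω`, is the distributional
gradient of `u` on `Ω`. -/
def IsGradMeasure {n M : ℕ} (Ω : Set (Vec n)) (u : Vec n → Vec M)
    (ρ : VectorMeasure (Vec n) (Tens n M)) : Prop :=
  ρ.variation Ωᶜ = 0 ∧
  ∀ φ : Vec n → ℝ, IsTest Ω φ → ∀ (j : Fin M) (i : Fin n),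
    ∫ x in Ω, u x j * partialDeriv i φ x = - (∫ᵛ x, φ x ∂•ρ) (j, i)

/-- `u ∈ BV(Ω)^M`. -/
def MemBV {n M : ℕ} (Ω : Set (Vec n)) (u : Vec n → Vec M) : Prop :=
  MemLp u 1 (volume.restrict Ω) ∧ ∃ ρ, IsGradMeasure Ω u ρ

open Classical in
/-- The gradient measure `∇u` of `u ∈ BV(Ω)^M`; it is unique (and `0` if there is none). -/
def gradMeasure {n M : ℕ} (Ω : Set (Vec n)) (u : Vec n → Vec M) :
    VectorMeasure (Vec n) (Tens n M) :=
  if h : ∃ ρ, IsGradMeasure Ω u ρ then h.choose else 0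

/-- `∇ᵃu`: the density of the absolutely continuous part of `∇u`. -/
def gradAC {n M : ℕ} (Ω : Set (Vec n)) (u : Vec n → Vec M) : Vec n → Tens n M :=
  density (gradMeasure Ω u) volume

/-- `∇ˢu`: the singular part of `∇u`. -/
def gradSing {n M : ℕ} (Ω : Set (Vec n)) (u : Vec n → Vec M) :
    VectorMeasure (Vec n) (Tens n M) :=
  singularPart (gradMeasure Ω u) volume

/-! ### The functionals -/

/-- The hypotheses on the density: `F : ℝ^{nM} → [0, ∞)` is strictly convex, of class `C¹`,
with `F 0 = 0`, bounded gradient and at least linear growth. -/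
structure IsDensity {n M : ℕ} (F : Tens n M → ℝ) (ν₁ ν₂ ν₃ : ℝ) : Prop where
  nonneg : ∀ P, 0 ≤ F P
  contDiff : ContDiff ℝ 1 F
  strictConvex : StrictConvexOn ℝ univ F
  map_zero : F 0 = 0
  norm_fderiv_le : ∀ P, ‖fderiv ℝ F P‖ ≤ ν₁
  lower : ∀ P, ν₂ * ‖P‖ - ν₃ ≤ F P

/-- The recession function `F^∞(P) = lim_{t → ∞} F(tP)/t`. -/
def recession {n M : ℕ} (F : Tens n M → ℝ) (P : Tens n M) : ℝ :=
  limUnder atTop fun t : ℝ => F (t • P) / t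

/-- The data fitting term. -/
def fidelity {n M : ℕ} (Ω D : Set (Vec n)) (f : Vec n → Vec M) (lam ζ : ℝ)
    (w : Vec n → Vec M) : ℝ :=
  lam / ζ * ∫ x in Ω \ D, ‖w x - f x‖ ^ ζ

/-- The functional `I`. -/
def functionalI {n M : ℕ} (Ω D : Set (Vec n)) (f : Vec n → Vec M) (F : Tens n M → ℝ)
    (lam ζ : ℝ) (w : Vec n → Vec M) : ℝ :=
  (∫ x in Ω, F (weakGrad Ω w x)) + fidelity Ω D f lam ζ w

/-- The relaxed functional `K`. -/
def functionalK {n M : ℕ} (Ω D : Set (Vec n)) (f : Vec n → Vec M) (F : Tens n M → ℝ)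
    (lam ζ : ℝ) (w : Vec n → Vec M) : ℝ :=
  (∫ x in Ω, F (gradAC Ω w x)) +
  (∫ x in Ω, recession F (polar (gradSing Ω w) x) ∂(gradSing Ω w).variation) +
  fidelity Ω D f lam ζ w

/-- The class `W^{1,1}(Ω)^M ∩ L^ζ(Ω - D)^M`. -/
def classW {n : ℕ} (M : ℕ) (Ω D : Set (Vec n)) (ζ : ℝ) : Set (Vec n → Vec M) :=
  {w | MemW11 Ω w ∧ MemLp w (ENNReal.ofReal ζ) (volume.restrict (Ω \ D))}

/-- The class `BV(Ω)^M ∩ L^ζ(Ω - D)^M`. -/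
def classBV {n : ℕ} (M : ℕ) (Ω D : Set (Vec n)) (ζ : ℝ) : Set (Vec n → Vec M) :=
  {w | MemBV Ω w ∧ MemLp w (ENNReal.ofReal ζ) (volume.restrict (Ω \ D))}

/-- The minimizers of `J` in the class `S`. -/
def minimizers {X : Type*} (J : X → ℝ) (S : Set X) : Set X :=
  {u | u ∈ S ∧ ∀ v ∈ S, J u ≤ J v}

/-- `J`-minimizing sequences from the class `S`. -/
def IsMinimizingSeq {X : Type*} (J : X → ℝ) (S : Set X) (w : ℕ → X) : Prop :=
  (∀ m, w m ∈ S) ∧ ∃ c : ℝ, IsGLB (J '' S) c ∧ Tendsto (fun m => J (w m)) atTop (𝓝 c)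

/-- `u ∈ L¹(Ω)^M` is an `L¹(Ω)^M`-cluster point of the sequence `w`. -/
def IsL1ClusterPt {n M : ℕ} (Ω : Set (Vec n)) (w : ℕ → Vec n → Vec M) (u : Vec n → Vec M) :
    Prop :=
  MemLp u 1 (volume.restrict Ω) ∧ ∃ φ : ℕ → ℕ, StrictMono φ ∧
    Tendsto (fun k => eLpNorm (w (φ k) - u) 1 (volume.restrict Ω)) atTop (𝓝 0)

end Inpainting

end

/-! The gradient part of `K` is one integral of a convex function of measures. Let `persp F (P, t)`
be `t F(P/t)` for `t > 0` and the recession function of `F` at `P` for `t = 0`. It is positively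
1-homogeneous, and it is the supremum of the linear functions `(P, t) ↦ t (F(Q) - DF(Q)Q) + DF(Q)P`.
If a finite measure `m` on `Ω` satisfies `∇u = p m` and `ℒⁿ = t m` on `Ω`, then the gradient part of
`K[u]` is `∫ persp F (p, t) dm`. By homogeneity this number does not depend on `m`, so several
functions can be compared over one measure without any Lebesgue decomposition (`GradRep`,
`GradRep.energy_eq`).

Lower semicontinuity (`exists_gradRep_of_tendsto`): along an ultrafilter the gradients and the
energy densities converge weakly to measures. Each tangent inequality is linear and survives in the
limit; countably many of them recover `persp F`. With Fatou's lemma for the fidelity this gives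
`mem_classBV_of_tendsto`.

Recovery (`exists_contDiff_functionalK_le`): `u` is cut up by a partition of unity, each piece is
translated into the Lipschitz domain and mollified, and Jensen's inequality bounds the energy. The
approximants converge only in `L¹`, which does not control the fidelity. They are therefore
truncated at a dyadic level whose shell of values carries little of the gradient, and dominated
convergence applies to the truncations.

Compactness: regularization and Arzelà–Ascoli give Rellich's theorem. Poincaré's inequality holds
with the set `Ω \ D` of positive measure, on which the fidelity controls the functions. So smooth
minimizing sequences have `L¹` limits; these are minimizers of `K`, the two infima agree, and
minimizers of `K` are exactly the cluster points of minimizing sequences of `I`.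

Uniqueness: at the midpoint of two minimizers both convexity inequalities must be equalities. The
power `ζ > 1` is strict on `Ω \ D`. The function `persp F` is strict in `P` only where `t > 0`, that
is, for the absolutely continuous part of the gradient. -/

namespace Inpainting

/-! ### The perspective function as a supremum of linear functions. -/

open Classical in
/-- The perspective function of `F`, extended by the recession function at `t = 0`. -/
noncomputable def persp {n M : ℕ} (F : Tens n M → ℝ) (P : Tens n M) (t : ℝ) : ℝ :=
  if 0 < t then t * F (t⁻¹ • P) else recession F P

namespace IsDensity

variable {n M : ℕ} {F : Tens n M → ℝ} {ν₁ ν₂ ν₃ : ℝ}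

lemma differentiable (hF : IsDensity F ν₁ ν₂ ν₃) : Differentiable ℝ F :=
  hF.contDiff.differentiable (by norm_num)

lemma tangent_le (hF : IsDensity F ν₁ ν₂ ν₃) (P Q : Tens n M) :
    F Q + fderiv ℝ F Q (P - Q) ≤ F P := by
  have hc : ConvexOn ℝ univ (fun s : ℝ => F (Q + s • (P - Q))) := by
    have := hF.strictConvex.convexOn.comp_affineMap (AffineMap.lineMap Q P)
    rw [preimage_univ] at this
    have e : (fun s : ℝ => F (Q + s • (P - Q))) = F ∘ AffineMap.lineMap Q P := by
      ext s; simp [AffineMap.lineMap_apply, add_comm]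
    rwa [e]
  have hd : HasDerivAt (fun s : ℝ => F (Q + s • (P - Q))) (fderiv ℝ F Q (P - Q)) 0 := by
    have h1 : HasDerivAt (fun s : ℝ => Q + s • (P - Q)) (P - Q) 0 := by
      simpa using ((hasDerivAt_id (0 : ℝ)).smul_const (P - Q)).const_add Q
    have h2 : HasFDerivAt F (fderiv ℝ F Q) (Q + (0 : ℝ) • (P - Q)) := by
      simpa using (hF.differentiable Q).hasFDerivAt
    exact h2.comp_hasDerivAt 0 h1
  have := hc.le_slope_of_hasDerivAt (mem_univ _) (mem_univ 1) one_pos hd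
  simp only [slope_def_field, one_smul, add_sub_cancel, zero_smul, add_zero, sub_zero,
    div_one] at this
  linarith

lemma abs_sub_le (hF : IsDensity F ν₁ ν₂ ν₃) (P Q : Tens n M) :
    |F P - F Q| ≤ ν₁ * ‖P - Q‖ :=
  convex_univ.norm_image_sub_le_of_norm_fderiv_le (fun x _ => hF.differentiable x)
    (fun x _ => hF.norm_fderiv_le x) (mem_univ Q) (mem_univ P)

lemma le_add (hF : IsDensity F ν₁ ν₂ ν₃) (P Q : Tens n M) :
    F (P + Q) ≤ F P + ν₁ * ‖Q‖ := by
  have := (abs_le.1 (hF.abs_sub_le (P + Q) P)).2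
  simp at this
  linarith

lemma le_norm (hF : IsDensity F ν₁ ν₂ ν₃) (P : Tens n M) : F P ≤ ν₁ * ‖P‖ := by
  have := hF.le_add 0 P
  simpa [hF.map_zero] using this

/-- As `F 0 = 0`, the quotient is the slope of a chord that starts at the origin, and such slopes
increase for a convex function. -/
lemma div_mono (hF : IsDensity F ν₁ ν₂ ν₃) (P : Tens n M) {s t : ℝ} (hs : 0 < s) (hst : s ≤ t) :
    F (s • P) / s ≤ F (t • P) / t := by
  have ht : 0 < t := hs.trans_le hst
  have := hF.strictConvex.convexOn.2 (mem_univ (t • P)) (mem_univ 0)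
    (show 0 ≤ s / t by positivity) (show 0 ≤ 1 - s / t by rw [sub_nonneg, div_le_one ht]; exact hst)
    (by ring)
  simp only [smul_zero, add_zero, smul_smul, hF.map_zero, smul_eq_mul, mul_zero] at this
  rw [div_mul_cancel₀ _ ht.ne'] at this
  rw [div_le_div_iff₀ hs ht]
  calc F (s • P) * t ≤ (s / t * F (t • P)) * t := by gcongr
    _ = F (t • P) * s := by field_simp

lemma tendsto_recession (hF : IsDensity F ν₁ ν₂ ν₃) (P : Tens n M) :
    Tendsto (fun t : ℝ => F (t • P) / t) atTop (𝓝 (recession F P)) := by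
  have h : ∃ l, Tendsto (fun t : ℝ => F (t • P) / t) atTop (𝓝 l) := by
    -- `div_mono` needs positive arguments; `max t 1` makes the quotient monotone on the whole line
    -- without changing it for large `t`.
    have hm : Monotone fun t : ℝ => F (max t 1 • P) / max t 1 := fun s t hst =>
      hF.div_mono P (by positivity) (max_le_max_right 1 hst)
    refine ⟨_, (tendsto_atTop_ciSup hm ⟨ν₁ * ‖P‖, ?_⟩).congr' ?_⟩
    · rintro _ ⟨t, rfl⟩
      have h1 : (0 : ℝ) < max t 1 := by positivity
      simp only
      rw [div_le_iff₀ h1]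
      refine (hF.le_norm _).trans ?_
      rw [norm_smul, Real.norm_of_nonneg h1.le]
      apply le_of_eq; ring
    · filter_upwards [eventually_ge_atTop 1] with t ht
      rw [max_eq_left ht]
  exact tendsto_nhds_limUnder h

/-- The tangent inequality at `t • P`, divided by `t`: its constant term disappears as `t → ∞`. -/
lemma le_recession (hF : IsDensity F ν₁ ν₂ ν₃) (P Q : Tens n M) :
    fderiv ℝ F Q P ≤ recession F P := by
  have h1 : Tendsto (fun t : ℝ => (F Q - fderiv ℝ F Q Q) / t + fderiv ℝ F Q P) atTop
      (𝓝 (0 + fderiv ℝ F Q P)) :=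
    (tendsto_const_nhds.div_atTop tendsto_id).add tendsto_const_nhds
  rw [zero_add] at h1
  refine le_of_tendsto_of_tendsto h1 (hF.tendsto_recession P) ?_
  filter_upwards [eventually_gt_atTop 0] with t ht
  have := hF.tangent_le (t • P) Q
  rw [map_sub, map_smul, smul_eq_mul] at this
  rw [div_add' _ _ _ ht.ne']
  gcongr
  linarith

/-- The perspective function lies above all its tangents. -/
lemma tangent_le_persp (hF : IsDensity F ν₁ ν₂ ν₃) (P Q : Tens n M) {t : ℝ} (ht : 0 ≤ t) :
    t * (F Q - fderiv ℝ F Q Q) + fderiv ℝ F Q P ≤ persp F P t := by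
  unfold persp
  split_ifs with h
  · have := hF.tangent_le (t⁻¹ • P) Q
    rw [map_sub, map_smul, smul_eq_mul] at this
    calc _ = t * (F Q + (t⁻¹ * fderiv ℝ F Q P - fderiv ℝ F Q Q)) := by field_simp; ring
      _ ≤ _ := by gcongr
  · obtain rfl : t = 0 := le_antisymm (not_lt.1 h) ht
    simpa using hF.le_recession P Q

lemma recession_le (hF : IsDensity F ν₁ ν₂ ν₃) {P : Tens n M} {y : ℝ}
    (h : ∀ Q, fderiv ℝ F Q P ≤ y) : recession F P ≤ y := by
  refine le_of_tendsto (hF.tendsto_recession P) ?_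
  filter_upwards [eventually_gt_atTop 0] with t ht
  -- The tangent at `t • P`, evaluated at `0` where `F` vanishes, gives `F (t • P) ≤ t * DF(t • P)
  -- P`.
  have := hF.tangent_le 0 (t • P)
  rw [hF.map_zero, zero_sub, map_neg, map_smul, smul_eq_mul] at this
  rw [div_le_iff₀ ht]
  nlinarith [h (t • P)]

/-- The perspective function is the supremum of its tangents. -/
lemma persp_le (hF : IsDensity F ν₁ ν₂ ν₃) {P : Tens n M} {t y : ℝ} (ht : 0 ≤ t)
    (h : ∀ Q, t * (F Q - fderiv ℝ F Q Q) + fderiv ℝ F Q P ≤ y) : persp F P t ≤ y := by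
  unfold persp
  split_ifs with h0
  -- For `t > 0` the tangent at `t⁻¹ • P` touches, so the supremum is attained there.
  · have := h (t⁻¹ • P)
    rw [map_smul, smul_eq_mul] at this
    calc t * F (t⁻¹ • P) = _ := by field_simp; ring
      _ ≤ y := this
  · obtain rfl : t = 0 := le_antisymm (not_lt.1 h0) ht
    exact hF.recession_le (by simpa using h)

/-- Countably many tangents suffice to recover the perspective function. -/
lemma persp_le_of_denseSeq (hF : IsDensity F ν₁ ν₂ ν₃) {P : Tens n M} {t y : ℝ} (ht : 0 ≤ t)
    (h : ∀ k, t * (F (TopologicalSpace.denseSeq (Tens n M) k) -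
      fderiv ℝ F (TopologicalSpace.denseSeq (Tens n M) k) (TopologicalSpace.denseSeq (Tens n M) k)) +
      fderiv ℝ F (TopologicalSpace.denseSeq (Tens n M) k) P ≤ y) : persp F P t ≤ y := by
  refine hF.persp_le ht fun Q => ?_
  have hcf : Continuous (fderiv ℝ F) := hF.contDiff.continuous_fderiv (by norm_num)
  -- Since `F` is of class `C¹`, the tangents depend continuously on `Q`, and a bound on a dense set
  -- of `Q` holds for all `Q`.
  have hcl : IsClosed {Q : Tens n M | t * (F Q - fderiv ℝ F Q Q) + fderiv ℝ F Q P ≤ y} := by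
    apply isClosed_le _ continuous_const
    have := hF.contDiff.continuous
    fun_prop
  have := (TopologicalSpace.denseRange_denseSeq (Tens n M)).closure_range
  have hsub : closure (range (TopologicalSpace.denseSeq (Tens n M))) ⊆ _ := hcl.closure_subset_iff.2 (by
    rintro _ ⟨k, rfl⟩; exact h k)
  rw [this] at hsub
  exact hsub (mem_univ Q)

/-- All tangents have slope at most `ν₁` in `P`, hence so does their supremum, uniformly in `t`. -/
lemma persp_le_add (hF : IsDensity F ν₁ ν₂ ν₃) (P Q : Tens n M) {t : ℝ} (ht : 0 ≤ t) :
    persp F P t ≤ persp F Q t + ν₁ * ‖P - Q‖ := by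
  refine hF.persp_le ht fun R => ?_
  have h1 := hF.tangent_le_persp Q R ht
  have h2 : fderiv ℝ F R (P - Q) ≤ ν₁ * ‖P - Q‖ :=
    (le_abs_self _).trans ((fderiv ℝ F R).le_of_opNorm_le (hF.norm_fderiv_le R) _)
  rw [map_sub] at h2
  linarith

/-- The tangent at `Q = 0` is identically zero, because `F` has its minimum `0` there. -/
lemma persp_nonneg (hF : IsDensity F ν₁ ν₂ ν₃) (P : Tens n M) {t : ℝ} (ht : 0 ≤ t) :
    0 ≤ persp F P t := by
  have h := hF.tangent_le_persp P 0 ht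
  have h0 : fderiv ℝ F 0 = 0 :=
    IsLocalMin.fderiv_eq_zero (Eventually.of_forall fun Q => by
      simpa only [hF.map_zero] using hF.nonneg Q)
  simpa [h0, hF.map_zero] using h

lemma persp_zero (hF : IsDensity F ν₁ ν₂ ν₃) {t : ℝ} (ht : 0 ≤ t) :
    persp F (0 : Tens n M) t = 0 := by
  refine le_antisymm (hF.persp_le ht fun Q => ?_) (hF.persp_nonneg 0 ht)
  have := hF.tangent_le 0 Q
  rw [hF.map_zero, zero_sub, map_neg] at this
  rw [_root_.map_zero, add_zero]
  exact mul_nonpos_of_nonneg_of_nonpos ht (by linarith)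

lemma persp_le_norm (hF : IsDensity F ν₁ ν₂ ν₃) (P : Tens n M) {t : ℝ} (ht : 0 ≤ t) :
    persp F P t ≤ ν₁ * ‖P‖ := by
  simpa [hF.persp_zero ht] using hF.persp_le_add P 0 ht

lemma persp_one (P : Tens n M) : persp F P 1 = F P := by simp [persp]

lemma persp_zero_right (P : Tens n M) : persp F P 0 = recession F P := by simp [persp]

/-- Each tangent is linear in `(P, t)`. This homogeneity is what frees the energy from the choice of
the reference measure. -/
lemma persp_smul (hF : IsDensity F ν₁ ν₂ ν₃) (P : Tens n M) {r t : ℝ} (hr : 0 ≤ r) (ht : 0 ≤ t) :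
    persp F (r • P) (r * t) = r * persp F P t := by
  rcases hr.eq_or_lt with rfl | hr0
  · simp [hF.persp_zero le_rfl]
  apply le_antisymm
  · refine hF.persp_le (by positivity) fun Q => ?_
    rw [map_smul, smul_eq_mul, mul_assoc, ← mul_add]
    gcongr
    exact hF.tangent_le_persp P Q ht
  · rw [← le_div_iff₀' hr0]
    refine hF.persp_le ht fun Q => ?_
    rw [le_div_iff₀' hr0, mul_add, ← mul_assoc]
    have := hF.tangent_le_persp (r • P) Q (mul_nonneg hr ht)
    simpa using this

lemma persp_add_le (hF : IsDensity F ν₁ ν₂ ν₃) (P Q : Tens n M) {t : ℝ} (ht : 0 ≤ t) :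
    persp F ((2⁻¹ : ℝ) • (P + Q)) t ≤ 2⁻¹ * persp F P t + 2⁻¹ * persp F Q t := by
  refine hF.persp_le ht fun R => ?_
  have h1 := hF.tangent_le_persp P R ht
  have h2 := hF.tangent_le_persp Q R ht
  rw [map_smul, map_add, smul_eq_mul]
  linarith

/-- Strictness needs `t > 0`: at `t = 0` the function is the recession function, which is linear
along rays. Hence nothing is claimed about the singular parts of minimizers. -/
lemma persp_add_lt (hF : IsDensity F ν₁ ν₂ ν₃) {P Q : Tens n M} {t : ℝ} (ht : 0 < t)
    (hPQ : P ≠ Q) :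
    persp F ((2⁻¹ : ℝ) • (P + Q)) t < 2⁻¹ * persp F P t + 2⁻¹ * persp F Q t := by
  have h := hF.strictConvex.2 (mem_univ (t⁻¹ • P)) (mem_univ (t⁻¹ • Q))
    (fun h => hPQ (smul_right_injective _ (inv_ne_zero ht.ne') h))
    (show (0 : ℝ) < 2⁻¹ by norm_num) (show (0 : ℝ) < 2⁻¹ by norm_num) (by norm_num)
  simp only [persp, ht, if_true]
  have e : t⁻¹ • (2⁻¹ : ℝ) • (P + Q) = (2⁻¹ : ℝ) • t⁻¹ • P + (2⁻¹ : ℝ) • t⁻¹ • Q := by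
    module
  rw [e]
  have := mul_lt_mul_of_pos_left h ht
  simp only [smul_eq_mul] at this
  linarith

lemma continuous_recession (hF : IsDensity F ν₁ ν₂ ν₃) : Continuous (recession F) := by
  have h : ∀ P Q : Tens n M, |recession F P - recession F Q| ≤ ν₁ * ‖P - Q‖ := fun P Q => by
    have h1 := hF.persp_le_add P Q le_rfl
    have h2 := hF.persp_le_add Q P le_rfl
    simp only [persp_zero_right] at h1 h2
    rw [norm_sub_rev] at h2
    rw [abs_le]; constructor <;> linarith
  have hν : 0 ≤ ν₁ := (norm_nonneg _).trans (hF.norm_fderiv_le 0)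
  refine LipschitzWith.continuous (K := ν₁.toNNReal) (LipschitzWith.of_dist_le_mul fun P Q => ?_)
  rw [Real.dist_eq, dist_eq_norm, Real.coe_toNNReal _ hν]
  exact h P Q

lemma measurable_persp (hF : IsDensity F ν₁ ν₂ ν₃) :
    Measurable fun z : Tens n M × ℝ => persp F z.1 z.2 := by
  unfold persp
  refine Measurable.ite (measurableSet_lt measurable_const measurable_snd) ?_
    (hF.continuous_recession.measurable.comp measurable_fst)
  exact measurable_snd.mul (hF.contDiff.continuous.measurable.comp
    (measurable_snd.inv.smul measurable_fst))

lemma norm_le (hF : IsDensity F ν₁ ν₂ ν₃) (hν₂ : 0 < ν₂) (P : Tens n M) :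
    ‖P‖ ≤ ν₂⁻¹ * (F P + ν₃) := by
  rw [le_inv_mul_iff₀ hν₂]
  linarith [hF.lower P]

lemma nu_one_nonneg (hF : IsDensity F ν₁ ν₂ ν₃) : 0 ≤ ν₁ :=
  (norm_nonneg _).trans (hF.norm_fderiv_le 0)

lemma nu_three_nonneg (hF : IsDensity F ν₁ ν₂ ν₃) : 0 ≤ ν₃ := by
  have := hF.lower 0
  simp [hF.map_zero] at this
  linarith

lemma continuous (hF : IsDensity F ν₁ ν₂ ν₃) : Continuous F := hF.contDiff.continuous

lemma integrable_comp (hF : IsDensity F ν₁ ν₂ ν₃) {α : Type*} [MeasurableSpace α] {μ : Measure α}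
    {G : α → Tens n M} (hG : Integrable G μ) : Integrable (fun x => F (G x)) μ := by
  refine (hG.norm.const_mul ν₁).mono' (hF.continuous.comp_aestronglyMeasurable hG.1)
    (Eventually.of_forall fun x => ?_)
  rw [Real.norm_of_nonneg (hF.nonneg _)]
  exact hF.le_norm _

lemma integrable_persp (hF : IsDensity F ν₁ ν₂ ν₃) {α : Type*} [MeasurableSpace α] {μ : Measure α}
    {p : α → Tens n M} {t : α → ℝ} (hp : Integrable p μ) (ht : AEMeasurable t μ)
    (ht0 : 0 ≤ᵐ[μ] t) : Integrable (fun x => persp F (p x) (t x)) μ := by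
  refine (hp.norm.const_mul ν₁).mono'
    (hF.measurable_persp.comp_aemeasurable (hp.1.aemeasurable.prodMk ht)).aestronglyMeasurable ?_
  filter_upwards [ht0] with x hx
  rw [Real.norm_of_nonneg (hF.persp_nonneg _ hx)]
  exact hF.persp_le_norm _ hx

end IsDensity

end Inpainting

/-! ### Vector measures with components, and integration against a density. -/

namespace Inpainting

open scoped ENNReal NNReal

section VectorMeasure

variable {α ι : Type*} [MeasurableSpace α] [Fintype ι]

lemma comp_apply (ρ : VectorMeasure α (EuclideanSpace ℝ ι)) (k : ι) (A : Set α) :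
    comp ρ k A = ρ A k := rfl

lemma ofComponents_apply (s : ι → SignedMeasure α) (A : Set α) (k : ι) :
    ofComponents s A k = s k A := rfl

lemma comp_ofComponents (s : ι → SignedMeasure α) (k : ι) : comp (ofComponents s) k = s k := by
  ext A _
  rw [comp_apply, ofComponents_apply]

lemma enorm_le_sum (x : EuclideanSpace ℝ ι) : ‖x‖ₑ ≤ ∑ k, ‖x k‖ₑ := by
  classical
  have h : x = ∑ k, EuclideanSpace.single k (x k) := by
    ext j
    simp [Finset.sum_apply, Pi.single_apply]
  calc ‖x‖ₑ = ‖∑ k, EuclideanSpace.single k (x k)‖ₑ := by rw [← h]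
    _ ≤ ∑ k, ‖EuclideanSpace.single k (x k)‖ₑ := enorm_sum_le _ _
    _ = ∑ k, ‖x k‖ₑ := by
      refine Finset.sum_congr rfl fun k _ => ?_
      rw [← ofReal_norm, ← ofReal_norm, PiLp.norm_single]

lemma enorm_apply_le (x : EuclideanSpace ℝ ι) (k : ι) : ‖x k‖ₑ ≤ ‖x‖ₑ := by
  rw [← ofReal_norm, ← ofReal_norm]
  exact ENNReal.ofReal_le_ofReal (PiLp.norm_apply_le x k)

/-- Yields finiteness of the variation, because signed measures have finite total variation. -/
lemma variation_le_sum (ρ : VectorMeasure α (EuclideanSpace ℝ ι)) :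
    ρ.variation ≤ ∑ k, (comp ρ k).totalVariation := by
  refine VectorMeasure.variation_le_of_forall_enorm_le fun A _ => ?_
  rw [Measure.finsetSum_apply]
  refine (enorm_le_sum _).trans (Finset.sum_le_sum fun k _ => ?_)
  exact SignedMeasure.enorm_le_totalVariation (comp ρ k) A

lemma totalVariation_comp_le (ρ : VectorMeasure α (EuclideanSpace ℝ ι)) (k : ι) :
    (comp ρ k).totalVariation ≤ ρ.variation := by
  rw [SignedMeasure.totalVariation_eq_variation]
  refine VectorMeasure.variation_le_of_forall_enorm_le fun A _ => ?_
  exact (enorm_apply_le (ρ A) k).trans (ρ.enorm_measure_le_variation A)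

instance isFiniteMeasure_totalVariation (s : SignedMeasure α) : IsFiniteMeasure s.totalVariation := by
  unfold SignedMeasure.totalVariation
  infer_instance

lemma isFiniteMeasure_variation (ρ : VectorMeasure α (EuclideanSpace ℝ ι)) :
    IsFiniteMeasure ρ.variation :=
  isFiniteMeasure_of_le _ (variation_le_sum ρ)

/-- Integration against the vector measure `p m`. -/
lemma integral_withDensity_vec {E : Type*} [NormedAddCommGroup E] [NormedSpace ℝ E]
    [CompleteSpace E] {m : Measure α} {p : α → E} (hp : Integrable p m) {φ : α → ℝ}
    (hφ : Integrable φ (m.withDensity fun x => ‖p x‖ₑ)) :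
    (m.withDensityᵥ p).integral φ (ContinuousLinearMap.lsmul ℝ ℝ) = ∫ x, φ x • p x ∂m := by
  have hpm : AEMeasurable (fun x => ‖p x‖₊) m := hp.1.nnnorm.aemeasurable
  have hint : ∀ {f : α → ℝ}, Integrable f (m.withDensity fun x => ‖p x‖ₑ) →
      Integrable (fun x => f x • p x) m := by
    intro f hf
    have h1 := (integrable_withDensity_iff_integrable_smul₀ hpm).1 hf
    -- Only for the measure `‖p‖ m` is `f` known to be measurable, so `f p` is written as `(‖p‖ f)
    -- (‖p‖⁻¹ p)`.
    have h2 : AEStronglyMeasurable (fun x => f x • p x) m := by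
      have hs : AEStronglyMeasurable (fun x => ‖p x‖⁻¹ • p x) m :=
        (hp.1.norm.aemeasurable.inv.aestronglyMeasurable).smul hp.1
      refine (h1.1.smul hs).congr (Eventually.of_forall fun x => ?_)
      change (‖p x‖ * f x) • ‖p x‖⁻¹ • p x = f x • p x
      by_cases h0 : p x = 0
      · simp [h0]
      · rw [smul_smul]; congr 1; field_simp
    refine h1.mono h2 (Eventually.of_forall fun x => ?_)
    change ‖f x • p x‖ ≤ ‖‖p x‖ * f x‖
    rw [norm_smul, norm_mul, norm_norm, mul_comm]
  have hvar := Measure.variation_withDensityᵥ hp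
  have hfin : IsFiniteMeasure (m.withDensity fun x => ‖p x‖ₑ) :=
    isFiniteMeasure_withDensity hp.2.ne
  have hfin' : IsFiniteMeasure (m.withDensityᵥ p).variation := by rw [hvar]; exact hfin
  -- The variation of `p m` is `‖p‖ m`, and both sides are continuous for its `L¹` norm, so
  -- indicators suffice.
  refine Integrable.induction (μ := m.withDensity fun x => ‖p x‖ₑ)
    (fun f => (m.withDensityᵥ p).integral f (ContinuousLinearMap.lsmul ℝ ℝ) = ∫ x, f x • p x ∂m)
    ?_ ?_ ?_ ?_ hφ
  · intro c s hs _
    rw [VectorMeasure.integral_indicator hs, VectorMeasure.setIntegral_const,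
      withDensityᵥ_apply hp hs]
    have : ∀ x, s.indicator (fun _ => c) x • p x = s.indicator (fun x => c • p x) x := fun x => by
      by_cases hx : x ∈ s <;> simp [hx]
    simp_rw [this]
    rw [MeasureTheory.integral_indicator hs, integral_smul]
    rfl
  · intro f g _ hf hg h1 h2
    have hf' : (m.withDensityᵥ p).Integrable f := by
      unfold VectorMeasure.Integrable; rwa [hvar]
    have hg' : (m.withDensityᵥ p).Integrable g := by
      unfold VectorMeasure.Integrable; rwa [hvar]
    rw [VectorMeasure.integral_add hf' hg', h1, h2, ← MeasureTheory.integral_add (hint hf) (hint hg)]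
    simp [add_smul]
  · have h1 : Continuous fun f : α →₁[m.withDensity fun x => ‖p x‖ₑ] ℝ =>
        (m.withDensityᵥ p).integral f (ContinuousLinearMap.lsmul ℝ ℝ) := by
      have := VectorMeasure.continuous_integral (μ := m.withDensityᵥ p)
        (B := ContinuousLinearMap.lsmul ℝ ℝ (E := E))
      rwa [hvar] at this
    have h2 : Continuous fun f : α →₁[m.withDensity fun x => ‖p x‖ₑ] ℝ =>
        ∫ x, f x • p x ∂m := by
      refine LipschitzWith.continuous (K := 1) (LipschitzWith.of_dist_le_mul fun f g => ?_)
      have hf := L1.integrable_coeFn f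
      have hg := L1.integrable_coeFn g
      rw [dist_eq_norm, ← MeasureTheory.integral_sub (hint hf) (hint hg), dist_eq_norm,
        L1.norm_eq_integral_norm, NNReal.coe_one, one_mul]
      have h3 : ∫ x, ‖(f - g) x‖ ∂(m.withDensity fun x => ‖p x‖ₑ) =
          ∫ x, ‖f x - g x‖ ∂(m.withDensity fun x => ‖p x‖ₑ) :=
        integral_congr_ae (by filter_upwards [Lp.coeFn_sub f g] with x hx; rw [hx]; rfl)
      have h4 : ∫ x, ‖f x - g x‖ ∂(m.withDensity fun x => ‖p x‖ₑ) =
          ∫ x, ‖p x‖₊ • ‖f x - g x‖ ∂m :=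
        integral_withDensity_eq_integral_smul₀ hpm _
      rw [h3, h4]
      refine (norm_integral_le_integral_norm _).trans (le_of_eq (integral_congr_ae
        (Eventually.of_forall fun x => ?_)))
      change ‖f x • p x - g x • p x‖ = ‖p x‖ * ‖f x - g x‖
      rw [← sub_smul, norm_smul, mul_comm]
    exact isClosed_eq h1 h2
  · intro f g hfg _ h
    rw [← VectorMeasure.integral_congr_ae (μ := m.withDensityᵥ p) (hvar ▸ hfg), h]
    have := (ae_withDensity_iff_ae_restrict' hp.1.enorm).1 hfg
    rw [ae_restrict_iff'₀ (by exact hp.1.enorm.nullMeasurable (measurableSet_singleton 0).compl)] at this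
    refine integral_congr_ae ?_
    filter_upwards [this] with x hx
    by_cases h0 : p x = 0
    · simp [h0]
    · rw [hx (by simpa using h0)]

end VectorMeasure

end Inpainting

/-! ### Representing gradients over a common reference measure. -/

namespace Inpainting

open scoped ENNReal NNReal

section GradRep

/-- A shortcut that keeps the instance search short. -/
instance haveLebesgueDecomposition_vec {n : ℕ} (m m' : Measure (Vec n)) [IsFiniteMeasure m]
    [IsFiniteMeasure m'] : m.HaveLebesgueDecomposition m' :=
  Measure.haveLebesgueDecomposition_of_finiteMeasure

variable {n M : ℕ} {Ω : Set (Vec n)} {u v : Vec n → Vec M}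

/-- `p m` is the gradient measure of `u` on `Ω`, for a finite measure `m` on `Ω` with respect to
which Lebesgue measure on `Ω` has the density `t`. -/
structure GradRep (Ω : Set (Vec n)) (u : Vec n → Vec M) (m : Measure (Vec n))
    (p : Vec n → Tens n M) (t : Vec n → ℝ) : Prop where
  finite : IsFiniteMeasure m
  compl : m Ωᶜ = 0
  int_p : Integrable p m
  int_t : Integrable t m
  t_nonneg : 0 ≤ᵐ[m] t
  vol : volume.restrict Ω = m.withDensity fun x => ENNReal.ofReal (t x)
  grad : ∀ φ : Vec n → ℝ, IsTest Ω φ → ∀ (j : Fin M) (i : Fin n),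
    ∫ x in Ω, u x j * partialDeriv i φ x = - ∫ x, φ x * p x (j, i) ∂m

lemma IsTest.exists_bound {φ : Vec n → ℝ} (hφ : IsTest Ω φ) : ∃ C, ∀ x, ‖φ x‖ ≤ C :=
  hφ.2.1.exists_bound_of_continuous hφ.1.continuous

lemma IsTest.integrable {φ : Vec n → ℝ} (hφ : IsTest Ω φ) (μ : Measure (Vec n))
    [IsFiniteMeasure μ] : Integrable φ μ := by
  obtain ⟨C, hC⟩ := hφ.exists_bound
  exact Integrable.of_bound hφ.1.continuous.aestronglyMeasurable C (Eventually.of_forall hC)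

lemma IsTest.integrable_mul {φ : Vec n → ℝ} (hφ : IsTest Ω φ) {μ : Measure (Vec n)}
    {g : Vec n → ℝ} (hg : Integrable g μ) : Integrable (fun x => φ x * g x) μ := by
  obtain ⟨C, hC⟩ := hφ.exists_bound
  exact hg.bdd_mul hφ.1.continuous.aestronglyMeasurable (Eventually.of_forall hC)

lemma IsTest.continuous_partialDeriv {φ : Vec n → ℝ} (hφ : IsTest Ω φ) (i : Fin n) :
    Continuous (partialDeriv i φ) := by
  have := hφ.1.continuous_fderiv (by norm_num)
  unfold partialDeriv
  fun_prop

lemma IsTest.exists_bound_partialDeriv {φ : Vec n → ℝ} (hφ : IsTest Ω φ) (i : Fin n) :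
    ∃ C, ∀ x, ‖partialDeriv i φ x‖ ≤ C := by
  have h : HasCompactSupport (partialDeriv i φ) :=
    (hφ.2.1.fderiv (𝕜 := ℝ)).comp_left (g := fun L : Vec n →L[ℝ] ℝ => L (EuclideanSpace.single i 1))
      rfl
  exact h.exists_bound_of_continuous (hφ.continuous_partialDeriv i)

lemma integrable_apply {μ : Measure (Vec n)} {ι : Type*} [Fintype ι] {g : Vec n → EuclideanSpace ℝ ι}
    (hg : Integrable g μ) (k : ι) : Integrable (fun x => g x k) μ :=
  (EuclideanSpace.proj k : EuclideanSpace ℝ ι →L[ℝ] ℝ).integrable_comp hg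

lemma integral_apply {μ : Measure (Vec n)} {ι : Type*} [Fintype ι] {g : Vec n → EuclideanSpace ℝ ι}
    (hg : Integrable g μ) (k : ι) : (∫ x, g x ∂μ) k = ∫ x, g x k ∂μ :=
  ((EuclideanSpace.proj k : EuclideanSpace ℝ ι →L[ℝ] ℝ).integral_comp_comm hg).symm

lemma integrable_of_apply {μ : Measure (Vec n)} {ι : Type*} [Fintype ι]
    {g : Vec n → EuclideanSpace ℝ ι} (hg : ∀ k, Integrable (fun x => g x k) μ) :
    Integrable g μ := by
  have h : Integrable (fun x => fun k => g x k) μ := Integrable.of_eval hg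
  exact (PiLp.continuousLinearEquiv 2 ℝ (fun _ : ι => ℝ)).symm.toContinuousLinearMap.integrable_comp h

lemma GradRep.isGradMeasure {m : Measure (Vec n)} {p : Vec n → Tens n M} {t : Vec n → ℝ}
    (h : GradRep Ω u m p t) : IsGradMeasure Ω u (m.withDensityᵥ p) := by
  have := h.finite
  refine ⟨?_, fun φ hφ j i => ?_⟩
  · rw [Measure.variation_withDensityᵥ h.int_p]
    exact withDensity_absolutelyContinuous _ _ h.compl
  · have hfin : IsFiniteMeasure (m.withDensity fun x => ‖p x‖ₑ) :=
      isFiniteMeasure_withDensity h.int_p.2.ne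
    obtain ⟨C, hC⟩ := hφ.exists_bound
    rw [h.grad φ hφ j i, integral_withDensity_vec h.int_p (hφ.integrable _), integral_apply]
    · rfl
    · exact h.int_p.bdd_smul C hφ.1.continuous.aestronglyMeasurable (Eventually.of_forall hC)

/-- The density `t` is determined by `Ω` and `m` alone, so two different functions represented over
`m` share it. -/
lemma GradRep.density_eq {m : Measure (Vec n)} {p p' : Vec n → Tens n M} {t t' : Vec n → ℝ}
    (h : GradRep Ω u m p t) (h' : GradRep Ω v m p' t') : t =ᵐ[m] t' := by
  have := h.finite
  have hf : (∫⁻ x, ENNReal.ofReal (t x) ∂m) ≠ ⊤ :=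
    ((lintegral_mono fun x => Real.ofReal_le_enorm _).trans_lt h.int_t.2).ne
  have e := (withDensity_eq_iff (μ := m) h.int_t.1.aemeasurable.ennreal_ofReal
    h'.int_t.1.aemeasurable.ennreal_ofReal hf).1 (h.vol.symm.trans h'.vol)
  filter_upwards [e, h.t_nonneg, h'.t_nonneg] with x hx h1 h2
  exact (ENNReal.ofReal_eq_ofReal_iff h1 h2).1 hx

/-- Test functions determine `p` on `Ω`, and `m` has no mass elsewhere. -/
lemma GradRep.unique {m : Measure (Vec n)} {p p' : Vec n → Tens n M} {t t' : Vec n → ℝ}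
    (hΩ : IsOpen Ω) (h : GradRep Ω u m p t) (h' : GradRep Ω u m p' t') :
    p =ᵐ[m] p' ∧ t =ᵐ[m] t' := by
  have := h.finite
  have hin : ∀ᵐ x ∂m, x ∈ Ω := by
    rw [ae_iff]; exact h.compl
  constructor
  · have key : ∀ k : Fin M × Fin n, ∀ᵐ x ∂m, p x k - p' x k = 0 := by
      rintro ⟨j, i⟩
      have h1 := integrable_apply h.int_p (j, i)
      have h2 := integrable_apply h'.int_p (j, i)
      have := hΩ.ae_eq_zero_of_integral_contDiff_smul_eq_zero (μ := m)
        (f := fun x => p x (j, i) - p' x (j, i))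
        ((h1.sub h2).locallyIntegrable.locallyIntegrableOn Ω) (fun φ hφ hc hs => by
          have ht : IsTest Ω φ := ⟨hφ, hc, hs⟩
          simp only [smul_eq_mul, mul_sub]
          rw [integral_sub (ht.integrable_mul h1) (ht.integrable_mul h2)]
          have e1 := h.grad φ ht j i
          have e2 := h'.grad φ ht j i
          linarith)
      filter_upwards [this, hin] with x hx hx' using hx hx'
    filter_upwards [ae_all_iff.2 key] with x hx
    ext k
    exact sub_eq_zero.1 (hx k)
  · exact h.density_eq h'

lemma GradRep.congr {m : Measure (Vec n)} {p : Vec n → Tens n M} {t : Vec n → ℝ}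
    (h : GradRep Ω u m p t) (huv : u =ᵐ[volume.restrict Ω] v) : GradRep Ω v m p t :=
  { h with
    grad := fun φ hφ j i => by
      rw [← h.grad φ hφ j i]
      refine integral_congr_ae ?_
      filter_upwards [huv] with x hx
      rw [hx] }

/-- The density of `m` with respect to a larger measure. -/
noncomputable def relDensity (m m' : Measure (Vec n)) (x : Vec n) : ℝ := (m.rnDeriv m' x).toReal

lemma relDensity_nonneg (m m' : Measure (Vec n)) (x : Vec n) : 0 ≤ relDensity m m' x :=
  ENNReal.toReal_nonneg

lemma integral_relDensity_smul {m m' : Measure (Vec n)} [IsFiniteMeasure m] [IsFiniteMeasure m']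
    (hm : m ≤ m') {E : Type*} [NormedAddCommGroup E] [NormedSpace ℝ E] (g : Vec n → E) :
    ∫ x, relDensity m m' x • g x ∂m' = ∫ x, g x ∂m :=
  integral_rnDeriv_smul (Measure.absolutelyContinuous_of_le hm)

lemma integrable_relDensity_smul {m m' : Measure (Vec n)} [IsFiniteMeasure m] [IsFiniteMeasure m']
    (hm : m ≤ m') {E : Type*} [NormedAddCommGroup E] [NormedSpace ℝ E] {g : Vec n → E}
    (hg : Integrable g m) : Integrable (fun x => relDensity m m' x • g x) m' :=
  (integrable_rnDeriv_smul_iff (Measure.absolutelyContinuous_of_le hm)).2 hg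

/-- Enlarging the reference measure multiplies both densities by the same factor, the density of `m`
in `m'`. Two representations can thus be brought to the sum of their measures. -/
lemma GradRep.change {m m' : Measure (Vec n)} {p : Vec n → Tens n M} {t : Vec n → ℝ}
    (h : GradRep Ω u m p t) [IsFiniteMeasure m'] (hm : m ≤ m') (hm' : m' Ωᶜ = 0) :
    GradRep Ω u m' (fun x => relDensity m m' x • p x) (fun x => relDensity m m' x * t x) := by
  have := h.finite
  have hac := Measure.absolutelyContinuous_of_le hm
  have hwd : m'.withDensity (m.rnDeriv m') = m := Measure.withDensity_rnDeriv_eq _ _ hac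
  -- Statements that hold `m`-a.e. pass to `m'` only where the factor is nonzero; elsewhere both new
  -- densities vanish anyway.
  have hae : ∀ {P : Vec n → Prop}, (∀ᵐ x ∂m, P x) → ∀ᵐ x ∂m', m.rnDeriv m' x ≠ 0 → P x := by
    intro P hP
    rw [← hwd] at hP
    exact (ae_withDensity_iff (Measure.measurable_rnDeriv _ _)).1 hP
  refine ⟨inferInstance, hm', integrable_relDensity_smul hm h.int_p,
    by simpa using integrable_relDensity_smul hm h.int_t, ?_, ?_, fun φ hφ j i => ?_⟩
  · filter_upwards [hae h.t_nonneg] with x hx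
    by_cases h0 : m.rnDeriv m' x = 0
    · simp [relDensity, h0]
    · exact mul_nonneg (relDensity_nonneg _ _ _) (hx h0)
  -- A measurable version of `t` is needed for the chain rule of densities.
  · obtain ⟨t₁, ht₁, htt⟩ := h.int_t.1.aemeasurable
    have e1 : m.withDensity (fun x => ENNReal.ofReal (t x)) =
        m.withDensity (fun x => ENNReal.ofReal (t₁ x)) :=
      withDensity_congr_ae (by filter_upwards [htt] with x hx; rw [hx])
    rw [h.vol, e1]
    conv_lhs => rw [← hwd]
    rw [← withDensity_mul _ (Measure.measurable_rnDeriv _ _) ht₁.ennreal_ofReal]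
    refine withDensity_congr_ae ?_
    filter_upwards [hae htt, Measure.rnDeriv_ne_top m m'] with x hx hx'
    by_cases h0 : m.rnDeriv m' x = 0
    · simp [relDensity, h0]
    · rw [hx h0, Pi.mul_apply, relDensity, ENNReal.ofReal_mul ENNReal.toReal_nonneg,
        ENNReal.ofReal_toReal hx']
  · rw [h.grad φ hφ j i, ← integral_relDensity_smul hm]
    congr 2
    ext x
    simp only [smul_eq_mul, PiLp.smul_apply]
    ring

lemma GradRep.integral_persp_change {F : Tens n M → ℝ} {ν₁ ν₂ ν₃ : ℝ} (hF : IsDensity F ν₁ ν₂ ν₃)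
    {m m' : Measure (Vec n)} {p : Vec n → Tens n M} {t : Vec n → ℝ}
    (h : GradRep Ω u m p t) [IsFiniteMeasure m'] (hm : m ≤ m') :
    ∫ x, persp F (relDensity m m' x • p x) (relDensity m m' x * t x) ∂m' =
      ∫ x, persp F (p x) (t x) ∂m := by
  have := h.finite
  have hac := Measure.absolutelyContinuous_of_le hm
  have hwd : m'.withDensity (m.rnDeriv m') = m := Measure.withDensity_rnDeriv_eq _ _ hac
  rw [← integral_relDensity_smul hm]
  have hP := h.t_nonneg
  rw [← hwd] at hP
  have := (ae_withDensity_iff (Measure.measurable_rnDeriv _ _)).1 hP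
  refine integral_congr_ae ?_
  filter_upwards [this] with x hx
  by_cases h0 : m.rnDeriv m' x = 0
  · simp [relDensity, h0, hF.persp_zero]
  · exact hF.persp_smul _ (relDensity_nonneg _ _ _) (hx h0)

/-- Over `m + m'` the two pairs of densities agree by uniqueness, and by homogeneity the passage to
`m + m'` leaves both integrals unchanged. -/
lemma GradRep.integral_persp_eq {F : Tens n M → ℝ} {ν₁ ν₂ ν₃ : ℝ} (hF : IsDensity F ν₁ ν₂ ν₃)
    (hΩ : IsOpen Ω) {m m' : Measure (Vec n)} {p p' : Vec n → Tens n M} {t t' : Vec n → ℝ}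
    (h : GradRep Ω u m p t) (h' : GradRep Ω u m' p' t') :
    ∫ x, persp F (p x) (t x) ∂m = ∫ x, persp F (p' x) (t' x) ∂m' := by
  have := h.finite
  have := h'.finite
  have h0 : (m + m') Ωᶜ = 0 := by simp [h.compl, h'.compl]
  rw [← h.integral_persp_change hF (Measure.le_add_right le_rfl : m ≤ m + m'),
    ← h'.integral_persp_change hF (Measure.le_add_left le_rfl : m' ≤ m + m')]
  obtain ⟨e1, e2⟩ := (h.change (Measure.le_add_right le_rfl : m ≤ m + m') h0).unique hΩ
    (h'.change (Measure.le_add_left le_rfl : m' ≤ m + m') h0)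
  refine integral_congr_ae ?_
  filter_upwards [e1, e2] with x h1 h2
  rw [h1, h2]

end GradRep

end Inpainting

/-! ### The canonical representation and the energy it computes. -/

namespace Inpainting

section Canonical

variable {n M : ℕ} {Ω : Set (Vec n)} {u v : Vec n → Vec M}

lemma singular_variation_le (ρ : VectorMeasure (Vec n) (Tens n M)) :
    (singularPart ρ volume).variation ≤ ∑ k, ((comp ρ k).singularPart volume).totalVariation := by
  refine (variation_le_sum _).trans (le_of_eq (Finset.sum_congr rfl fun k _ => ?_))
  rw [singularPart, comp_ofComponents]

lemma singular_mutuallySingular (ρ : VectorMeasure (Vec n) (Tens n M)) :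
    (singularPart ρ volume).variation.MutuallySingular volume := by
  have h : (Measure.sum fun k => ((comp ρ k).singularPart volume).totalVariation).MutuallySingular
      volume := by
    refine Measure.MutuallySingular.sum_left.2 fun k => ?_
    rw [SignedMeasure.singularPart_totalVariation]
    exact (Measure.mutuallySingular_singularPart _ _).add_left
      (Measure.mutuallySingular_singularPart _ _)
  refine h.mono ?_ le_rfl
  rw [Measure.sum_fintype]
  exact singular_variation_le ρ

lemma singular_compl {ρ : VectorMeasure (Vec n) (Tens n M)} {A : Set (Vec n)}
    (h : ρ.variation A = 0) : (singularPart ρ volume).variation A = 0 := by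
  have h1 : ∀ k, ((comp ρ k).singularPart volume).totalVariation ≤ ρ.variation := fun k => by
    rw [SignedMeasure.singularPart_totalVariation]
    refine le_trans ?_ (totalVariation_comp_le ρ k)
    unfold SignedMeasure.totalVariation
    exact add_le_add (Measure.singularPart_le _ _) (Measure.singularPart_le _ _)
  refine le_antisymm ((singular_variation_le ρ A).trans ?_) bot_le
  rw [Measure.finsetSum_apply]
  exact (Finset.sum_eq_zero fun k _ => le_antisymm ((h1 k A).trans h.le) bot_le).le

/-- `polar` consists of Radon–Nikodym derivatives, which would forget singular parts; nothing is
lost here because each component is absolutely continuous with respect to the variation. -/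
lemma singular_withDensity (ρ : VectorMeasure (Vec n) (Tens n M)) (k : Fin M × Fin n) :
    (singularPart ρ volume).variation.withDensityᵥ
      (fun x => polar (singularPart ρ volume) x k) = (comp ρ k).singularPart volume := by
  have := isFiniteMeasure_variation (singularPart ρ volume)
  have hc : comp (singularPart ρ volume) k = (comp ρ k).singularPart volume := by
    rw [singularPart, comp_ofComponents]
  have hac : comp (singularPart ρ volume) k ≪ᵥ
      (singularPart ρ volume).variation.toENNRealVectorMeasure := by
    refine VectorMeasure.AbsolutelyContinuous.mk fun A hA h0 => ?_
    rw [Measure.toENNRealVectorMeasure_apply_measurable hA] at h0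
    have h1 := (singularPart ρ volume).enorm_measure_le_variation A
    rw [h0] at h1
    have h2 : singularPart ρ volume A = 0 := enorm_eq_zero.1 (le_antisymm h1 bot_le)
    rw [comp_apply, h2]
    rfl
  rw [← hc]
  exact (SignedMeasure.absolutelyContinuous_iff_withDensityᵥ_rnDeriv_eq _ _).1 hac

lemma integrable_density (ρ : VectorMeasure (Vec n) (Tens n M)) (μ : Measure (Vec n)) :
    Integrable (density ρ μ) μ :=
  integrable_of_apply fun k => SignedMeasure.integrable_rnDeriv (comp ρ k) μ

open Classical in
/-- The representation of a gradient measure over Lebesgue measure and the total variation of its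
singular part. -/
lemma IsGradMeasure.exists_gradRep {ρ : VectorMeasure (Vec n) (Tens n M)} (hΩ : IsOpen Ω)
    (hfin : volume Ω ≠ ⊤) (h : IsGradMeasure Ω u ρ) :
    ∃ E : Set (Vec n), MeasurableSet E ∧ volume E = 0 ∧
      (singularPart ρ volume).variation Eᶜ = 0 ∧
      GradRep Ω u (volume.restrict Ω + (singularPart ρ volume).variation)
        (E.piecewise (polar (singularPart ρ volume)) (density ρ volume))
        (Eᶜ.indicator fun _ => 1) := by
  -- A Lebesgue null set that carries the singular part: on `E` the density is the polar one and `t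
  -- = 0`, off `E` it is the absolutely continuous one and `t = 1`.
  obtain ⟨E, hE, hν, hvol⟩ : ∃ E : Set (Vec n), MeasurableSet E ∧
      (singularPart ρ volume).variation Eᶜ = 0 ∧ volume E = 0 := by
    obtain ⟨E', hE', hν', hvol'⟩ := singular_mutuallySingular ρ
    exact ⟨E'ᶜ, hE'.compl, by rwa [compl_compl], hvol'⟩
  set ν := (singularPart ρ volume).variation with hν_def
  have hνfin : IsFiniteMeasure ν := isFiniteMeasure_variation _
  have hΩfin : IsFiniteMeasure (volume.restrict Ω) := ⟨by simpa using hfin.lt_top⟩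
  set G := density ρ volume with hG_def
  set H := polar (singularPart ρ volume) with hH_def
  set p := E.piecewise H G with hp_def
  have hνΩ : ν Ωᶜ = 0 := singular_compl h.1
  have hG : Integrable G volume := integrable_density ρ volume
  have hH : Integrable H ν := integrable_density _ _
  have hpG : p =ᵐ[volume] G := by
    have : ∀ᵐ x ∂(volume : Measure (Vec n)), x ∉ E := measure_eq_zero_iff_ae_notMem.1 hvol
    filter_upwards [this] with x hx
    exact piecewise_eq_of_notMem _ _ _ hx
  have hpH : p =ᵐ[ν] H := by
    have : ∀ᵐ x ∂ν, x ∉ Eᶜ := measure_eq_zero_iff_ae_notMem.1 hν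
    filter_upwards [this] with x hx
    exact piecewise_eq_of_mem _ _ _ (notMem_compl_iff.1 hx)
  have hpG' : p =ᵐ[volume.restrict Ω] G := ae_restrict_of_ae hpG
  have hp1 : Integrable p (volume.restrict Ω) := hG.restrict.congr hpG'.symm
  have hp2 : Integrable p ν := hH.congr hpH.symm
  have hp : Integrable p (volume.restrict Ω + ν) := hp1.add_measure hp2
  have ht : AEMeasurable (Eᶜ.indicator fun _ => (1 : ℝ)) (volume.restrict Ω + ν) :=
    (measurable_const.indicator hE.compl).aemeasurable
  have hdens : (volume.restrict Ω + ν).withDensityᵥ p = ρ := by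
    ext A hA
    rename_i k
    rw [withDensityᵥ_apply hp hA, integral_apply hp.restrict]
    have e1 : ∀ B, MeasurableSet B → ρ B k = (comp ρ k).singularPart volume B +
        ∫ x in B, G x k := fun B hB => by
      have := (comp ρ k).singularPart_add_withDensity_rnDeriv_eq volume
      rw [← comp_apply]
      conv_lhs => rw [← this]
      rw [_root_.add_apply, withDensityᵥ_apply (SignedMeasure.integrable_rnDeriv _ _) hB]
      rfl
    have e2 : ∀ B, MeasurableSet B → (comp ρ k).singularPart volume B = ∫ x in B, H x k ∂ν :=
      fun B hB => by
        rw [← singular_withDensity ρ k, withDensityᵥ_apply (integrable_apply hH k) hB]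
    have e3 : ρ (A ∩ Ωᶜ) = 0 := by
      have h1 := ρ.enorm_measure_le_variation (A ∩ Ωᶜ)
      rw [measure_mono_null inter_subset_right h.1] at h1
      exact enorm_eq_zero.1 (le_antisymm h1 bot_le)
    have hB : MeasurableSet (A ∩ Ωᶜ) := hA.inter hΩ.measurableSet.compl
    -- The density `G` lives on all of `ℝⁿ`; outside `Ω` its integrals vanish because `ρ` and its
    -- singular part do.
    have e4 : ∫ x in A ∩ Ωᶜ, G x k = 0 := by
      have h1 := e1 _ hB
      rw [e2 _ hB, Measure.restrict_eq_zero.2 (measure_mono_null inter_subset_right hνΩ),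
        integral_zero_measure, e3] at h1
      simpa using h1.symm
    have e5 : ∫ x in A, G x k = ∫ x in A ∩ Ω, G x k := by
      rw [← integral_inter_add_sdiff hΩ.measurableSet (integrable_apply hG k).integrableOn,
        sdiff_eq, e4, add_zero]
    rw [e1 A hA, e2 A hA, e5, Measure.restrict_add,
      integral_add_measure (integrable_apply hp1.restrict k) (integrable_apply hp2.restrict k),
      Measure.restrict_restrict hA, add_comm]
    congr 1
    · refine integral_congr_ae (ae_restrict_of_ae ?_)
      filter_upwards [hpH] with x hx
      rw [hx]
    · refine integral_congr_ae (ae_restrict_of_ae ?_)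
      filter_upwards [hpG] with x hx
      rw [hx]
  refine ⟨E, hE, hvol, hν, inferInstance, ?_, hp, ?_, ?_, ?_, fun φ hφ j i => ?_⟩
  · simp [hνΩ, hΩ.measurableSet.compl]
  · exact (integrable_const (1 : ℝ)).indicator hE.compl
  · exact Eventually.of_forall fun x => indicator_nonneg (fun _ _ => zero_le_one) x
  · have : (fun x => ENNReal.ofReal (Eᶜ.indicator (fun _ => (1 : ℝ)) x)) =
        Eᶜ.indicator 1 := by
      ext x
      by_cases hx : x ∈ Eᶜ <;> simp [hx]
    rw [this, withDensity_indicator_one hE.compl, Measure.restrict_add,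
      Measure.restrict_eq_zero.2 hν, add_zero]
    refine (Measure.restrict_eq_self_of_ae_mem (ae_restrict_of_ae ?_)).symm
    exact measure_eq_zero_iff_ae_notMem.1 hvol
  · obtain ⟨C, hC⟩ := hφ.exists_bound
    have hfin' : IsFiniteMeasure ((volume.restrict Ω + ν).withDensity fun x => ‖p x‖ₑ) :=
      isFiniteMeasure_withDensity hp.2.ne
    rw [h.2 φ hφ j i, ← hdens, integral_withDensity_vec hp (hφ.integrable _), integral_apply]
    · rfl
    · exact hp.bdd_smul C hφ.1.continuous.aestronglyMeasurable (Eventually.of_forall hC)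

/-- The gradient part of the relaxed functional. -/
noncomputable def energy (Ω : Set (Vec n)) (F : Tens n M → ℝ) (w : Vec n → Vec M) : ℝ :=
  (∫ x in Ω, F (gradAC Ω w x)) +
  ∫ x in Ω, recession F (polar (gradSing Ω w) x) ∂(gradSing Ω w).variation

lemma functionalK_eq (Ω D : Set (Vec n)) (f : Vec n → Vec M) (F : Tens n M → ℝ)
    (lam ζ : ℝ) (w : Vec n → Vec M) :
    functionalK Ω D f F lam ζ w = energy Ω F w + fidelity Ω D f lam ζ w := rfl

lemma MemBV.isGradMeasure (h : MemBV Ω u) : IsGradMeasure Ω u (gradMeasure Ω u) := by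
  unfold gradMeasure
  rw [dif_pos h.2]
  exact h.2.choose_spec

lemma GradRep.memBV {m : Measure (Vec n)} {p : Vec n → Tens n M} {t : Vec n → ℝ}
    (h : GradRep Ω u m p t) (hu : MemLp u 1 (volume.restrict Ω)) : MemBV Ω u :=
  ⟨hu, _, h.isGradMeasure⟩

lemma GradRep.t_pos {m : Measure (Vec n)} {p : Vec n → Tens n M} {t : Vec n → ℝ}
    (h : GradRep Ω u m p t) : ∀ᵐ x ∂(volume.restrict Ω), 0 < t x := by
  rw [h.vol, ae_withDensity_iff' h.int_t.1.aemeasurable.ennreal_ofReal]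
  refine Eventually.of_forall fun x hx => ?_
  simpa using hx

lemma GradRep.absolutelyContinuous {m : Measure (Vec n)} {p : Vec n → Tens n M} {t : Vec n → ℝ}
    (h : GradRep Ω u m p t) : volume.restrict Ω ≪ m := by
  rw [h.vol]
  exact withDensity_absolutelyContinuous _ _

-- In the canonical representation `t` is `1` or `0`, so `persp F` is `F` on the absolutely
-- continuous part and the recession function on the singular part. The two integrals of `energy`
-- merge into one.
open Classical in
lemma MemBV.exists_gradRep (hΩ : IsOpen Ω) (hfin : volume Ω ≠ ⊤) (h : MemBV Ω u) :
    ∃ m p t, GradRep Ω u m p t ∧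
      (∀ (F : Tens n M → ℝ) (ν₁ ν₂ ν₃ : ℝ), IsDensity F ν₁ ν₂ ν₃ →
        energy Ω F u = ∫ x, persp F (p x) (t x) ∂m) ∧
      ∀ᵐ x ∂(volume.restrict Ω), p x = gradAC Ω u x ∧ t x = 1 := by
  obtain ⟨E, hE, hvol, hν, hrep⟩ := h.isGradMeasure.exists_gradRep hΩ hfin
  have a1 : ∀ᵐ x ∂(volume.restrict Ω), x ∉ E :=
    ae_restrict_of_ae (measure_eq_zero_iff_ae_notMem.1 hvol)
  refine ⟨_, _, _, hrep, fun F ν₁ ν₂ ν₃ hF => ?_, ?_⟩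
  · have hint := hF.integrable_persp hrep.int_p hrep.int_t.1.aemeasurable hrep.t_nonneg
    have hνΩ := singular_compl h.isGradMeasure.1
    rw [integral_add_measure hint.left_of_add_measure hint.right_of_add_measure]
    unfold energy
    congr 1
    · refine integral_congr_ae ?_
      filter_upwards [a1] with x hx
      rw [piecewise_eq_of_notMem _ _ _ hx, indicator_of_mem (mem_compl hx), IsDensity.persp_one]
      rfl
    · rw [Measure.restrict_eq_self_of_ae_mem (by
        have := measure_eq_zero_iff_ae_notMem.1 hνΩ
        filter_upwards [this] with x hx
        exact notMem_compl_iff.1 hx)]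
      refine integral_congr_ae ?_
      have := measure_eq_zero_iff_ae_notMem.1 hν
      filter_upwards [this] with x hx
      rw [piecewise_eq_of_mem _ _ _ (notMem_compl_iff.1 hx), indicator_of_notMem hx,
        IsDensity.persp_zero_right]
      rfl
  · filter_upwards [a1] with x hx
    rw [piecewise_eq_of_notMem _ _ _ hx, indicator_of_mem (mem_compl hx)]
    exact ⟨rfl, rfl⟩

/-- Computes the energy from an arbitrary representation, such as those of weak limits and
midpoints, whose Lebesgue decomposition is not at hand. -/
lemma GradRep.energy_eq {F : Tens n M → ℝ} {ν₁ ν₂ ν₃ : ℝ} (hF : IsDensity F ν₁ ν₂ ν₃)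
    (hΩ : IsOpen Ω) (hfin : volume Ω ≠ ⊤) {m : Measure (Vec n)} {p : Vec n → Tens n M}
    {t : Vec n → ℝ} (h : GradRep Ω u m p t) (hu : MemLp u 1 (volume.restrict Ω)) :
    energy Ω F u = ∫ x, persp F (p x) (t x) ∂m := by
  obtain ⟨m', p', t', h', he, -⟩ := (h.memBV hu).exists_gradRep hΩ hfin
  rw [he F ν₁ ν₂ ν₃ hF]
  exact h'.integral_persp_eq hF hΩ h

/-- The quotient `p / t` does not change when the reference measure grows, and in the canonical
representation it is `gradAC Ω u`. -/
lemma GradRep.gradAC_eq (hΩ : IsOpen Ω) (hfin : volume Ω ≠ ⊤) {m : Measure (Vec n)}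
    {p : Vec n → Tens n M} {t : Vec n → ℝ} (h : GradRep Ω u m p t)
    (hu : MemLp u 1 (volume.restrict Ω)) :
    gradAC Ω u =ᵐ[volume.restrict Ω] fun x => (t x)⁻¹ • p x := by
  obtain ⟨m', p', t', h', -, hac⟩ := (h.memBV hu).exists_gradRep hΩ hfin
  have := h.finite
  have := h'.finite
  have h0 : (m + m') Ωᶜ = 0 := by simp [h.compl, h'.compl]
  have c1 := h.change (Measure.le_add_right le_rfl : m ≤ m + m') h0
  have c2 := h'.change (Measure.le_add_left le_rfl : m' ≤ m + m') h0
  obtain ⟨e1, e2⟩ := c1.unique hΩ c2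
  filter_upwards [c1.absolutelyContinuous.ae_le e1, c1.absolutelyContinuous.ae_le e2, c1.t_pos,
    hac] with x h1 h2 h3 h4
  rw [h4.1] at h1
  rw [h4.2, mul_one] at h2
  rw [← h2] at h1
  have hr : relDensity m (m + m') x ≠ 0 := left_ne_zero_of_mul h3.ne'
  have ht : t x ≠ 0 := right_ne_zero_of_mul h3.ne'
  rw [mul_smul] at h1
  have h5 := smul_right_injective _ hr h1
  rw [h5, smul_smul, inv_mul_cancel₀ ht, one_smul]

lemma IsWeakGrad.gradRep (hΩ : IsOpen Ω) (hfin : volume Ω ≠ ⊤) {G : Vec n → Tens n M}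
    (h : IsWeakGrad Ω u G) : GradRep Ω u (volume.restrict Ω) G fun _ => 1 := by
  have hΩfin : IsFiniteMeasure (volume.restrict Ω) := ⟨by simpa using hfin.lt_top⟩
  refine ⟨hΩfin, by simp [hΩ.measurableSet.compl], memLp_one_iff_integrable.1 h.1,
    integrable_const _, Eventually.of_forall fun _ => zero_le_one, by simp, fun φ hφ j i => ?_⟩
  exact h.2 φ hφ j i

lemma MemW11.isWeakGrad (h : MemW11 Ω u) : IsWeakGrad Ω u (weakGrad Ω u) := by
  unfold weakGrad
  rw [dif_pos h.2]
  exact h.2.choose_spec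

lemma MemW11.memBV (hΩ : IsOpen Ω) (hfin : volume Ω ≠ ⊤) (h : MemW11 Ω u) : MemBV Ω u :=
  (h.isWeakGrad.gradRep hΩ hfin).memBV h.1

lemma IsWeakGrad.energy_eq {F : Tens n M → ℝ} {ν₁ ν₂ ν₃ : ℝ} (hF : IsDensity F ν₁ ν₂ ν₃)
    (hΩ : IsOpen Ω) (hfin : volume Ω ≠ ⊤) {G : Vec n → Tens n M}
    (h : IsWeakGrad Ω u G) (hu : MemLp u 1 (volume.restrict Ω)) :
    energy Ω F u = ∫ x in Ω, F (G x) := by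
  rw [(h.gradRep hΩ hfin).energy_eq hF hΩ hfin hu]
  simp [IsDensity.persp_one]

lemma MemW11.functionalI_eq {F : Tens n M → ℝ} {ν₁ ν₂ ν₃ : ℝ} (hF : IsDensity F ν₁ ν₂ ν₃)
    (hΩ : IsOpen Ω) (hfin : volume Ω ≠ ⊤) (h : MemW11 Ω u) (D : Set (Vec n))
    (f : Vec n → Vec M) (lam ζ : ℝ) :
    functionalI Ω D f F lam ζ u = functionalK Ω D f F lam ζ u := by
  rw [functionalK_eq, h.isWeakGrad.energy_eq hF hΩ hfin h.1]
  rfl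

lemma energy_nonneg {F : Tens n M → ℝ} {ν₁ ν₂ ν₃ : ℝ} (hF : IsDensity F ν₁ ν₂ ν₃)
    (w : Vec n → Vec M) : 0 ≤ energy Ω F w := by
  refine add_nonneg (integral_nonneg fun x => hF.nonneg _) (integral_nonneg fun x => ?_)
  rw [← IsDensity.persp_zero_right]
  exact hF.persp_nonneg _ le_rfl

end Canonical

end Inpainting

/-! ### Test functions and weak limits of densities. -/

namespace Inpainting

open scoped Manifold in
lemma exists_test_eq_one {n : ℕ} {K V : Set (Vec n)} (hK : IsCompact K) (hV : IsOpen V)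
    (hKV : K ⊆ V) : ∃ φ : Vec n → ℝ, IsTest V φ ∧ (∀ x, 0 ≤ φ x) ∧ (∀ x, φ x ≤ 1) ∧
      ∀ x ∈ K, φ x = 1 := by
  obtain ⟨δ, hδ, hsub⟩ := hK.exists_cthickening_subset_open hV hKV
  obtain ⟨φ, h1, h2, h3, h4⟩ := exists_contMDiff_support_eq_eq_one_iff (n := (⊤ : ℕ∞)) 𝓘(ℝ, Vec n)
    (Metric.isOpen_thickening (E := K) (δ := δ)) hK.isClosed (Metric.self_subset_thickening hδ K)
  have hs : tsupport φ ⊆ Metric.cthickening δ K := by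
    rw [tsupport, h3]
    exact Metric.closure_thickening_subset_cthickening δ K
  exact ⟨φ, ⟨h1.contDiff, HasCompactSupport.of_support_subset_isCompact hK.cthickening
    (subset_closure.trans hs), hs.trans hsub⟩, fun x => (h2 (mem_range_self x)).1,
    fun x => (h2 (mem_range_self x)).2, fun x hx => (h4 x).1 hx⟩

/-- A function whose integrals against nonnegative test functions are nonnegative is itself
nonnegative. -/
lemma ae_nonneg_of_test {n : ℕ} {Ω : Set (Vec n)} (hΩ : IsOpen Ω) {m : Measure (Vec n)}
    [IsFiniteMeasure m] {q : Vec n → ℝ} (hq : Integrable q m)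
    (h : ∀ φ, IsTest Ω φ → (∀ x, 0 ≤ φ x) → 0 ≤ ∫ x, φ x * q x ∂m) :
    ∀ᵐ x ∂(m.restrict Ω), 0 ≤ q x := by
  refine ae_nonneg_of_forall_setIntegral_nonneg hq.restrict fun A hA _ => ?_
  rw [Measure.restrict_restrict hA]
  have hB : MeasurableSet (A ∩ Ω) := hA.inter hΩ.measurableSet
  set B := A ∩ Ω
  have hfin : IsFiniteMeasure (m.withDensity fun x => ‖q x‖ₑ) :=
    isFiniteMeasure_withDensity hq.2.ne
  have key : ∀ S, MeasurableSet S → ∀ ε > 0, (m.withDensity fun x => ‖q x‖ₑ) S < ENNReal.ofReal ε →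
      ∫ x in S, ‖q x‖ ∂m ≤ ε := fun S hS ε hε hlt => by
    rw [withDensity_apply _ hS] at hlt
    rw [integral_norm_eq_lintegral_enorm hq.1.restrict]
    exact ENNReal.toReal_le_of_le_ofReal hε.le hlt.le
  refine le_of_forall_pos_le_add fun ε hε => ?_
  have hε2 : ENNReal.ofReal (ε / 2) ≠ 0 := by simp [hε]
  -- Regularity is applied to `|q| m` rather than to `m`: then the integrals of `|q|` over `B \ K`
  -- and `V \ K` are small, and a test function that is `1` on `K` and supported in `V` nearly
  -- integrates `q` over `B`.
  obtain ⟨K, hKB, hK, hK1⟩ := hB.exists_isCompact_sdiff_lt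
    (measure_ne_top (m.withDensity fun x => ‖q x‖ₑ) _) hε2
  obtain ⟨V', hKV', hV'o, -, hV'1⟩ := hK.measurableSet.exists_isOpen_sdiff_lt
    (measure_ne_top (m.withDensity fun x => ‖q x‖ₑ) _) hε2
  set V := V' ∩ Ω
  have hV : IsOpen V := hV'o.inter hΩ
  have hKV : K ⊆ V := subset_inter hKV' (hKB.trans inter_subset_right)
  obtain ⟨φ, hφ, h0, hle, h1⟩ := exists_test_eq_one hK hV hKV
  have hφΩ : IsTest Ω φ := ⟨hφ.1, hφ.2.1, hφ.2.2.trans inter_subset_right⟩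
  have i1 := h φ hφΩ h0
  have hVK : (m.withDensity fun x => ‖q x‖ₑ) (V \ K) < ENNReal.ofReal (ε / 2) :=
    (measure_mono (sdiff_subset_sdiff_left inter_subset_left)).trans_lt hV'1
  have i2 := key _ (hV.measurableSet.diff hK.measurableSet) _ (half_pos hε) hVK
  have i3 := key _ (hB.diff hK.measurableSet) _ (half_pos hε) hK1
  have i4 : ∫ x in K, q x ∂m = ∫ x in B, q x ∂m - ∫ x in B \ K, q x ∂m := by
    rw [setIntegral_sdiff hK.measurableSet hq.integrableOn hKB]; ring
  have i5 : |∫ x in B \ K, q x ∂m| ≤ ∫ x in B \ K, ‖q x‖ ∂m := abs_integral_le_integral_abs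
  have i6 : ∫ x, φ x * q x ∂m = ∫ x in V, φ x * q x ∂m := by
    refine (setIntegral_eq_integral_of_forall_compl_eq_zero fun x hx => ?_).symm
    rw [image_eq_zero_of_notMem_tsupport fun h => hx (hφ.2.2 h), zero_mul]
  have hφq := hφ.integrable_mul hq
  have i7 : ∫ x in V \ K, φ x * q x ∂m = ∫ x in V, φ x * q x ∂m - ∫ x in K, φ x * q x ∂m :=
    setIntegral_sdiff hK.measurableSet hφq.integrableOn hKV
  have i8 : ∫ x in K, φ x * q x ∂m = ∫ x in K, q x ∂m :=
    setIntegral_congr_fun hK.measurableSet fun x hx => by simp [h1 x hx]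
  have i9 : ∫ x in V \ K, φ x * q x ∂m ≤ ∫ x in V \ K, ‖q x‖ ∂m := by
    refine integral_mono hφq.integrableOn hq.norm.integrableOn fun x => ?_
    calc φ x * q x ≤ φ x * ‖q x‖ := by gcongr; exacts [h0 x, le_abs_self _]
      _ ≤ 1 * ‖q x‖ := by gcongr; exact hle x
      _ = ‖q x‖ := one_mul _
  have := (abs_le.1 i5).1
  linarith

open CompactlySupported in
/-- Bounded sequences of nonnegative densities have weak limits along an ultrafilter. -/
lemma exists_weak_limit {n : ℕ} (𝒰 : Ultrafilter ℕ) {μ : Measure (Vec n)} {g : ℕ → Vec n → ℝ}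
    (h0 : ∀ k, 0 ≤ᵐ[μ] g k) (hg : ∀ k, Integrable (g k) μ) {C : ℝ} (hC : ∀ k, ∫ x, g k x ∂μ ≤ C) :
    ∃ ν : Measure (Vec n), ν univ ≤ ENNReal.ofReal C ∧
      ∀ φ : Vec n → ℝ, Continuous φ → HasCompactSupport φ →
        Tendsto (fun k => ∫ x, φ x * g k x ∂μ) 𝒰 (𝓝 (∫ x, φ x ∂ν)) := by
  have hint : ∀ (φ : C_c(Vec n, ℝ)) k, Integrable (fun x => φ x * g k x) μ := fun φ k => by
    obtain ⟨B, hB⟩ := φ.hasCompactSupport.exists_bound_of_continuous φ.continuous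
    exact (hg k).bdd_mul φ.continuous.aestronglyMeasurable (Eventually.of_forall hB)
  have hbd : ∀ (φ : C_c(Vec n, ℝ)) (B : ℝ), (∀ x, |φ x| ≤ B) →
      ∀ k, |∫ x, φ x * g k x ∂μ| ≤ B * C := fun φ B hB k => by
    have hB0 : 0 ≤ B := (abs_nonneg _).trans (hB 0)
    calc |∫ x, φ x * g k x ∂μ| ≤ ∫ x, |φ x * g k x| ∂μ := abs_integral_le_integral_abs
      _ ≤ ∫ x, B * g k x ∂μ := by
        refine integral_mono_ae (hint φ k).abs ((hg k).const_mul B) ?_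
        filter_upwards [h0 k] with x hx
        rw [abs_mul, abs_of_nonneg (show 0 ≤ g k x from hx)]
        exact mul_le_mul_of_nonneg_right (hB x) hx
      _ = B * ∫ x, g k x ∂μ := integral_const_mul _ _
      _ ≤ B * C := by gcongr; exact hC k
  -- Bounded real sequences converge along the ultrafilter for all `φ` at once, without choosing
  -- subsequences. The limit is a positive linear functional, so Riesz's theorem yields the measure.
  have hlim : ∀ φ : C_c(Vec n, ℝ), ∃ l, Tendsto (fun k => ∫ x, φ x * g k x ∂μ) 𝒰 (𝓝 l) := by
    intro φ
    obtain ⟨B, hB⟩ := φ.hasCompactSupport.exists_bound_of_continuous φ.continuous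
    have hmem : ∀ k, (∫ x, φ x * g k x ∂μ) ∈ Icc (-(B * C)) (B * C) := fun k =>
      abs_le.1 (hbd φ B hB k)
    obtain ⟨l, -, hl⟩ := (isCompact_Icc (a := -(B * C)) (b := B * C)).ultrafilter_le_nhds
      (𝒰.map fun k => ∫ x, φ x * g k x ∂μ) (by
        rw [le_principal_iff]
        exact Filter.Eventually.of_forall (f := (𝒰 : Filter ℕ)) hmem)
    exact ⟨l, hl⟩
  choose L hL using hlim
  let Λ₀ : C_c(Vec n, ℝ) →ₗ[ℝ] ℝ :=
    { toFun := L
      map_add' := fun φ ψ => by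
        refine tendsto_nhds_unique (hL (φ + ψ)) (((hL φ).add (hL ψ)).congr fun k => ?_)
        rw [← integral_add (hint φ k) (hint ψ k)]
        simp [add_mul]
      map_smul' := fun c φ => by
        refine tendsto_nhds_unique (hL (c • φ)) (((hL φ).const_mul c).congr fun k => ?_)
        rw [← integral_const_mul]
        simp [mul_assoc] }
  let Λ : C_c(Vec n, ℝ) →ₚ[ℝ] ℝ := PositiveLinearMap.mk₀ Λ₀ fun φ hφ => by
    refine ge_of_tendsto (hL φ) (Eventually.of_forall fun k => integral_nonneg_of_ae ?_)
    filter_upwards [h0 k] with x hx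
    exact mul_nonneg (hφ x) hx
  refine ⟨RealRMK.rieszMeasure Λ, ?_, fun φ hφ hc => ?_⟩
  -- Mass may escape in the limit, so only an upper bound can hold; it is tested on compact sets.
  · rw [isOpen_univ.measure_eq_iSup_isCompact]
    refine iSup_le fun K => iSup_le fun _ => iSup_le fun hK => ?_
    obtain ⟨φ, hφ, hφ0, hφ1, hφK⟩ := exists_test_eq_one hK isOpen_univ (subset_univ K)
    refine (RealRMK.rieszMeasure_le_of_eq_one Λ (f := ⟨⟨φ, hφ.1.continuous⟩, hφ.2.1⟩)
      (fun x => hφ0 x) hK hφK).trans (ENNReal.ofReal_le_ofReal ?_)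
    refine le_of_tendsto (hL ⟨⟨φ, hφ.1.continuous⟩, hφ.2.1⟩) (Eventually.of_forall fun k => ?_)
    have := hbd ⟨⟨φ, hφ.1.continuous⟩, hφ.2.1⟩ 1
      (fun x => abs_le.2 ⟨by linarith [hφ0 x, show (0:ℝ) ≤ φ x from hφ0 x,
        show (⟨⟨φ, hφ.1.continuous⟩, hφ.2.1⟩ : C_c(Vec n, ℝ)) x = φ x from rfl], hφ1 x⟩) k
    rw [one_mul] at this
    exact (le_abs_self _).trans this
  · have h1 := RealRMK.integral_rieszMeasure Λ ⟨⟨φ, hφ⟩, hc⟩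
    have h2 : ∫ x, φ x ∂(RealRMK.rieszMeasure Λ) = L ⟨⟨φ, hφ⟩, hc⟩ := h1
    rw [h2]
    exact hL ⟨⟨φ, hφ⟩, hc⟩

end Inpainting

/-! ### Lower semicontinuity of the energy. -/

namespace Inpainting

section Lsc

variable {n M : ℕ} {Ω : Set (Vec n)}

lemma tendsto_integral_apply_mul {ι : Type*} {l : Filter ι} {μ : Measure (Vec n)}
    {w : ι → Vec n → Vec M} {u : Vec n → Vec M} (hw : ∀ k, MemLp (w k) 1 μ) (hu : MemLp u 1 μ)
    (h : Tendsto (fun k => eLpNorm (w k - u) 1 μ) l (𝓝 0)) {ψ : Vec n → ℝ} (hψ : Continuous ψ)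
    {C : ℝ} (hC : ∀ x, ‖ψ x‖ ≤ C) (j : Fin M) :
    Tendsto (fun k => ∫ x, w k x j * ψ x ∂μ) l (𝓝 (∫ x, u x j * ψ x ∂μ)) := by
  have hi : ∀ {v : Vec n → Vec M}, MemLp v 1 μ → Integrable (fun x => v x j * ψ x) μ :=
    fun {v} hv => (integrable_apply (memLp_one_iff_integrable.1 hv) j).mul_bdd
      hψ.aestronglyMeasurable (Eventually.of_forall hC)
  refine tendsto_integral_of_L1' _ (hi hu).1 (Eventually.of_forall fun k => hi (hw k)) ?_
  refine tendsto_of_tendsto_of_tendsto_of_le_of_le tendsto_const_nhds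
    (by simpa using ENNReal.Tendsto.const_mul (a := ENNReal.ofReal C) h (Or.inr (by simp)))
    (fun _ => bot_le) fun k => ?_
  simp only [eLpNorm_one_eq_lintegral_enorm]
  rw [← lintegral_const_mul' _ _ (by simp)]
  refine lintegral_mono fun x => ?_
  have : w k x j * ψ x - u x j * ψ x = ψ x * (w k x - u x) j := by
    simp only [PiLp.sub_apply]; ring
  simp only [Pi.sub_apply]
  rw [this, enorm_mul]
  gcongr
  · rw [← ofReal_norm]
    exact ENNReal.ofReal_le_ofReal (hC x)
  · exact enorm_apply_le _ j

/-- `L¹`-limits of `W^{1,1}`-functions with bounded energy are functions of bounded variation, and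
the relaxed energy is lower semicontinuous. -/
lemma exists_gradRep_of_tendsto {F : Tens n M → ℝ} {ν₁ ν₂ ν₃ : ℝ} (hF : IsDensity F ν₁ ν₂ ν₃)
    (hν₂ : 0 < ν₂) (hΩ : IsOpen Ω) (hfin : volume Ω ≠ ⊤) {w : ℕ → Vec n → Vec M}
    {G : ℕ → Vec n → Tens n M} {u : Vec n → Vec M}
    (hw : ∀ k, MemLp (w k) 1 (volume.restrict Ω)) (hG : ∀ k, IsWeakGrad Ω (w k) (G k))
    (hu : MemLp u 1 (volume.restrict Ω))
    (hlim : Tendsto (fun k => eLpNorm (w k - u) 1 (volume.restrict Ω)) atTop (𝓝 0)) {A : ℝ}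
    (hA : ∀ k, ∫ x in Ω, F (G k x) ≤ A) :
    ∃ m p t, GradRep Ω u m p t ∧ ∫ x, persp F (p x) (t x) ∂m ≤ A := by
  classical
  -- One ultrafilter serves all weak limits below, so that they can be compared.
  set 𝒰 : Ultrafilter ℕ := hyperfilter ℕ
  have h𝒰 : (𝒰 : Filter ℕ) ≤ atTop := Nat.hyperfilter_le_atTop
  set μ := (volume : Measure (Vec n)).restrict Ω with hμ
  have hμfin : IsFiniteMeasure μ := ⟨by simpa [hμ] using hfin.lt_top⟩
  have hGi : ∀ k, Integrable (G k) μ := fun k => memLp_one_iff_integrable.1 (hG k).1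
  have hFi : ∀ k, Integrable (fun x => F (G k x)) μ := fun k => hF.integrable_comp (hGi k)
  have hA0 : 0 ≤ A := (integral_nonneg fun x => hF.nonneg _).trans (hA 0)
  set C := ν₂⁻¹ * (A + ν₃ * μ.real univ) with hCdef
  have hC : ∀ k, ∫ x, ‖G k x‖ ∂μ ≤ C := fun k => by
    calc ∫ x, ‖G k x‖ ∂μ ≤ ∫ x, ν₂⁻¹ * (F (G k x) + ν₃) ∂μ :=
          integral_mono (hGi k).norm (((hFi k).add (integrable_const _)).const_mul _)
            fun x => hF.norm_le hν₂ _
      _ = ν₂⁻¹ * (∫ x, F (G k x) ∂μ + ν₃ * μ.real univ) := by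
          rw [integral_const_mul, integral_add (hFi k) (integrable_const _)]
          simp [mul_comm]
      _ ≤ C := by rw [hCdef]; gcongr; exact hA k
  -- `ε = 1` and `ε = -1` select the positive and negative parts of each entry, which are
  -- nonnegative densities bounded in `L¹`.
  have hpos : ∀ (ε : ℝ), |ε| = 1 → ∀ c : Fin M × Fin n, ∃ ν : Measure (Vec n),
      ν univ ≤ ENNReal.ofReal C ∧ ∀ φ : Vec n → ℝ, Continuous φ → HasCompactSupport φ →
        Tendsto (fun k => ∫ x, φ x * max (ε * G k x c) 0 ∂μ) 𝒰 (𝓝 (∫ x, φ x ∂ν)) := by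
    intro ε hε c
    have hi : ∀ k, Integrable (fun x => max (ε * G k x c) 0) μ := fun k =>
      ((integrable_apply (hGi k) c).const_mul ε).pos_part
    refine exists_weak_limit 𝒰 (fun k => Eventually.of_forall fun x => le_max_right _ _) hi
      fun k => (integral_mono (hi k) (hGi k).norm fun x => ?_).trans (hC k)
    refine max_le ((le_abs_self _).trans ?_) (norm_nonneg _)
    rw [abs_mul, hε, one_mul]
    exact PiLp.norm_apply_le (G k x) c
  choose P hPfin hP using hpos 1 (by simp)
  choose N hNfin hN using hpos (-1) (by simp)
  obtain ⟨θ, hθfin, hθ⟩ := exists_weak_limit 𝒰 (fun k => Eventually.of_forall fun x =>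
    hF.nonneg (G k x)) hFi hA
  have fP : ∀ c, IsFiniteMeasure (P c) := fun c => ⟨(hPfin c).trans_lt ENNReal.ofReal_lt_top⟩
  have fN : ∀ c, IsFiniteMeasure (N c) := fun c => ⟨(hNfin c).trans_lt ENNReal.ofReal_lt_top⟩
  have fθ : IsFiniteMeasure θ := ⟨hθfin.trans_lt ENNReal.ofReal_lt_top⟩
  -- A measure that dominates Lebesgue measure on `Ω`, the limits of both parts of every entry, and
  -- the limit `θ` of the energy densities, all restricted to `Ω`.
  set m : Measure (Vec n) := μ + ((∑ c, ((P c).restrict Ω + (N c).restrict Ω)) + θ.restrict Ω)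
    with hm
  have hmfin : IsFiniteMeasure m := by rw [hm]; infer_instance
  have leμ : μ ≤ m := Measure.le_add_right le_rfl
  have leθ : θ.restrict Ω ≤ m := Measure.le_add_left (Measure.le_add_left le_rfl)
  have lePN : ∀ c, (P c).restrict Ω + (N c).restrict Ω ≤ m := fun c =>
    Measure.le_add_left (Measure.le_add_right
      (Finset.single_le_sum (f := fun c => (P c).restrict Ω + (N c).restrict Ω)
        (fun _ _ => Measure.zero_le _) (Finset.mem_univ c)))
  have leP : ∀ c, (P c).restrict Ω ≤ m := fun c => (Measure.le_add_right le_rfl).trans (lePN c)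
  have leN : ∀ c, (N c).restrict Ω ≤ m := fun c => (Measure.le_add_left le_rfl).trans (lePN c)
  have hmΩ : m Ωᶜ = 0 := by
    have h0 : ∀ ν : Measure (Vec n), ν.restrict Ω Ωᶜ = 0 := fun ν => by
      simp [Measure.restrict_apply hΩ.measurableSet.compl]
    simp [hm, h0, hμ]
  have hint : ∀ {m₀ : Measure (Vec n)} [IsFiniteMeasure m₀], m₀ ≤ m →
      Integrable (relDensity m₀ m) m := fun {m₀} _ hle => by
    simpa using integrable_relDensity_smul hle (integrable_const (1 : ℝ))
  have hφint : ∀ {m₀ : Measure (Vec n)} [IsFiniteMeasure m₀], m₀.restrict Ω ≤ m →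
      ∀ φ, IsTest Ω φ → ∫ x, φ x * relDensity (m₀.restrict Ω) m x ∂m = ∫ x, φ x ∂m₀ := by
    intro m₀ _ hle φ hφ
    have := integral_relDensity_smul hle φ
    simp only [smul_eq_mul] at this
    simp_rw [mul_comm (φ _)]
    rw [this]
    refine setIntegral_eq_integral_of_forall_compl_eq_zero fun x hx => ?_
    exact image_eq_zero_of_notMem_tsupport fun h => hx (hφ.2.2 h)
  set p : Vec n → Tens n M := fun x => WithLp.toLp 2 fun c =>
    relDensity ((P c).restrict Ω) m x - relDensity ((N c).restrict Ω) m x with hp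
  have hpi : ∀ c, Integrable (fun x => p x c) m := fun c => (hint (leP c)).sub (hint (leN c))
  have hφG : ∀ φ, IsTest Ω φ → ∀ c, Tendsto (fun k => ∫ x, φ x * G k x c ∂μ) 𝒰
      (𝓝 (∫ x, φ x * p x c ∂m)) := by
    intro φ hφ c
    have e : ∫ x, φ x * p x c ∂m = ∫ x, φ x ∂(P c) - ∫ x, φ x ∂(N c) := by
      rw [← hφint (leP c) φ hφ, ← hφint (leN c) φ hφ, ← integral_sub
        (hφ.integrable_mul (hint (leP c))) (hφ.integrable_mul (hint (leN c)))]
      simp only [hp, mul_sub]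
    rw [e]
    refine ((hP c φ hφ.1.continuous hφ.2.1).sub (hN c φ hφ.1.continuous hφ.2.1)).congr fun k => ?_
    have hi := integrable_apply (hGi k) c
    rw [← integral_sub (hφ.integrable_mul (hi.const_mul 1).pos_part)
      (hφ.integrable_mul (hi.const_mul (-1)).pos_part)]
    refine integral_congr_ae (Eventually.of_forall fun x => ?_)
    simp only
    rw [← mul_sub, one_mul, neg_one_mul]
    congr 1
    rcases le_total 0 (G k x c) with h | h
    · rw [max_eq_left h, max_eq_right (by linarith), sub_zero]
    · rw [max_eq_right h, max_eq_left (by linarith)]; ring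
  have hpint : Integrable p m := integrable_of_apply hpi
  have hφF : ∀ φ, IsTest Ω φ → Tendsto (fun k => ∫ x, φ x * F (G k x) ∂μ) 𝒰
      (𝓝 (∫ x, φ x * relDensity (θ.restrict Ω) m x ∂m)) := by
    intro φ hφ
    rw [hφint leθ φ hφ]
    exact hθ φ hφ.1.continuous hφ.2.1
  have hrep : GradRep Ω u m p (relDensity μ m) := by
    refine ⟨hmfin, hmΩ, hpint, hint leμ, Eventually.of_forall fun x => relDensity_nonneg _ _ _,
      ?_, fun φ hφ j i => ?_⟩
    · conv_lhs => rw [← hμ, ← Measure.withDensity_rnDeriv_eq μ m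
        (Measure.absolutelyContinuous_of_le leμ)]
      refine withDensity_congr_ae ?_
      filter_upwards [Measure.rnDeriv_ne_top μ m] with x hx
      rw [relDensity, ENNReal.ofReal_toReal hx]
    · obtain ⟨B, hB⟩ := hφ.exists_bound_partialDeriv i
      have h1 := (tendsto_integral_apply_mul hw hu hlim (hφ.continuous_partialDeriv i) hB j).mono_left
        h𝒰
      refine tendsto_nhds_unique h1 ((hφG φ hφ (j, i)).neg.congr fun k => ?_)
      exact ((hG k).2 φ hφ j i).symm
  refine ⟨m, p, relDensity μ m, hrep, ?_⟩
  -- For fixed `Q` the tangent inequality is linear in the gradient, so it passes to the weak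
  -- limits; `F (G k)` becomes the density of `θ`.
  have htan : ∀ Q : Tens n M, ∀ᵐ x ∂(m.restrict Ω),
      relDensity μ m x * (F Q - fderiv ℝ F Q Q) + fderiv ℝ F Q (p x) ≤
        relDensity (θ.restrict Ω) m x := by
    intro Q
    set a := F Q - fderiv ℝ F Q Q
    set b : Fin M × Fin n → ℝ := fun c => fderiv ℝ F Q (EuclideanSpace.single c 1) with hb
    have hbsum : ∀ R : Tens n M, fderiv ℝ F Q R = ∑ c, b c * R c := fun R => by
      have : R = ∑ c, R c • EuclideanSpace.single c (1 : ℝ) := by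
        ext d
        simp [Finset.sum_apply, Pi.single_apply]
      conv_lhs => rw [this]
      rw [map_sum]
      refine Finset.sum_congr rfl fun c _ => ?_
      rw [map_smul, smul_eq_mul, mul_comm]
    have hint' : Integrable (fun x => relDensity (θ.restrict Ω) m x -
        (relDensity μ m x * a + fderiv ℝ F Q (p x))) m :=
      (hint leθ).sub (((hint leμ).mul_const a).add ((fderiv ℝ F Q).integrable_comp hpint))
    have := ae_nonneg_of_test hΩ hint' fun φ hφ hφ0 => ?_
    · filter_upwards [this] with x hx
      linarith
    -- Used twice: over `m` for the limit, and over Lebesgue measure on `Ω` with `t = 1` for the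
    -- members of the sequence.
    · have e1 : ∀ {m' : Measure (Vec n)} [IsFiniteMeasure m'] (f t : Vec n → ℝ)
          (g : Vec n → Tens n M), Integrable f m' → Integrable t m' → Integrable g m' →
          ∫ x, φ x * (f x - (t x * a + fderiv ℝ F Q (g x))) ∂m' =
            ∫ x, φ x * f x ∂m' - ((∫ x, φ x * t x ∂m') * a +
              ∑ c, b c * ∫ x, φ x * g x c ∂m') := by
        intro m' _ f t g hf ht hg
        have i1 := hφ.integrable_mul hf
        have i2 := (hφ.integrable_mul ht).mul_const a
        have i3 : ∀ c, Integrable (fun x => b c * (φ x * g x c)) m' := fun c =>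
          (hφ.integrable_mul (integrable_apply hg c)).const_mul (b c)
        have i4 : Integrable (fun x => ∑ c, b c * (φ x * g x c)) m' :=
          integrable_finsetSum _ fun c _ => i3 c
        rw [← integral_mul_const]
        simp_rw [← integral_const_mul]
        rw [← integral_finsetSum _ fun c _ => i3 c, ← integral_add i2 i4, 
          ← integral_sub i1 (show Integrable (fun x => φ x * t x * a + ∑ c, b c * (φ x * g x c)) m' from
            i2.add i4)]
        refine integral_congr_ae (Eventually.of_forall fun x => ?_)
        simp only [hbsum]
        rw [mul_sub, mul_add, Finset.mul_sum]
        congr 2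
        · ring
        · exact Finset.sum_congr rfl fun c _ => by ring
      have hφt : ∫ x, φ x * relDensity μ m x ∂m = ∫ x, φ x * 1 ∂μ := by
        have := integral_relDensity_smul leμ φ
        simp only [smul_eq_mul] at this
        simp_rw [mul_comm (φ _), this, one_mul]
      rw [e1 _ _ _ (hint leθ) (hint leμ) hpint, hφt]
      have hl := (hφF φ hφ).sub ((tendsto_const_nhds (x := (∫ x, φ x * 1 ∂μ) * a)).add
        (tendsto_finsetSum Finset.univ fun c _ => (hφG φ hφ c).const_mul (b c)))
      refine ge_of_tendsto hl (Eventually.of_forall fun k => ?_)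
      rw [← e1 _ _ _ (hFi k) (integrable_const 1) (hGi k)]
      refine integral_nonneg fun x => mul_nonneg (hφ0 x) ?_
      have := hF.tangent_le (G k x) Q
      rw [map_sub] at this
      simp only [a]
      linarith
  have hmres : m.restrict Ω = m := Measure.restrict_eq_self_of_ae_mem (by
    rw [ae_iff]; exact hmΩ)
  rw [hmres] at htan
  -- The tangents at a dense sequence hold simultaneously almost everywhere, so `persp F` is at most
  -- the density of `θ`, whose mass is at most `A`.
  calc ∫ x, persp F (p x) (relDensity μ m x) ∂m ≤ ∫ x, relDensity (θ.restrict Ω) m x ∂m := by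
        refine integral_mono_ae (hF.integrable_persp hpint (hint leμ).1.aemeasurable
          hrep.t_nonneg) (hint leθ) ?_
        filter_upwards [ae_all_iff.2 fun k => htan (TopologicalSpace.denseSeq (Tens n M) k)] with x hx
        exact hF.persp_le_of_denseSeq (relDensity_nonneg _ _ _) hx
    _ = (θ.restrict Ω).real univ := by
        have := integral_relDensity_smul leθ (fun _ => (1 : ℝ))
        simpa using this
    _ ≤ A := by
        refine ENNReal.toReal_le_of_le_ofReal hA0 ?_
        exact (measure_mono (subset_univ _)).trans (Measure.restrict_le_self univ |>.trans hθfin)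

end Lsc

end Inpainting

/-! ### Moving Lipschitz domains inward. -/

namespace Inpainting

section Partition

variable {n : ℕ} {Ω : Set (Vec n)}

/-- Points of `Ω` near a point of its closure can be moved into `Ω`, uniformly. -/
lemma IsBoundedLipschitzDomain.exists_inward (hΩ : IsBoundedLipschitzDomain Ω) {x : Vec n}
    (hx : x ∈ closure Ω) : ∃ (r c τ₀ : ℝ) (e : Vec n), 0 < r ∧ 0 < c ∧ c ≤ 1 ∧ 0 < τ₀ ∧ ‖e‖ ≤ 1 ∧
      ∀ y ∈ Metric.ball x r, y ∈ Ω → ∀ τ, 0 < τ → τ < τ₀ → ∀ z : Vec n, ‖z‖ ≤ c * τ →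
        y + (τ • e + z) ∈ Ω := by
  by_cases hxΩ : x ∈ Ω
  · obtain ⟨r, hr, hsub⟩ := Metric.isOpen_iff.1 hΩ.isOpen x hxΩ
    refine ⟨r / 2, 1, r / 2, 0, by linarith, one_pos, le_rfl, by linarith, by simp,
      fun y hy _ τ _ hτ z hz => hsub ?_⟩
    rw [Metric.mem_ball, dist_eq_norm] at hy ⊢
    calc ‖y + (τ • 0 + z) - x‖ = ‖(y - x) + z‖ := by congr 1; rw [smul_zero]; abel
      _ ≤ ‖y - x‖ + ‖z‖ := norm_add_le _ _
      _ < r := by linarith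
  · obtain ⟨e, γ, L, r, he, hγ, hinv, hr, hball⟩ := hΩ.boundary x
      (by rw [hΩ.isOpen.frontier_eq]; exact ⟨hx, hxΩ⟩)
    have hL : (0 : ℝ) < 1 + L := by positivity
    have hc1 : 1 / (2 * (1 + (L : ℝ))) ≤ 1 := by
      rw [div_le_one (by positivity)]
      have : (0 : ℝ) ≤ L := L.2
      linarith
    -- The step `τ • e` raises the height above the graph by `τ`, while `z` costs at most `(1 + L)
    -- ‖z‖ ≤ τ / 2`. The total displacement is at most `2 τ < r / 2`, so the point stays in the
    -- ball.
    refine ⟨r / 2, 1 / (2 * (1 + L)), r / 4, e, by linarith, by positivity, hc1, by linarith, he.le,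
      fun y hy hyΩ τ hτ hτr z hz => ?_⟩
    rw [Metric.mem_ball, dist_eq_norm] at hy
    have hz' : ‖z‖ ≤ τ := hz.trans (mul_le_of_le_one_left hτ.le hc1)
    have hmem : y + (τ • e + z) ∈ Metric.ball x r := by
      rw [Metric.mem_ball, dist_eq_norm]
      calc ‖y + (τ • e + z) - x‖ = ‖(y - x) + (τ • e + z)‖ := by congr 1; abel
        _ ≤ ‖y - x‖ + (‖τ • e‖ + ‖z‖) := (norm_add_le _ _).trans (by gcongr; exact norm_add_le _ _)
        _ < r := by rw [norm_smul, he, Real.norm_of_nonneg hτ.le]; linarith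
    have hymem : y ∈ Metric.ball x r := by rw [Metric.mem_ball, dist_eq_norm]; linarith
    rw [hball _ hmem]
    have h1 := (hball y hymem).1 hyΩ
    have h2 : γ (y + (τ • e + z)) = γ (y + z) := by
      rw [← hinv (y + z) τ]; congr 1; abel
    have h3 : γ (y + z) ≤ γ y + L * ‖z‖ := by
      have := hγ.dist_le_mul (y + z) y
      rw [Real.dist_eq, dist_eq_norm, add_sub_cancel_left] at this
      linarith [le_abs_self (γ (y + z) - γ y)]
    have h4 : inner ℝ e (y + (τ • e + z)) = inner ℝ e y + (τ + inner ℝ e z) := by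
      rw [inner_add_right, inner_add_right, inner_smul_right, real_inner_self_eq_norm_sq, he]
      ring
    have h5 : -‖z‖ ≤ inner ℝ e z := by
      have := abs_real_inner_le_norm e z
      rw [he, one_mul] at this
      exact (abs_le.1 this).1
    have h6 : (1 + L) * ‖z‖ ≤ τ / 2 := by
      calc (1 + L) * ‖z‖ ≤ (1 + L) * (1 / (2 * (1 + L)) * τ) := by gcongr
        _ = τ / 2 := by field_simp
    rw [h2, h4]
    linarith

/-- A partition of unity on `Ω` such that the support of each member can be moved into `Ω`. -/
structure InwardPartition (Ω : Set (Vec n)) (ι : Type) [Fintype ι] where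
  /-- the members of the partition -/
  χ : ι → Vec n → ℝ
  /-- the directions -/
  e : ι → Vec n
  /-- the opening of the cones -/
  c : ℝ
  /-- the maximal length of the translations -/
  τ₀ : ℝ
  c_pos : 0 < c
  c_le : c ≤ 1
  τ₀_pos : 0 < τ₀
  norm_e : ∀ i, ‖e i‖ ≤ 1
  contDiff : ∀ i, ContDiff ℝ ∞ (χ i)
  hasCompactSupport : ∀ i, HasCompactSupport (χ i)
  nonneg : ∀ i x, 0 ≤ χ i x
  sum_eq_one : ∀ x ∈ Ω, ∑ i, χ i x = 1
  inward : ∀ i, ∀ x ∈ Ω, χ i x ≠ 0 → ∀ τ, 0 < τ → τ < τ₀ → ∀ z : Vec n, ‖z‖ ≤ c * τ →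
    x + (τ • e i + z) ∈ Ω

-- The compact closure is covered by finitely many balls from `exists_inward`; a smooth partition is
-- subordinate to them, and the smallest `c` and `τ₀` serve all.
open scoped Manifold in
lemma IsBoundedLipschitzDomain.exists_inwardPartition (hΩ : IsBoundedLipschitzDomain Ω) :
    ∃ (ι : Type) (_ : Fintype ι), Nonempty (InwardPartition Ω ι) := by
  classical
  have hK : IsCompact (closure Ω) := hΩ.isBounded.isCompact_closure
  have hne : (closure Ω).Nonempty := hΩ.isConnected.nonempty.closure
  choose! r c τ₀ e hr hc hc1 hτ he hin using fun x hx => hΩ.exists_inward (x := x) hx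
  obtain ⟨s, hs, hcov⟩ := hK.elim_nhds_subcover (fun x => Metric.ball x (r x))
    (fun x hx => Metric.ball_mem_nhds x (hr x hx))
  have hsne : s.Nonempty := by
    rw [Finset.nonempty_iff_ne_empty]
    rintro rfl
    obtain ⟨y, hy⟩ := hne
    simpa using hcov hy
  obtain ⟨f, hf⟩ := SmoothPartitionOfUnity.exists_isSubordinate 𝓘(ℝ, Vec n)
    (isClosed_closure (s := Ω)) (fun i : s => Metric.ball (i : Vec n) (r i))
    (fun i => Metric.isOpen_ball) (hcov.trans (by
      intro y hy
      simp only [mem_iUnion] at hy ⊢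
      obtain ⟨x, hx, hy⟩ := hy
      exact ⟨⟨x, hx⟩, hy⟩))
  obtain ⟨k, hk⟩ : ∃ k : Fin s.card ≃ s, True := ⟨s.equivFin.symm, trivial⟩
  obtain ⟨a, ha, hmin⟩ := s.exists_min_image c hsne
  obtain ⟨b, hb, hmin'⟩ := s.exists_min_image τ₀ hsne
  refine ⟨Fin s.card, inferInstance, ⟨⟨fun i => f (k i), fun i => e (k i), c a, τ₀ b,
    hc a (hs a ha), hc1 a (hs a ha), hτ b (hs b hb), fun i => he _ (hs _ (k i).2),
    fun i => (f (k i)).contMDiff.contDiff, fun i => ?_, fun i x => f.nonneg _ _, fun x hx => ?_,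
    fun i x hx h0 τ h1 h2 z hz => ?_⟩⟩⟩
  · exact (isCompact_closedBall (k i : Vec n) (r (k i))).of_isClosed_subset (isClosed_tsupport _)
      ((hf (k i)).trans Metric.ball_subset_closedBall)
  · have := f.sum_eq_one (subset_closure hx)
    rw [finsum_eq_sum_of_fintype] at this
    rw [← this]
    exact Equiv.sum_comp k fun i => f i x
  · have hmem : x ∈ Metric.ball (k i : Vec n) (r (k i)) := hf (k i) (subset_tsupport _ h0)
    refine hin _ (hs _ (k i).2) x hmem hx τ h1 (h2.trans_le (hmin' _ (k i).2)) z (hz.trans ?_)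
    gcongr
    exact hmin _ (k i).2

end Partition

/-! ### Mollification, and continuity of translations in `L¹`. -/

section Mollify

variable {n M : ℕ}

/-- Smooth kernels of mass one that are supported in the ball of radius `ε`. -/
structure IsMollifier (ε : ℝ) (η : Vec n → ℝ) : Prop where
  contDiff : ContDiff ℝ ∞ η
  nonneg : ∀ z, 0 ≤ η z
  integral_eq_one : ∫ z, η z = 1
  tsupport_subset : tsupport η ⊆ Metric.closedBall 0 ε

lemma exists_isMollifier {ε : ℝ} (hε : 0 < ε) : ∃ η : Vec n → ℝ, IsMollifier ε η := by
  let f : ContDiffBump (0 : Vec n) := ⟨ε / 2, ε, by linarith, by linarith⟩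
  refine ⟨f.normed volume, f.contDiff_normed, f.nonneg_normed, f.integral_normed, ?_⟩
  rw [f.tsupport_normed_eq]

/-- Convolution of `g` with the kernel `η`. -/
noncomputable def mollify (η : Vec n → ℝ) (g : Vec n → Vec M) : Vec n → Vec M :=
  convolution η g (ContinuousLinearMap.lsmul ℝ ℝ) volume

/-- The gradient tensor of a differentiable function. -/
noncomputable def gradOf (v : Vec n → Vec M) (x : Vec n) : Tens n M :=
  WithLp.toLp 2 fun c => fderiv ℝ v x (EuclideanSpace.single c.2 1) c.1

namespace IsMollifier

variable {ε : ℝ} {η : Vec n → ℝ} {g : Vec n → Vec M}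

lemma hasCompactSupport (h : IsMollifier ε η) : HasCompactSupport η :=
  (isCompact_closedBall 0 ε).of_isClosed_subset (isClosed_tsupport _) h.tsupport_subset

lemma eq_zero (h : IsMollifier ε η) {z : Vec n} (hz : ε < ‖z‖) : η z = 0 :=
  image_eq_zero_of_notMem_tsupport fun h' => by
    have := h.tsupport_subset h'
    rw [mem_closedBall_zero_iff] at this
    linarith

lemma integrable (h : IsMollifier ε η) : Integrable η :=
  h.contDiff.continuous.integrable_of_hasCompactSupport h.hasCompactSupport

lemma lintegral_eq_one (h : IsMollifier ε η) : ∫⁻ z, ENNReal.ofReal (η z) = 1 := by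
  rw [← ofReal_integral_eq_lintegral_ofReal h.integrable (Eventually.of_forall h.nonneg),
    h.integral_eq_one, ENNReal.ofReal_one]

lemma exists_bound (h : IsMollifier ε η) : ∃ B, ∀ z, ‖η z‖ ≤ B :=
  h.hasCompactSupport.exists_bound_of_continuous h.contDiff.continuous

lemma mollify_eq (η : Vec n → ℝ) (g : Vec n → Vec M) (x : Vec n) :
    mollify η g x = ∫ z, η z • g (x - z) := rfl

lemma mollify_eq' (η : Vec n → ℝ) (g : Vec n → Vec M) (x : Vec n) :
    mollify η g x = ∫ z, η (x - z) • g z := by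
  rw [mollify_eq, ← integral_sub_left_eq_self (fun z => η z • g (x - z)) volume x]
  simp

lemma contDiff_mollify (h : IsMollifier ε η) (hg : Integrable g) : ContDiff ℝ ∞ (mollify η g) :=
  h.hasCompactSupport.contDiff_convolution_left _ h.contDiff hg.locallyIntegrable

lemma integrable_smul (h : IsMollifier ε η) (hg : Integrable g) (x : Vec n) :
    Integrable fun z => η z • g (x - z) := by
  obtain ⟨B, hB⟩ := h.exists_bound
  exact (hg.comp_sub_left x).bdd_smul B h.contDiff.continuous.aestronglyMeasurable
    (Eventually.of_forall hB)

/-- Mollification changes `g` in `L¹` by no more than small translations do. -/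
lemma lintegral_mollify_sub_le (h : IsMollifier ε η) (hg : Integrable g) (hgm : StronglyMeasurable g)
    {ψ : Vec n → ENNReal} (hψ : Measurable ψ) (a : Vec n) {δ : ENNReal}
    (hδ : ∀ z, ‖z‖ ≤ ε → ∫⁻ x, ψ x * ‖g (x + a - z) - g x‖ₑ ≤ δ) :
    ∫⁻ x, ψ x * ‖mollify η g (x + a) - g x‖ₑ ≤ δ := by
  have hη := h.contDiff.continuous
  have hm : Measurable fun y : Vec n × Vec n =>
      ψ y.1 * (ENNReal.ofReal (η y.2) * ‖g (y.1 + a - y.2) - g y.1‖ₑ) := by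
    have h1 : Measurable fun y : Vec n × Vec n => g (y.1 + a - y.2) - g y.1 :=
      (hgm.measurable.comp (by fun_prop)).sub (hgm.measurable.comp measurable_fst)
    have h2 : Measurable fun y : Vec n × Vec n => η y.2 := hη.measurable.comp measurable_snd
    exact (hψ.comp measurable_fst).mul (h2.ennreal_ofReal.mul h1.enorm)
  -- The weight `ψ` allows for translations that are controlled only on part of the space, as for
  -- the members of a partition on `Ω`.
  calc ∫⁻ x, ψ x * ‖mollify η g (x + a) - g x‖ₑ
      ≤ ∫⁻ x, ∫⁻ z, ψ x * (ENNReal.ofReal (η z) * ‖g (x + a - z) - g x‖ₑ) := by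
        refine lintegral_mono fun x => ?_
        rw [lintegral_const_mul _ (by
          exact (hη.measurable.ennreal_ofReal).mul
            ((hgm.measurable.comp (by fun_prop)).sub measurable_const).enorm)]
        gcongr
        have e : mollify η g (x + a) - g x = ∫ z, η z • (g (x + a - z) - g x) := by
          simp_rw [smul_sub]
          rw [integral_sub (h.integrable_smul hg _) (h.integrable.smul_const _),
            integral_smul_const, h.integral_eq_one, one_smul, mollify_eq]
        rw [e]
        refine (enorm_integral_le_lintegral_enorm _).trans (le_of_eq ?_)
        refine lintegral_congr fun z => ?_
        rw [enorm_smul, Real.enorm_of_nonneg (h.nonneg z)]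
    _ = ∫⁻ z, ∫⁻ x, ψ x * (ENNReal.ofReal (η z) * ‖g (x + a - z) - g x‖ₑ) :=
        lintegral_lintegral_swap hm.aemeasurable
    _ ≤ ∫⁻ z, ENNReal.ofReal (η z) * δ := by
        refine lintegral_mono fun z => ?_
        by_cases hz : ‖z‖ ≤ ε
        · calc ∫⁻ x, ψ x * (ENNReal.ofReal (η z) * ‖g (x + a - z) - g x‖ₑ)
              = ∫⁻ x, ENNReal.ofReal (η z) * (ψ x * ‖g (x + a - z) - g x‖ₑ) :=
                lintegral_congr fun x => by ring
            _ = ENNReal.ofReal (η z) * ∫⁻ x, ψ x * ‖g (x + a - z) - g x‖ₑ :=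
                lintegral_const_mul' _ _ ENNReal.ofReal_ne_top
            _ ≤ _ := by gcongr; exact hδ z hz
        · simp [h.eq_zero (not_le.1 hz)]
    _ = δ := by
        rw [lintegral_mul_const _ hη.measurable.ennreal_ofReal, h.lintegral_eq_one, one_mul]

lemma fderiv_mollify (h : IsMollifier ε η) (hg : Integrable g) (x : Vec n) (j : Fin M) (i : Fin n) :
    fderiv ℝ (mollify η g) x (EuclideanSpace.single i 1) j =
      ∫ z, g z j * fderiv ℝ η (x - z) (EuclideanSpace.single i 1) := by
  have h1 := h.hasCompactSupport.hasFDerivAt_convolution_left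
    (ContinuousLinearMap.lsmul ℝ ℝ : ℝ →L[ℝ] Vec M →L[ℝ] Vec M) (h.contDiff.of_le (by simp))
    hg.locallyIntegrable (μ := volume) x
  have hcs : HasCompactSupport (fderiv ℝ η) := h.hasCompactSupport.fderiv (𝕜 := ℝ)
  have hcont : Continuous (fderiv ℝ η) := h.contDiff.continuous_fderiv (by norm_num)
  have h2 := hcs.convolutionExists_left ((ContinuousLinearMap.lsmul ℝ ℝ :
    ℝ →L[ℝ] Vec M →L[ℝ] Vec M).precompL (Vec n)) hcont hg.locallyIntegrable (μ := volume) x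
  rw [mollify, h1.fderiv, convolution, ContinuousLinearMap.integral_apply h2.integrable,
    integral_apply (h2.integrable.apply_continuousLinearMap _),
    ← integral_sub_left_eq_self _ volume x]
  refine integral_congr_ae (Eventually.of_forall fun z => ?_)
  simp [ContinuousLinearMap.precompL_apply, mul_comm]

lemma isTest_translate (h : IsMollifier ε η) {Ω : Set (Vec n)} {x : Vec n}
    (hx : Metric.closedBall x ε ⊆ Ω) : IsTest Ω fun z => η (x - z) := by
  have hs : tsupport (fun z => η (x - z)) ⊆ Metric.closedBall x ε := by
    refine closure_minimal (fun z hz => ?_) Metric.isClosed_closedBall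
    rw [Metric.mem_closedBall, dist_comm, dist_eq_norm]
    by_contra hlt
    exact hz (h.eq_zero (not_le.1 hlt))
  exact ⟨h.contDiff.comp (contDiff_const.sub contDiff_id),
    (isCompact_closedBall x ε).of_isClosed_subset (isClosed_tsupport _) hs, hs.trans hx⟩

/-- Inside of `Ω` the gradient of a mollified function is the mollified gradient measure. -/
lemma gradOf_mollify (h : IsMollifier ε η) {Ω : Set (Vec n)} (hΩ : IsOpen Ω) {u : Vec n → Vec M}
    (hu : Integrable (Ω.indicator u)) {m : Measure (Vec n)} {p : Vec n → Tens n M} {t : Vec n → ℝ}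
    (hrep : GradRep Ω u m p t) {x : Vec n} (hx : Metric.closedBall x ε ⊆ Ω) :
    gradOf (mollify η (Ω.indicator u)) x = ∫ z, η (x - z) • p z ∂m := by
  have ht := h.isTest_translate hx
  obtain ⟨B, hB⟩ := ht.exists_bound
  ext ⟨j, i⟩
  have hi : Integrable (fun z => η (x - z) • p z) m :=
    hrep.int_p.bdd_smul B ht.1.continuous.aestronglyMeasurable (Eventually.of_forall hB)
  rw [integral_apply hi]
  change fderiv ℝ (mollify η (Ω.indicator u)) x (EuclideanSpace.single i 1) j = _
  rw [h.fderiv_mollify hu]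
  have h1 := hrep.grad _ ht j i
  -- The sign from the reflection of the kernel cancels the sign in the definition of the
  -- distributional gradient.
  have h2 : ∀ z, partialDeriv i (fun z => η (x - z)) z =
      - fderiv ℝ η (x - z) (EuclideanSpace.single i 1) := fun z => by
    have hd : HasFDerivAt (fun z => η (x - z))
        ((fderiv ℝ η (x - z)).comp (-ContinuousLinearMap.id ℝ (Vec n))) z :=
      ((h.contDiff.differentiable (by norm_num) (x - z)).hasFDerivAt).comp z
        ((hasFDerivAt_id z).const_sub x)
    rw [partialDeriv, hd.fderiv]
    simp
  simp_rw [h2, mul_neg, integral_neg, neg_inj] at h1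
  simp only [PiLp.smul_apply, smul_eq_mul]
  rw [← h1, ← integral_indicator hΩ.measurableSet]
  refine integral_congr_ae (Eventually.of_forall fun z => ?_)
  by_cases hz : z ∈ Ω <;> simp [hz]

end IsMollifier

/-- Continuity of translations in `L¹`. -/
lemma exists_lintegral_translate_le {g : Vec n → Vec M} (hg : Integrable g) {δ : ENNReal}
    (hδ : δ ≠ 0) : ∃ r > 0, ∀ a : Vec n, ‖a‖ < r → ∫⁻ x, ‖g (x + a) - g x‖ₑ ≤ δ := by
  -- Two shares pay for replacing `g` by a compactly supported continuous `g'`, before and after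
  -- translation; the third is for the uniform continuity of `g'`.
  obtain ⟨δ', hδ'0, hδ'⟩ : ∃ δ' : NNReal, 0 < δ' ∧ 3 * (δ' : ENNReal) ≤ δ := by
    obtain ⟨d, hd0, hd⟩ := ENNReal.lt_iff_exists_nnreal_btwn.1 (pos_iff_ne_zero.2 hδ)
    refine ⟨d / 3, by have : 0 < d := by exact_mod_cast hd0
                      positivity, le_trans (le_of_eq ?_) hd.le⟩
    rw [← ENNReal.coe_ofNat, ← ENNReal.coe_mul, mul_div_cancel₀ _ (by norm_num)]
  obtain ⟨g', hc, hgg', hcont, hmem⟩ :=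
    (memLp_one_iff_integrable.2 hg).exists_hasCompactSupport_eLpNorm_sub_le (by simp)
      (ε := δ') (by exact_mod_cast hδ'0.ne')
  rw [eLpNorm_one_eq_lintegral_enorm] at hgg'
  -- Off `K` both `g' x` and `g' (x + a)` vanish once `‖a‖ < 1`.
  set K := Metric.cthickening 1 (tsupport g')
  have hK : IsCompact K := hc.isCompact.cthickening
  set V := (volume K).toReal
  have hV : volume K = ENNReal.ofReal V := (ENNReal.ofReal_toReal hK.measure_lt_top.ne).symm
  have huc := hc.uniformContinuous_of_continuous hcont
  obtain ⟨r, hr, hur⟩ := Metric.uniformContinuous_iff.1 huc (δ' / (V + 1)) (by positivity)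
  refine ⟨min r 1, by positivity, fun a ha => ?_⟩
  have har : ‖a‖ < r := ha.trans_le (min_le_left _ _)
  have ha1 : ‖a‖ < 1 := ha.trans_le (min_le_right _ _)
  have hmid : ∫⁻ x, ‖g' (x + a) - g' x‖ₑ ≤ δ' := by
    calc ∫⁻ x, ‖g' (x + a) - g' x‖ₑ ≤ ∫⁻ x, K.indicator (fun _ => ENNReal.ofReal (δ' / (V + 1))) x := by
          refine lintegral_mono fun x => ?_
          by_cases hx : x ∈ K
          · rw [indicator_of_mem hx, ← ofReal_norm, ← dist_eq_norm]
            exact ENNReal.ofReal_le_ofReal (hur (by simpa [dist_eq_norm] using har)).le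
          · have h1 : g' x = 0 := image_eq_zero_of_notMem_tsupport fun h =>
              hx (Metric.self_subset_cthickening _ h)
            have h2 : g' (x + a) = 0 := image_eq_zero_of_notMem_tsupport fun h =>
              hx (Metric.mem_cthickening_of_dist_le x (x + a) 1 _ h (by
                simpa [dist_eq_norm] using ha1.le))
            simp [h1, h2]
      _ = ENNReal.ofReal (δ' / (V + 1)) * volume K := by
          rw [lintegral_indicator_const hK.isClosed.measurableSet]
      _ ≤ δ' := by
          rw [hV, ← ENNReal.ofReal_mul (by positivity)]
          refine ENNReal.ofReal_le_of_le_toReal ?_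
          rw [ENNReal.coe_toReal, div_mul_eq_mul_div, div_le_iff₀ (by positivity)]
          nlinarith [δ'.2, (ENNReal.toReal_nonneg : 0 ≤ V)]
  have hsub : AEStronglyMeasurable (g - g') := hg.1.sub hcont.aestronglyMeasurable
  have hshift : ∫⁻ x, ‖(g - g') (x + a)‖ₑ = ∫⁻ x, ‖(g - g') x‖ₑ :=
    lintegral_add_right_eq_self (fun x => ‖(g - g') x‖ₑ) a
  have hmeas : AEStronglyMeasurable (fun x => (g - g') (x + a)) :=
    hsub.comp_quasiMeasurePreserving (measurePreserving_add_right volume a).quasiMeasurePreserving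
  calc ∫⁻ x, ‖g (x + a) - g x‖ₑ
      ≤ ∫⁻ x, (‖(g - g') (x + a)‖ₑ + (‖g' (x + a) - g' x‖ₑ + ‖(g - g') x‖ₑ)) := by
        refine lintegral_mono fun x => ?_
        have e : g (x + a) - g x = (g - g') (x + a) + ((g' (x + a) - g' x) - (g - g') x) := by
          simp only [Pi.sub_apply]; abel
        rw [e]
        refine (enorm_add_le _ _).trans ?_
        gcongr
        exact enorm_sub_le
    _ = (∫⁻ x, ‖(g - g') (x + a)‖ₑ) +
          ((∫⁻ x, ‖g' (x + a) - g' x‖ₑ) + ∫⁻ x, ‖(g - g') x‖ₑ) := by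
        rw [lintegral_add_left' hmeas.enorm, lintegral_add_left' (by
          have : Continuous fun x => g' (x + a) - g' x := by fun_prop
          exact this.aestronglyMeasurable.enorm)]
    _ ≤ δ' + (δ' + δ') := by rw [hshift]; gcongr
    _ = 3 * δ' := by ring
    _ ≤ δ := hδ'

end Mollify

end Inpainting

/-! ### Gradient tensors and Jensen's inequality. -/

namespace Inpainting

section Gradient

variable {n M : ℕ}

/-- The tensor of the entries of a linear map. -/
noncomputable def toTens (n M : ℕ) : (Vec n →L[ℝ] Vec M) →L[ℝ] Tens n M :=
  LinearMap.toContinuousLinearMap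
    { toFun := fun A => WithLp.toLp 2 fun c => A (EuclideanSpace.single c.2 1) c.1
      map_add' := fun A B => by ext c; simp
      map_smul' := fun r A => by ext c; simp }

lemma toTens_apply (A : Vec n →L[ℝ] Vec M) (c : Fin M × Fin n) :
    toTens n M A c = A (EuclideanSpace.single c.2 1) c.1 := rfl

lemma gradOf_eq (v : Vec n → Vec M) (x : Vec n) : gradOf v x = toTens n M (fderiv ℝ v x) := rfl

/-- `toTens` is injective and the spaces are finite dimensional, so the operator norm is controlled
by the Euclidean norm of the entries. -/
lemma exists_norm_le_toTens (n M : ℕ) :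
    ∃ C : ℝ, 0 < C ∧ ∀ A : Vec n →L[ℝ] Vec M, ‖A‖ ≤ C * ‖toTens n M A‖ := by
  obtain ⟨C, hC, h⟩ := (toTens n M).toLinearMap.exists_antilipschitzWith (by
    rw [LinearMap.ker_eq_bot']
    intro A hA
    refine ContinuousLinearMap.coe_injective ((EuclideanSpace.basisFun (Fin n) ℝ).toBasis.ext ?_)
    intro i
    ext j
    have := congrArg (fun T : Tens n M => T (j, i)) hA
    simpa [toTens_apply] using this)
  refine ⟨C, by exact_mod_cast hC, fun A => ?_⟩
  have := h.le_mul_dist A 0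
  simpa [dist_eq_norm] using this

lemma continuous_gradOf {v : Vec n → Vec M} (hv : ContDiff ℝ 1 v) : Continuous (gradOf v) :=
  (toTens n M).continuous.comp (hv.continuous_fderiv (by norm_num))

end Gradient

section Jensen

variable {n M : ℕ} {ε : ℝ} {η : Vec n → ℝ} {Ω : Set (Vec n)} {u : Vec n → Vec M}
  {m : Measure (Vec n)} {p : Vec n → Tens n M} {t : Vec n → ℝ}

lemma GradRep.integral_vol (h : GradRep Ω u m p t) (φ : Vec n → ℝ) :
    ∫ x in Ω, φ x = ∫ x, t x * φ x ∂m := by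
  rw [h.vol, integral_withDensity_eq_integral_toReal_smul₀ h.int_t.aemeasurable.ennreal_ofReal
    (Eventually.of_forall fun _ => ENNReal.ofReal_lt_top)]
  refine integral_congr_ae ?_
  filter_upwards [h.t_nonneg] with x hx
  rw [ENNReal.toReal_ofReal hx, smul_eq_mul]

/-- Jensen's inequality for mollified gradient measures. -/
lemma IsMollifier.apply_le_integral_persp {F : Tens n M → ℝ} {ν₁ ν₂ ν₃ : ℝ}
    (hF : IsDensity F ν₁ ν₂ ν₃) (h : IsMollifier ε η) (hrep : GradRep Ω u m p t)
    {x : Vec n} (hx : Metric.closedBall x ε ⊆ Ω) :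
    F (∫ z, η (x - z) • p z ∂m) ≤ ∫ z, η (x - z) * persp F (p z) (t z) ∂m := by
  have ht := h.isTest_translate hx
  obtain ⟨B, hB⟩ := ht.exists_bound
  have hi : Integrable (fun z => η (x - z) • p z) m :=
    hrep.int_p.bdd_smul B ht.1.continuous.aestronglyMeasurable (Eventually.of_forall hB)
  have hit : Integrable (fun z => η (x - z) * t z) m := ht.integrable_mul hrep.int_t
  -- As `t m` is Lebesgue measure on `Ω` and the kernel is supported there, the weights have mass
  -- one.
  have hmass : ∫ z, η (x - z) * t z ∂m = 1 := by
    have h1 := hrep.integral_vol fun z => η (x - z)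
    rw [setIntegral_eq_integral_of_forall_compl_eq_zero fun z hz => by
      by_contra h0
      exact hz (ht.2.2 (subset_tsupport _ h0)), integral_sub_left_eq_self η volume x,
      h.integral_eq_one] at h1
    simp_rw [mul_comm, ← h1]
  set Q := ∫ z, η (x - z) • p z ∂m with hQ
  -- The tangent at the barycentre `Q` integrates to `F Q`; it lies below `persp F`, which is
  -- Jensen's inequality.
  have e : F Q = ∫ z, (η (x - z) * t z * (F Q - fderiv ℝ F Q Q) +
      fderiv ℝ F Q (η (x - z) • p z)) ∂m := by
    rw [integral_add (hit.mul_const _) ((fderiv ℝ F Q).integrable_comp hi), integral_mul_const,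
      hmass, ContinuousLinearMap.integral_comp_comm _ hi, ← hQ]
    ring
  rw [e]
  refine integral_mono_ae ((hit.mul_const _).add ((fderiv ℝ F Q).integrable_comp hi))
    (ht.integrable_mul (hF.integrable_persp hrep.int_p hrep.int_t.aemeasurable hrep.t_nonneg)) ?_
  filter_upwards [hrep.t_nonneg] with z hz
  have := mul_le_mul_of_nonneg_left (hF.tangent_le_persp (p z) Q hz) (h.nonneg (x - z))
  rw [map_smul, smul_eq_mul]
  linarith

end Jensen

/-! ### Regularization up to the boundary. -/

namespace InwardPartition

variable {n M : ℕ} {Ω : Set (Vec n)} {ι : Type} [Fintype ι] (Ψ : InwardPartition Ω ι)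

/-- Smoothing in the interior and up to the boundary, by mollification of the pieces after a
translation into `Ω`. -/
noncomputable def regularize (η : Vec n → ℝ) (τ : ℝ) (g : Vec n → Vec M) (x : Vec n) : Vec M :=
  ∑ i, Ψ.χ i x • mollify η g (x + τ • Ψ.e i)

/-- The part of the gradient of `regularize` that contains derivatives of the partition. -/
noncomputable def gradError (η : Vec n → ℝ) (τ : ℝ) (g : Vec n → Vec M) (x : Vec n) : Tens n M :=
  ∑ i, toTens n M ((fderiv ℝ (Ψ.χ i) x).smulRight (mollify η g (x + τ • Ψ.e i) - g x))

variable {Ψ} {ε τ : ℝ} {η : Vec n → ℝ} {g : Vec n → Vec M}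

lemma contDiff_regularize (h : IsMollifier ε η) (hg : Integrable g) :
    ContDiff ℝ ∞ (Ψ.regularize η τ g) :=
  ContDiff.sum fun i _ => (Ψ.contDiff i).smul
    ((h.contDiff_mollify hg).comp (contDiff_id.add contDiff_const))

lemma closedBall_subset (hτ : 0 < τ) (hτ₀ : τ < Ψ.τ₀) {x : Vec n} (hx : x ∈ Ω) {i : ι}
    (hi : Ψ.χ i x ≠ 0) : Metric.closedBall (x + τ • Ψ.e i) (Ψ.c * τ) ⊆ Ω := by
  intro y hy
  have := Ψ.inward i x hx hi τ hτ hτ₀ (y - (x + τ • Ψ.e i))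
    (by rwa [← dist_eq_norm, ← Metric.mem_closedBall])
  convert this using 1
  abel

lemma sum_fderiv (hΩ : IsOpen Ω) {x : Vec n} (hx : x ∈ Ω) : ∑ i, fderiv ℝ (Ψ.χ i) x = 0 := by
  have h1 : HasFDerivAt (fun y => ∑ i, Ψ.χ i y) (∑ i, fderiv ℝ (Ψ.χ i) x) x :=
    HasFDerivAt.fun_sum fun i _ => ((Ψ.contDiff i).differentiable (by norm_num) x).hasFDerivAt
  have h2 : (fun y => ∑ i, Ψ.χ i y) =ᶠ[𝓝 x] fun _ => 1 := by
    filter_upwards [hΩ.mem_nhds hx] with y hy using Ψ.sum_eq_one y hy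
  exact h1.unique ((hasFDerivAt_const (1 : ℝ) x).congr_of_eventuallyEq h2)

/-- The derivatives of the partition sum to zero on `Ω`, so `g x` may be subtracted in the terms
containing them. The error then involves only mollified differences, which are small in `L¹`. -/
lemma gradOf_regularize (hΩ : IsOpen Ω) (h : IsMollifier ε η) (hg : Integrable g) {x : Vec n}
    (hx : x ∈ Ω) : gradOf (Ψ.regularize η τ g) x =
      ∑ i, Ψ.χ i x • gradOf (mollify η g) (x + τ • Ψ.e i) + Ψ.gradError η τ g x := by
  have hd : ∀ i, HasFDerivAt (fun y => Ψ.χ i y • mollify η g (y + τ • Ψ.e i))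
      (Ψ.χ i x • fderiv ℝ (mollify η g) (x + τ • Ψ.e i) +
        (fderiv ℝ (Ψ.χ i) x).smulRight (mollify η g (x + τ • Ψ.e i))) x := fun i => by
    have h1 := ((Ψ.contDiff i).differentiable (by norm_num) x).hasFDerivAt
    have h2 := (((h.contDiff_mollify hg).differentiable (by norm_num)
      (x + τ • Ψ.e i)).hasFDerivAt).comp x ((hasFDerivAt_id x).add_const (τ • Ψ.e i))
    rw [ContinuousLinearMap.comp_id] at h2
    exact h1.smul h2
  have hs := HasFDerivAt.fun_sum (u := Finset.univ) fun i _ => hd i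
  have h0 : ∑ i, (fderiv ℝ (Ψ.χ i) x).smulRight (g x) = 0 := by
    ext y : 1
    have := congrArg (fun A : Vec n →L[ℝ] ℝ => A y • g x) (Ψ.sum_fderiv hΩ hx)
    simpa [sum_apply, Finset.sum_smul] using this
  rw [gradOf_eq]
  change toTens n M (fderiv ℝ (fun y => ∑ i, Ψ.χ i y • mollify η g (y + τ • Ψ.e i)) x) = _
  rw [hs.fderiv, gradError, Finset.sum_add_distrib, map_add, map_sum, ← map_sum]
  congr 1
  · simp [gradOf_eq]
  · have e : ∀ i, (fderiv ℝ (Ψ.χ i) x).smulRight (mollify η g (x + τ • Ψ.e i) - g x) =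
        (fderiv ℝ (Ψ.χ i) x).smulRight (mollify η g (x + τ • Ψ.e i)) -
          (fderiv ℝ (Ψ.χ i) x).smulRight (g x) := fun i => by
      ext y : 1; simp [smul_sub]
    simp_rw [← map_sum, e, Finset.sum_sub_distrib, h0, sub_zero]

lemma exists_lipschitz (Ψ : InwardPartition Ω ι) : ∃ L : ℝ, 0 < L ∧ (∀ i x, ‖fderiv ℝ (Ψ.χ i) x‖ ≤ L) ∧
    ∀ i x y, |Ψ.χ i x - Ψ.χ i y| ≤ L * ‖x - y‖ := by
  have h1 : ∀ i, ∃ C, ∀ x, ‖fderiv ℝ (Ψ.χ i) x‖ ≤ C := fun i =>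
    ((Ψ.hasCompactSupport i).fderiv (𝕜 := ℝ)).exists_bound_of_continuous
      ((Ψ.contDiff i).continuous_fderiv (by norm_num))
  choose C hC using h1
  have hC0 : ∀ i, 0 ≤ C i := fun i => (norm_nonneg _).trans (hC i 0)
  have hb : ∀ i x, ‖fderiv ℝ (Ψ.χ i) x‖ ≤ ∑ i, C i + 1 := fun i x => by
    have := Finset.single_le_sum (fun j _ => hC0 j) (Finset.mem_univ i)
    linarith [hC i x]
  refine ⟨∑ i, C i + 1, by have := Finset.sum_nonneg fun i (_ : i ∈ Finset.univ) => hC0 i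
                           linarith, hb, fun i x y => ?_⟩
  exact convex_univ.norm_image_sub_le_of_norm_fderiv_le (𝕜 := ℝ)
    (fun z _ => (Ψ.contDiff i).differentiable (by norm_num) z) (fun z _ => hb i z) (mem_univ y)
    (mem_univ x)

lemma le_one {x : Vec n} (hx : x ∈ Ω) (i : ι) : Ψ.χ i x ≤ 1 := by
  rw [← Ψ.sum_eq_one x hx]
  exact Finset.single_le_sum (fun j _ => Ψ.nonneg j x) (Finset.mem_univ i)

lemma regularize_sub {x : Vec n} (hx : x ∈ Ω) : Ψ.regularize η τ g x - g x =
    ∑ i, Ψ.χ i x • (mollify η g (x + τ • Ψ.e i) - g x) := by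
  simp_rw [smul_sub, Finset.sum_sub_distrib, ← Finset.sum_smul, Ψ.sum_eq_one x hx, one_smul]
  rfl

lemma enorm_regularize_sub_le {x : Vec n} (hx : x ∈ Ω) : ‖Ψ.regularize η τ g x - g x‖ₑ ≤
    ∑ i, ENNReal.ofReal (Ψ.χ i x) * ‖mollify η g (x + τ • Ψ.e i) - g x‖ₑ := by
  rw [regularize_sub hx]
  refine (enorm_sum_le _ _).trans (Finset.sum_le_sum fun i _ => ?_)
  rw [enorm_smul, Real.enorm_of_nonneg (Ψ.nonneg i x)]

lemma measurable_mollify (h : IsMollifier ε η) (hg : Integrable g) (a : Vec n) :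
    Measurable fun x => mollify η g (x + a) :=
  ((h.contDiff_mollify hg).continuous.comp (continuous_id.add continuous_const)).measurable

lemma enorm_gradError_le {L : ℝ} (hL : ∀ i x, ‖fderiv ℝ (Ψ.χ i) x‖ ≤ L) (x : Vec n) :
    ‖Ψ.gradError η τ g x‖ₑ ≤
      ∑ i, ENNReal.ofReal (‖toTens n M‖ * L) * ‖mollify η g (x + τ • Ψ.e i) - g x‖ₑ := by
  refine (enorm_sum_le _ _).trans (Finset.sum_le_sum fun i _ => ?_)
  have hL0 : 0 ≤ L := (norm_nonneg _).trans (hL i x)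
  rw [← ofReal_norm, ← ofReal_norm, ← ENNReal.ofReal_mul (by positivity)]
  refine ENNReal.ofReal_le_ofReal (((toTens n M).le_opNorm _).trans ?_)
  rw [ContinuousLinearMap.norm_smulRight_apply, mul_assoc]
  gcongr
  exact hL i x

/-- The smoothed functions do not have more energy than the convex combination of the translated
energies and the error term. -/
lemma apply_gradOf_regularize_le {F : Tens n M → ℝ} {ν₁ ν₂ ν₃ : ℝ} (hF : IsDensity F ν₁ ν₂ ν₃)
    (hΩ : IsOpen Ω) (hτ : 0 < τ) (hτ₀ : τ < Ψ.τ₀) (h : IsMollifier (Ψ.c * τ) η)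
    {u : Vec n → Vec M} {m : Measure (Vec n)} {p : Vec n → Tens n M} {t : Vec n → ℝ}
    (hu : Integrable (Ω.indicator u)) (hrep : GradRep Ω u m p t) {x : Vec n} (hx : x ∈ Ω) :
    ENNReal.ofReal (F (gradOf (Ψ.regularize η τ (Ω.indicator u)) x)) ≤
      ∑ i, ∫⁻ z, ENNReal.ofReal (Ψ.χ i x) * (ENNReal.ofReal (η (x + τ • Ψ.e i - z)) *
        ENNReal.ofReal (persp F (p z) (t z))) ∂m +
      ENNReal.ofReal ν₁ * ‖Ψ.gradError η τ (Ω.indicator u) x‖ₑ := by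
  rw [gradOf_regularize hΩ h hu hx]
  refine (ENNReal.ofReal_le_ofReal (hF.le_add _ _)).trans (ENNReal.ofReal_add_le.trans ?_)
  rw [ENNReal.ofReal_mul hF.nu_one_nonneg, ofReal_norm]
  gcongr
  -- Convexity of `F` with the weights `Ψ.χ i x`.
  refine (ENNReal.ofReal_le_ofReal (hF.strictConvex.convexOn.map_sum_le
    (fun i _ => Ψ.nonneg i x) (Ψ.sum_eq_one x hx) fun i _ => mem_univ _)).trans ?_
  rw [ENNReal.ofReal_sum_of_nonneg fun i _ => smul_nonneg (Ψ.nonneg i x) (hF.nonneg _)]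
  refine Finset.sum_le_sum fun i _ => ?_
  -- Only where the weight is nonzero is the translated ball known to lie in `Ω`; otherwise the term
  -- vanishes.
  by_cases hi : Ψ.χ i x = 0
  · simp [hi]
  have hb := Ψ.closedBall_subset hτ hτ₀ hx hi
  rw [smul_eq_mul, ENNReal.ofReal_mul (Ψ.nonneg i x), lintegral_const_mul' _ _ ENNReal.ofReal_ne_top]
  gcongr
  rw [h.gradOf_mollify hΩ hu hrep hb]
  refine (ENNReal.ofReal_le_ofReal (h.apply_le_integral_persp hF hrep hb)).trans ?_
  have hn : ∀ᵐ z ∂m, 0 ≤ persp F (p z) (t z) := by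
    filter_upwards [hrep.t_nonneg] with z hz using hF.persp_nonneg _ hz
  rw [ofReal_integral_eq_lintegral_ofReal ((h.isTest_translate hb).integrable_mul
    (hF.integrable_persp hrep.int_p hrep.int_t.aemeasurable hrep.t_nonneg))]
  · refine (lintegral_congr fun z => ?_).le
    rw [ENNReal.ofReal_mul (h.nonneg _)]
  · filter_upwards [hn] with z hz using mul_nonneg (h.nonneg _) hz

/-- After an exchange of integrals this is the factor of the energy density at `z`. The kernel
vanishes unless `‖x - z‖ ≤ 2 * τ`, so `χ i x` may be replaced by `χ i z` at the cost `L * (2 * τ)`.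
-/
lemma lintegral_kernel_le (hτ : 0 < τ) (h : IsMollifier (Ψ.c * τ) η) {L : ℝ}
    (hL0 : 0 < L) (hL : ∀ i x y, |Ψ.χ i x - Ψ.χ i y| ≤ L * ‖x - y‖) (i : ι) (z : Vec n) :
    ∫⁻ x in Ω, ENNReal.ofReal (Ψ.χ i x) * ENNReal.ofReal (η (x + τ • Ψ.e i - z)) ≤
      ENNReal.ofReal (Ψ.χ i z + L * (2 * τ)) := by
  calc ∫⁻ x in Ω, ENNReal.ofReal (Ψ.χ i x) * ENNReal.ofReal (η (x + τ • Ψ.e i - z))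
      ≤ ∫⁻ x, ENNReal.ofReal (Ψ.χ i z + L * (2 * τ)) * ENNReal.ofReal (η (x + τ • Ψ.e i - z)) := by
        refine (setLIntegral_le_lintegral _ _).trans (lintegral_mono fun x => ?_)
        by_cases hz : ‖x + τ • Ψ.e i - z‖ ≤ Ψ.c * τ
        · gcongr
          have h1 : ‖x - z‖ ≤ 2 * τ := by
            calc ‖x - z‖ = ‖(x + τ • Ψ.e i - z) - τ • Ψ.e i‖ := by congr 1; abel
              _ ≤ ‖x + τ • Ψ.e i - z‖ + ‖τ • Ψ.e i‖ := norm_sub_le _ _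
              _ ≤ 1 * τ + τ * 1 := by
                rw [norm_smul, Real.norm_of_nonneg hτ.le]
                gcongr
                · exact hz.trans (by gcongr; exact Ψ.c_le)
                · exact Ψ.norm_e i
              _ = 2 * τ := by ring
          have h2 := (le_abs_self _).trans (hL i x z)
          have h3 := mul_le_mul_of_nonneg_left h1 hL0.le
          linarith
        · simp [h.eq_zero (not_le.1 hz)]
    _ = _ := by
        rw [lintegral_const_mul' _ _ ENNReal.ofReal_ne_top]
        have : ∀ x, x + τ • Ψ.e i - z = x + (τ • Ψ.e i - z) := fun x => by abel
        simp_rw [this]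
        rw [lintegral_add_right_eq_self (fun x => ENNReal.ofReal (η x)), h.lintegral_eq_one, mul_one]

/-- The energy of the smoothed function. -/
lemma lintegral_apply_gradOf_regularize_le {F : Tens n M → ℝ} {ν₁ ν₂ ν₃ : ℝ}
    (hF : IsDensity F ν₁ ν₂ ν₃) (hΩ : IsOpen Ω) (hτ : 0 < τ) (hτ₀ : τ < Ψ.τ₀)
    (h : IsMollifier (Ψ.c * τ) η) {L : ℝ} (hL0 : 0 < L)
    (hL : ∀ i x y, |Ψ.χ i x - Ψ.χ i y| ≤ L * ‖x - y‖) {u : Vec n → Vec M} {m : Measure (Vec n)}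
    {p : Vec n → Tens n M} {t : Vec n → ℝ} (hu : Integrable (Ω.indicator u))
    (hrep : GradRep Ω u m p t) :
    ∫⁻ x in Ω, ENNReal.ofReal (F (gradOf (Ψ.regularize η τ (Ω.indicator u)) x)) ≤
      ENNReal.ofReal (1 + Fintype.card ι * (L * (2 * τ))) *
        (∫⁻ z, ENNReal.ofReal (persp F (p z) (t z)) ∂m) +
      ENNReal.ofReal ν₁ * ∫⁻ x in Ω, ‖Ψ.gradError η τ (Ω.indicator u) x‖ₑ := by
  have := hrep.finite
  have hη := h.contDiff.continuous
  have hpm : AEMeasurable (fun z => ENNReal.ofReal (persp F (p z) (t z))) m :=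
    (hF.integrable_persp hrep.int_p hrep.int_t.aemeasurable
      hrep.t_nonneg).aemeasurable.ennreal_ofReal
  have hkm : ∀ i, Measurable fun y : Vec n × Vec n =>
      ENNReal.ofReal (Ψ.χ i y.1) * ENNReal.ofReal (η (y.1 + τ • Ψ.e i - y.2)) := fun i => by
    have h1 : Measurable fun y : Vec n × Vec n => Ψ.χ i y.1 :=
      (Ψ.contDiff i).continuous.measurable.comp measurable_fst
    have h2 : Measurable fun y : Vec n × Vec n => η (y.1 + τ • Ψ.e i - y.2) :=
      hη.measurable.comp (by fun_prop)
    exact h1.ennreal_ofReal.mul h2.ennreal_ofReal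
  have hjoint : ∀ i, AEMeasurable (fun y : Vec n × Vec n => ENNReal.ofReal (Ψ.χ i y.1) *
      (ENNReal.ofReal (η (y.1 + τ • Ψ.e i - y.2)) *
        ENNReal.ofReal (persp F (p y.2) (t y.2)))) ((volume.restrict Ω).prod m) := fun i => by
    have := (hkm i).aemeasurable.mul (hpm.comp_snd (μ := volume.restrict Ω))
    refine this.congr (Eventually.of_forall fun y => ?_)
    simp only [Pi.mul_apply]
    ring
  refine (setLIntegral_mono' hΩ.measurableSet fun x hx =>
    Ψ.apply_gradOf_regularize_le hF hΩ hτ hτ₀ h hu hrep hx).trans ?_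
  rw [lintegral_add_left' (Finset.aemeasurable_fun_sum _ fun i _ =>
    (hjoint i).lintegral_prod_right'), lintegral_const_mul' _ _ ENNReal.ofReal_ne_top]
  gcongr
  rw [lintegral_finsetSum' _ fun i _ => (hjoint i).lintegral_prod_right']
  calc ∑ i, ∫⁻ x in Ω, ∫⁻ z, ENNReal.ofReal (Ψ.χ i x) * (ENNReal.ofReal (η (x + τ • Ψ.e i - z)) *
        ENNReal.ofReal (persp F (p z) (t z))) ∂m
      = ∑ i, ∫⁻ z, ENNReal.ofReal (persp F (p z) (t z)) * (∫⁻ x in Ω, ENNReal.ofReal (Ψ.χ i x) *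
          ENNReal.ofReal (η (x + τ • Ψ.e i - z))) ∂m := by
        refine Finset.sum_congr rfl fun i _ => ?_
        rw [lintegral_lintegral_swap (hjoint i)]
        refine lintegral_congr fun z => ?_
        rw [← lintegral_const_mul' _ _ ENNReal.ofReal_ne_top]
        exact lintegral_congr fun x => by ring
    _ ≤ ∑ i, ∫⁻ z, ENNReal.ofReal (persp F (p z) (t z)) *
          ENNReal.ofReal (Ψ.χ i z + L * (2 * τ)) ∂m := by
        gcongr with i _ z
        exact Ψ.lintegral_kernel_le hτ h hL0 hL i z
    _ = ∫⁻ z, ∑ i, ENNReal.ofReal (persp F (p z) (t z)) *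
          ENNReal.ofReal (Ψ.χ i z + L * (2 * τ)) ∂m := by
        refine (lintegral_finsetSum' _ fun i _ => hpm.mul ?_).symm
        exact ((Ψ.contDiff i).continuous.add
          continuous_const).measurable.ennreal_ofReal.aemeasurable
    _ = ∫⁻ z, ENNReal.ofReal (1 + Fintype.card ι * (L * (2 * τ))) *
          ENNReal.ofReal (persp F (p z) (t z)) ∂m := by
        refine lintegral_congr_ae ?_
        -- On `Ω`, which carries `m`, the partition sums to one; only the Lipschitz errors of the
        -- members add to the factor.
        have : ∀ᵐ z ∂m, z ∈ Ω := hrep.compl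
        filter_upwards [this] with z hz
        rw [← Finset.mul_sum, mul_comm, ← ENNReal.ofReal_sum_of_nonneg fun i _ =>
          add_nonneg (Ψ.nonneg i z) (by positivity), Finset.sum_add_distrib, Ψ.sum_eq_one z hz]
        simp
    _ = _ := lintegral_const_mul' _ _ ENNReal.ofReal_ne_top

end InwardPartition

end Inpainting

/-! ### Smooth approximation in `BV` with control of the energy. -/

namespace Inpainting

variable {n M : ℕ} {Ω D : Set (Vec n)}

/-- Functions of bounded variation are limits of smooth functions, with their energy. -/
lemma IsBoundedLipschitzDomain.exists_contDiff_approx (hΩ : IsBoundedLipschitzDomain Ω)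
    {F : Tens n M → ℝ} {ν₁ ν₂ ν₃ : ℝ} (hF : IsDensity F ν₁ ν₂ ν₃) {u : Vec n → Vec M}
    (hu : MemLp u 1 (volume.restrict Ω)) {m : Measure (Vec n)} {p : Vec n → Tens n M}
    {t : Vec n → ℝ} (hrep : GradRep Ω u m p t) {δ : ℝ} (hδ : 0 < δ) :
    ∃ v : Vec n → Vec M, ContDiff ℝ ∞ v ∧ ∫⁻ x in Ω, ‖v x - u x‖ₑ ≤ ENNReal.ofReal δ ∧
      ∫⁻ x in Ω, ENNReal.ofReal (F (gradOf v x)) ≤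
        ENNReal.ofReal ((∫ x, persp F (p x) (t x) ∂m) + δ) := by
  have hm := hΩ.isOpen.measurableSet
  obtain ⟨u', hu'm, huu'⟩ := hu.1
  have hrep' := hrep.congr huu'
  have hint : Integrable (Ω.indicator u') :=
    (integrable_indicator_iff hm).2 ((memLp_one_iff_integrable.1 hu).congr huu')
  have hgm : StronglyMeasurable (Ω.indicator u') := hu'm.indicator hm
  obtain ⟨ι, _, ⟨Ψ⟩⟩ := hΩ.exists_inwardPartition
  obtain ⟨L, hL0, hL, hL'⟩ := Ψ.exists_lipschitz
  set N : ℝ := ((Fintype.card ι : ℕ) : ℝ) with hN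
  have hN0 : 0 ≤ N := by positivity
  set A := ∫ x, persp F (p x) (t x) ∂m
  have hpn : 0 ≤ᵐ[m] fun z => persp F (p z) (t z) := by
    filter_upwards [hrep.t_nonneg] with z hz using hF.persp_nonneg _ hz
  have hA0 : 0 ≤ A := integral_nonneg_of_ae hpn
  have hA : ∫⁻ z, ENNReal.ofReal (persp F (p z) (t z)) ∂m = ENNReal.ofReal A :=
    (ofReal_integral_eq_lintegral_ofReal
      (hF.integrable_persp hrep.int_p hrep.int_t.aemeasurable hrep.t_nonneg) hpn).symm
  have hν := hF.nu_one_nonneg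
  set T := ‖toTens n M‖
  -- `N * d` bounds the `L¹` distance, and `ν₁ * (N * (T * L)) * d ≤ δ / 2` bounds the cost of the
  -- gradient error.
  obtain ⟨d, hd, hd'⟩ : ∃ d > 0, (N + 2 * (ν₁ * (N * (T * L)))) * d ≤ δ := by
    refine ⟨δ / (N + 2 * (ν₁ * (N * (T * L))) + 1), by positivity, ?_⟩
    rw [mul_div_assoc', div_le_iff₀ (by positivity)]
    nlinarith
  obtain ⟨r, hr, htr⟩ := exists_lintegral_translate_le hint (ENNReal.ofReal_pos.2 hd).ne'
  -- The translations involved have length at most `2 * τ`, and the last condition bounds the excess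
  -- of the factor in front of the energy.
  obtain ⟨τ, hτ, hτ₀, hτr, hτA⟩ : ∃ τ > 0, τ < Ψ.τ₀ ∧ 2 * τ < r ∧
      N * (L * (2 * τ)) * A ≤ δ / 2 := by
    refine ⟨min (min (Ψ.τ₀ / 2) (r / 4)) (δ / (4 * (N * L * A + 1))), ?_, ?_, ?_, ?_⟩
    · have := Ψ.τ₀_pos
      positivity
    · have := Ψ.τ₀_pos
      exact ((min_le_left _ _).trans (min_le_left _ _)).trans_lt (by linarith)
    · have := (min_le_left (min (Ψ.τ₀ / 2) (r / 4)) (δ / (4 * (N * L * A + 1)))).trans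
        (min_le_right _ _)
      linarith
    · calc N * (L * (2 * min (min (Ψ.τ₀ / 2) (r / 4)) (δ / (4 * (N * L * A + 1))))) * A
          ≤ N * (L * (2 * (δ / (4 * (N * L * A + 1))))) * A := by
            gcongr; exact min_le_right _ _
        _ = (N * L * A) / (N * L * A + 1) * (δ / 2) := by field_simp; ring
        _ ≤ 1 * (δ / 2) := by
            gcongr
            rw [div_le_one (by positivity)]
            linarith
        _ = δ / 2 := one_mul _
  obtain ⟨η, hη⟩ := exists_isMollifier (n := n) (mul_pos Ψ.c_pos hτ)
  have hstep : ∀ i, ∫⁻ x, ‖mollify η (Ω.indicator u') (x + τ • Ψ.e i) - Ω.indicator u' x‖ₑ ≤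
      ENNReal.ofReal d := fun i => by
    have := hη.lintegral_mollify_sub_le hint hgm (ψ := fun _ => 1) measurable_const (τ • Ψ.e i)
      (δ := ENNReal.ofReal d) (fun z hz => by
        simp_rw [one_mul, add_sub_assoc]
        refine htr _ ((norm_sub_le _ _).trans_lt ?_)
        rw [norm_smul, Real.norm_of_nonneg hτ.le]
        have h1 := mul_le_mul_of_nonneg_left (Ψ.norm_e i) hτ.le
        have h2 := mul_le_mul_of_nonneg_right Ψ.c_le hτ.le
        linarith)
    simpa using this
  have hmm : ∀ i, Measurable fun x =>
      ‖mollify η (Ω.indicator u') (x + τ • Ψ.e i) - Ω.indicator u' x‖ₑ := fun i =>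
    ((InwardPartition.measurable_mollify hη hint _).sub hgm.measurable).enorm
  refine ⟨Ψ.regularize η τ (Ω.indicator u'), InwardPartition.contDiff_regularize hη hint, ?_, ?_⟩
  · calc ∫⁻ x in Ω, ‖Ψ.regularize η τ (Ω.indicator u') x - u x‖ₑ
        = ∫⁻ x in Ω, ‖Ψ.regularize η τ (Ω.indicator u') x - Ω.indicator u' x‖ₑ := by
          refine lintegral_congr_ae ?_
          filter_upwards [huu', ae_restrict_mem hm] with x hx hxΩ
          rw [hx, indicator_of_mem hxΩ]
      _ ≤ ∫⁻ x in Ω, ∑ i, ‖mollify η (Ω.indicator u') (x + τ • Ψ.e i) - Ω.indicator u' x‖ₑ := by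
          refine setLIntegral_mono' hm fun x hx =>
            (InwardPartition.enorm_regularize_sub_le hx).trans ?_
          gcongr with i
          exact mul_le_of_le_one_left' (ENNReal.ofReal_le_one.2 (InwardPartition.le_one hx i))
      _ = ∑ i, ∫⁻ x in Ω, ‖mollify η (Ω.indicator u') (x + τ • Ψ.e i) - Ω.indicator u' x‖ₑ :=
          lintegral_finsetSum _ fun i _ => hmm i
      _ ≤ ∑ _i : ι, ENNReal.ofReal d := by
          gcongr with i
          exact (setLIntegral_le_lintegral _ _).trans (hstep i)
      _ = ENNReal.ofReal (N * d) := by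
          rw [Finset.sum_const, nsmul_eq_mul, Finset.card_univ, ENNReal.ofReal_mul hN0, hN,
            ENNReal.ofReal_natCast]
      _ ≤ _ := by
          refine ENNReal.ofReal_le_ofReal ?_
          have : 0 ≤ 2 * (ν₁ * (N * (T * L))) * d := by positivity
          linarith
  · refine (InwardPartition.lintegral_apply_gradOf_regularize_le hF hΩ.isOpen hτ hτ₀ hη hL0 hL' hint
      hrep').trans ?_
    have herr : ∫⁻ x in Ω, ‖Ψ.gradError η τ (Ω.indicator u') x‖ₑ ≤
        ENNReal.ofReal (N * (T * L) * d) := by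
      calc ∫⁻ x in Ω, ‖Ψ.gradError η τ (Ω.indicator u') x‖ₑ
          ≤ ∫⁻ x, ∑ i, ENNReal.ofReal (T * L) *
              ‖mollify η (Ω.indicator u') (x + τ • Ψ.e i) - Ω.indicator u' x‖ₑ :=
            (setLIntegral_le_lintegral _ _).trans
              (lintegral_mono fun x => InwardPartition.enorm_gradError_le hL x)
        _ = ∑ i, ENNReal.ofReal (T * L) *
              ∫⁻ x, ‖mollify η (Ω.indicator u') (x + τ • Ψ.e i) - Ω.indicator u' x‖ₑ := by
            rw [lintegral_finsetSum _ fun i _ => (hmm i).const_mul _]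
            simp_rw [lintegral_const_mul _ (hmm _)]
        _ ≤ ∑ _i : ι, ENNReal.ofReal (T * L) * ENNReal.ofReal d := by
            gcongr with i
            exact hstep i
        _ = ENNReal.ofReal (N * (T * L) * d) := by
            rw [Finset.sum_const, nsmul_eq_mul, Finset.card_univ, ← ENNReal.ofReal_mul (by positivity),
              ← ENNReal.ofReal_natCast, ← hN, ← ENNReal.ofReal_mul hN0]
            congr 1
            ring
    rw [hA, ← ENNReal.ofReal_mul (by positivity)]
    calc _ ≤ ENNReal.ofReal ((1 + N * (L * (2 * τ))) * A) +
          ENNReal.ofReal ν₁ * ENNReal.ofReal (N * (T * L) * d) := by gcongr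
      _ = ENNReal.ofReal ((1 + N * (L * (2 * τ))) * A + ν₁ * (N * (T * L) * d)) := by
          rw [← ENNReal.ofReal_mul hν, ← ENNReal.ofReal_add (by positivity) (by positivity)]
      _ ≤ _ := by
          refine ENNReal.ofReal_le_ofReal ?_
          have : 0 ≤ N * d := by positivity
          linarith

lemma IsBoundedLipschitzDomain.volume_ne_top (hΩ : IsBoundedLipschitzDomain Ω) : volume Ω ≠ ⊤ :=
  hΩ.isBounded.measure_lt_top.ne

/-- Continuous functions on `ℝⁿ` are bounded on bounded sets. -/
lemma exists_bound_of_isBounded {E : Type*} [NormedAddCommGroup E] (hΩ : Bornology.IsBounded Ω)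
    {g : Vec n → E} (hg : Continuous g) : ∃ C, ∀ x ∈ Ω, ‖g x‖ ≤ C := by
  obtain ⟨C, hC⟩ := hΩ.isCompact_closure.exists_bound_of_continuousOn hg.continuousOn
  exact ⟨C, fun x hx => hC x (subset_closure hx)⟩

lemma memLp_of_continuous {E : Type*} [NormedAddCommGroup E] [SecondCountableTopologyEither (Vec n) E]
    (hΩ : IsBoundedLipschitzDomain Ω) {S : Set (Vec n)} (hS : S ⊆ Ω) {g : Vec n → E}
    (hg : Continuous g) (q : ENNReal) : MemLp g q (volume.restrict S) := by
  obtain ⟨C, hC⟩ := exists_bound_of_isBounded hΩ.isBounded hg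
  have : IsFiniteMeasure (volume.restrict Ω) := ⟨by simpa using hΩ.isBounded.measure_lt_top⟩
  refine MemLp.mono_measure (Measure.restrict_mono hS le_rfl) (MemLp.of_bound
    hg.aestronglyMeasurable C ?_)
  filter_upwards [ae_restrict_mem hΩ.isOpen.measurableSet] with x hx using hC x hx

/-- The classical gradient is a weak gradient. -/
lemma isWeakGrad_gradOf (hΩ : IsBoundedLipschitzDomain Ω) {v : Vec n → Vec M}
    (hv : ContDiff ℝ 1 v) : IsWeakGrad Ω v (gradOf v) := by
  refine ⟨memLp_of_continuous hΩ le_rfl (continuous_gradOf hv) 1, fun φ hφ j i => ?_⟩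
  have hvj : ContDiff ℝ 1 fun x => v x j :=
    (EuclideanSpace.proj j : Vec M →L[ℝ] ℝ).contDiff.comp hv
  have hvd : ∀ x, fderiv ℝ (fun x => v x j) x (EuclideanSpace.single i 1) = gradOf v x (j, i) := by
    intro x
    have := (EuclideanSpace.proj j : Vec M →L[ℝ] ℝ).hasFDerivAt.comp x
      (hv.differentiable (by norm_num) x).hasFDerivAt
    rw [show (fun x => v x j) = (EuclideanSpace.proj j : Vec M →L[ℝ] ℝ) ∘ v from rfl, this.fderiv]
    rfl
  have hdc := hφ.continuous_partialDeriv i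
  have hgc : Continuous fun x => gradOf v x (j, i) :=
    (EuclideanSpace.proj (j, i) : Tens n M →L[ℝ] ℝ).continuous.comp (continuous_gradOf hv)
  have hds : HasCompactSupport (partialDeriv i φ) := by
    refine (hφ.2.1.fderiv (𝕜 := ℝ)).comp_left (g := fun A => A (EuclideanSpace.single i 1)) rfl
  have hφd : ∀ x, x ∉ Ω → partialDeriv i φ x = 0 := fun x hx => by
    rw [partialDeriv, image_eq_zero_of_notMem_tsupport (fun h' =>
      hx (hφ.2.2 (tsupport_fderiv_subset ℝ h')))]
    rfl
  have hφ0 : ∀ x, x ∉ Ω → φ x = 0 := fun x hx =>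
    image_eq_zero_of_notMem_tsupport fun h' => hx (hφ.2.2 h')
  rw [setIntegral_eq_integral_of_forall_compl_eq_zero fun x hx => by rw [hφd x hx, mul_zero],
    setIntegral_eq_integral_of_forall_compl_eq_zero fun x hx => by rw [hφ0 x hx, zero_mul]]
  simp_rw [← hvd, partialDeriv]
  rw [integral_mul_fderiv_eq_neg_fderiv_mul_of_integrable]
  · simp_rw [mul_comm]
  · simp_rw [hvd]
    exact (hgc.mul hφ.1.continuous).integrable_of_hasCompactSupport hφ.2.1.mul_left
  · exact (hvj.continuous.mul hdc).integrable_of_hasCompactSupport hds.mul_left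
  · exact (hvj.continuous.mul hφ.1.continuous).integrable_of_hasCompactSupport hφ.2.1.mul_left
  · exact fun x _ => hvj.differentiable (by norm_num) x
  · exact fun x _ => hφ.1.differentiable (by norm_num) x

lemma mem_classW_of_contDiff (hΩ : IsBoundedLipschitzDomain Ω) {v : Vec n → Vec M}
    (hv : ContDiff ℝ 1 v) (ζ : ℝ) : v ∈ classW M Ω D ζ :=
  ⟨⟨memLp_of_continuous hΩ le_rfl hv.continuous 1, _, isWeakGrad_gradOf hΩ hv⟩,
    memLp_of_continuous hΩ sdiff_subset hv.continuous _⟩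

lemma energy_of_contDiff (hΩ : IsBoundedLipschitzDomain Ω) {F : Tens n M → ℝ} {ν₁ ν₂ ν₃ : ℝ}
    (hF : IsDensity F ν₁ ν₂ ν₃) {v : Vec n → Vec M} (hv : ContDiff ℝ 1 v) :
    energy Ω F v = ∫ x in Ω, F (gradOf v x) :=
  (isWeakGrad_gradOf hΩ hv).energy_eq hF hΩ.isOpen hΩ.volume_ne_top
    (memLp_of_continuous hΩ le_rfl hv.continuous 1)

end Inpainting

/-! ### Smooth truncations and their energy. -/

namespace Inpainting

section Truncation

variable {n M : ℕ} {Ω D : Set (Vec n)}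

/-- Smooth truncations at level `R`, with derivatives that are bounded by `κ`. -/
structure IsTruncation (κ R : ℝ) (Θ : Vec M → Vec M) : Prop where
  pos : 0 < R
  contDiff : ContDiff ℝ 1 Θ
  norm_le : ∀ y, ‖Θ y‖ ≤ ‖y‖
  norm_le' : ∀ y, ‖Θ y‖ ≤ 2 * R
  norm_fderiv_le : ∀ y, ‖fderiv ℝ Θ y‖ ≤ κ
  eq_self : ∀ y, ‖y‖ < R → Θ y = y
  eq_zero : ∀ y, 3 / 2 * R < ‖y‖ → Θ y = 0

/-- The rescalings `R • Θ (R⁻¹ • y)` of one compactly supported map all have its derivative bound,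
so `κ` does not depend on `R`. -/
lemma exists_isTruncation (M : ℕ) : ∃ κ : ℝ, 0 < κ ∧ ∀ R > 0, ∃ Θ : Vec M → Vec M, IsTruncation κ R Θ := by
  -- Equals `1` for `‖y‖ ≤ 1` and `0` for `‖y‖ ^ 2 ≥ 2`, in particular for `‖y‖ ≥ 3 / 2`.
  set s : Vec M → ℝ := fun y => Real.smoothTransition (2 - ‖y‖ ^ 2)
  set Θ : Vec M → Vec M := fun y => s y • y
  have hs : ContDiff ℝ 1 s :=
    Real.smoothTransition.contDiff.comp (contDiff_const.sub (contDiff_norm_sq ℝ))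
  have hΘ : ContDiff ℝ 1 Θ := hs.smul contDiff_id
  have hself : ∀ y, ‖y‖ ≤ 1 → Θ y = y := fun y hy => by
    have : s y = 1 := Real.smoothTransition.one_of_one_le (by nlinarith [norm_nonneg y])
    simp [Θ, this]
  have hzero : ∀ y, 3 / 2 ≤ ‖y‖ → Θ y = 0 := fun y hy => by
    have : s y = 0 := Real.smoothTransition.zero_of_nonpos (by nlinarith [norm_nonneg y])
    simp [Θ, this]
  have hle : ∀ y, ‖Θ y‖ ≤ ‖y‖ := fun y => by
    rw [norm_smul, Real.norm_of_nonneg (Real.smoothTransition.nonneg _)]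
    exact mul_le_of_le_one_left (norm_nonneg _) (Real.smoothTransition.le_one _)
  have hcs : HasCompactSupport Θ := by
    refine HasCompactSupport.intro (isCompact_closedBall 0 (3 / 2)) fun y hy => hzero y ?_
    rw [mem_closedBall_zero_iff, not_le] at hy
    exact hy.le
  obtain ⟨κ, hκ⟩ := (hcs.fderiv (𝕜 := ℝ)).exists_bound_of_continuous
    (hΘ.continuous_fderiv (by norm_num))
  refine ⟨max κ 1, by positivity, fun R hR => ⟨fun y => R • Θ (R⁻¹ • y), ?_⟩⟩
  have hn : ∀ y : Vec M, ‖R⁻¹ • y‖ = R⁻¹ * ‖y‖ := fun y => by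
    rw [norm_smul, Real.norm_of_nonneg (by positivity)]
  have hR' : ∀ y : Vec M, ‖R • Θ y‖ = R * ‖Θ y‖ := fun y => by
    rw [norm_smul, Real.norm_of_nonneg hR.le]
  refine ⟨hR, (hΘ.comp (contDiff_id.const_smul R⁻¹)).const_smul R, fun y => ?_, fun y => ?_,
    fun y => ?_, fun y hy => ?_, fun y hy => ?_⟩
  · rw [hR']
    calc R * ‖Θ (R⁻¹ • y)‖ ≤ R * (R⁻¹ * ‖y‖) := by gcongr; rw [← hn]; exact hle _
      _ = ‖y‖ := by field_simp
  · rw [hR', mul_comm]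
    gcongr
    by_cases h : ‖R⁻¹ • y‖ ≤ 3 / 2
    · exact (hle _).trans (h.trans (by norm_num))
    · rw [hzero _ (not_le.1 h).le]; simp
  · have h1 : HasFDerivAt (fun y : Vec M => R⁻¹ • y) (R⁻¹ • ContinuousLinearMap.id ℝ (Vec M)) y :=
      (hasFDerivAt_id y).const_smul R⁻¹
    have h2 := (((hΘ.differentiable (by norm_num) (R⁻¹ • y)).hasFDerivAt).comp y h1).const_smul R
    have h3 : fderiv ℝ (fun y => R • Θ (R⁻¹ • y)) y = fderiv ℝ Θ (R⁻¹ • y) := by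
      refine h2.fderiv.trans ?_
      ext z
      simp [hR.ne']
    rw [h3]
    exact (hκ _).trans (le_max_left _ _)
  · rw [hself _ (by rw [hn, inv_mul_le_iff₀ hR]; linarith), smul_smul, mul_inv_cancel₀ hR.ne',
      one_smul]
  · rw [hzero _ (by rw [hn, le_inv_mul_iff₀ hR]; linarith), smul_zero]

variable {κ R : ℝ} {Θ : Vec M → Vec M}

lemma IsTruncation.norm_sub_le (h : IsTruncation κ R Θ) (y z : Vec M) :
    ‖Θ y - Θ z‖ ≤ κ * ‖y - z‖ :=
  convex_univ.norm_image_sub_le_of_norm_fderiv_le (𝕜 := ℝ)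
    (fun x _ => h.contDiff.differentiable (by norm_num) x) (fun x _ => h.norm_fderiv_le x)
    (mem_univ z) (mem_univ y)

lemma IsTruncation.gradOf_eq_self (h : IsTruncation κ R Θ) {v : Vec n → Vec M}
    (hv : ContDiff ℝ 1 v) {x : Vec n} (hx : ‖v x‖ < R) : gradOf (Θ ∘ v) x = gradOf v x := by
  have : Θ ∘ v =ᶠ[𝓝 x] v := by
    filter_upwards [hv.continuous.norm.continuousAt.eventually_lt continuousAt_const hx] with y hy
    exact h.eq_self _ hy
  rw [gradOf_eq, this.fderiv_eq, gradOf_eq]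

lemma IsTruncation.gradOf_eq_zero (h : IsTruncation κ R Θ) {v : Vec n → Vec M}
    (hv : ContDiff ℝ 1 v) {x : Vec n} (hx : 3 / 2 * R < ‖v x‖) : gradOf (Θ ∘ v) x = 0 := by
  have : Θ ∘ v =ᶠ[𝓝 x] fun _ => 0 := by
    filter_upwards [continuousAt_const.eventually_lt hv.continuous.norm.continuousAt hx] with y hy
    exact h.eq_zero _ hy
  rw [gradOf_eq, this.fderiv_eq]
  simp

/-- The constant in the chain rule for tensors. -/
lemma exists_norm_gradOf_comp_le (n M : ℕ) : ∃ C : ℝ, 0 < C ∧ ∀ {κ R : ℝ} {Θ : Vec M → Vec M},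
    IsTruncation κ R Θ → ∀ {v : Vec n → Vec M}, ContDiff ℝ 1 v → ∀ x,
      ‖gradOf (Θ ∘ v) x‖ ≤ C * κ * ‖gradOf v x‖ := by
  obtain ⟨C, hC, hle⟩ := exists_norm_le_toTens n M
  refine ⟨(‖toTens n M‖ + 1) * C, by positivity, fun {κ R Θ} h v hv x => ?_⟩
  have hκ : 0 ≤ κ := (norm_nonneg _).trans (h.norm_fderiv_le 0)
  have hd := ((h.contDiff.differentiable (by norm_num) (v x)).hasFDerivAt).comp x
    (hv.differentiable (by norm_num) x).hasFDerivAt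
  rw [gradOf_eq, hd.fderiv]
  calc _ ≤ ‖toTens n M‖ * ‖(fderiv ℝ Θ (v x)).comp (fderiv ℝ v x)‖ := (toTens n M).le_opNorm _
    _ ≤ (‖toTens n M‖ + 1) * (κ * (C * ‖gradOf v x‖)) := by
      gcongr
      · linarith
      · refine (ContinuousLinearMap.opNorm_comp_le _ _).trans ?_
        gcongr
        · exact h.norm_fderiv_le _
        · exact hle _
    _ = _ := by ring

/-- The energy of a truncation. -/
lemma IsTruncation.integral_le (hΩ : IsBoundedLipschitzDomain Ω) {F : Tens n M → ℝ} {ν₁ ν₂ ν₃ : ℝ}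
    (hF : IsDensity F ν₁ ν₂ ν₃) (h : IsTruncation κ R Θ) {v : Vec n → Vec M} (hv : ContDiff ℝ 1 v)
    {C : ℝ} (hC : ∀ x, ‖gradOf (Θ ∘ v) x‖ ≤ C * κ * ‖gradOf v x‖) :
    ∫ x in Ω, F (gradOf (Θ ∘ v) x) ≤ (∫ x in Ω, F (gradOf v x)) +
      ν₁ * (C * κ) * ∫ x in Ω, {x | R ≤ ‖v x‖ ∧ ‖v x‖ < 2 * R}.indicator
        (fun x => ‖gradOf v x‖) x := by
  have hΘv : ContDiff ℝ 1 (Θ ∘ v) := h.contDiff.comp hv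
  have hi : ∀ w : Vec n → Vec M, ContDiff ℝ 1 w →
      Integrable (fun x => F (gradOf w x)) (volume.restrict Ω) := fun w hw =>
    memLp_one_iff_integrable.1 (memLp_of_continuous hΩ le_rfl
      (hF.continuous.comp (continuous_gradOf hw)) 1)
  have hmS : MeasurableSet {x | R ≤ ‖v x‖ ∧ ‖v x‖ < 2 * R} :=
    (measurableSet_le measurable_const hv.continuous.norm.measurable).inter
      (measurableSet_lt hv.continuous.norm.measurable measurable_const)
  have hiS : Integrable ({x | R ≤ ‖v x‖ ∧ ‖v x‖ < 2 * R}.indicator fun x => ‖gradOf v x‖)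
      (volume.restrict Ω) :=
    (memLp_one_iff_integrable.1 (memLp_of_continuous hΩ le_rfl
      (continuous_gradOf hv).norm 1)).indicator hmS
  rw [← integral_const_mul, ← integral_add (hi v hv) (hiS.const_mul _)]
  refine integral_mono (hi _ hΘv) ((hi v hv).add (hiS.const_mul _)) fun x => ?_
  have hν := hF.nu_one_nonneg
  -- Below the shell the truncation is the identity and above it is zero near the point, with `F 0 =
  -- 0`; only in the shell is the chain rule needed.
  by_cases hx : x ∈ {x | R ≤ ‖v x‖ ∧ ‖v x‖ < 2 * R}
  · have h1 := hF.le_norm (gradOf (Θ ∘ v) x)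
    have h2 := mul_le_mul_of_nonneg_left (hC x) hν
    have h3 := hF.nonneg (gradOf v x)
    simp only [indicator_of_mem hx]
    linarith
  · simp only [indicator_of_notMem hx, mul_zero, add_zero]
    by_cases h1 : ‖v x‖ < R
    · rw [h.gradOf_eq_self hv h1]
    · rw [h.gradOf_eq_zero hv, hF.map_zero]
      · exact hF.nonneg _
      · simp only [mem_ofPred_eq, not_and, not_lt] at hx h1
        linarith [hx h1, h.pos]

end Truncation

/-! ### The fidelity term. -/

section Fidelity

variable {n M : ℕ} {Ω D : Set (Vec n)} {f u : Vec n → Vec M} {lam ζ : ℝ}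

lemma integrable_rpow_norm_sub (hζ : 1 < ζ) {S : Set (Vec n)}
    (hf : MemLp f (ENNReal.ofReal ζ) (volume.restrict S))
    (hu : MemLp u (ENNReal.ofReal ζ) (volume.restrict S)) :
    Integrable (fun x => ‖u x - f x‖ ^ ζ) (volume.restrict S) := by
  have := (hu.sub hf).integrable_norm_rpow (by simp; linarith) ENNReal.ofReal_ne_top
  rwa [ENNReal.toReal_ofReal (by linarith)] at this

lemma tendsto_fidelity (hζ : 1 < ζ) (hf : MemLp f (ENNReal.ofReal ζ) (volume.restrict (Ω \ D)))
    {w : ℕ → Vec n → Vec M} (hw : ∀ k, AEStronglyMeasurable (w k) (volume.restrict (Ω \ D)))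
    {b : Vec n → ℝ} (hb : MemLp b (ENNReal.ofReal ζ) (volume.restrict (Ω \ D)))
    (hwb : ∀ k, ∀ᵐ x ∂volume.restrict (Ω \ D), ‖w k x‖ ≤ b x)
    (hlim : ∀ᵐ x ∂volume.restrict (Ω \ D), Tendsto (fun k => w k x) atTop (𝓝 (u x))) :
    Tendsto (fun k => fidelity Ω D f lam ζ (w k)) atTop (𝓝 (fidelity Ω D f lam ζ u)) := by
  refine Tendsto.const_mul _ (tendsto_integral_of_dominated_convergence
    (fun x => ‖b x + ‖f x‖‖ ^ ζ) (fun k => ?_) ?_ (fun k => ?_) ?_)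
  · exact (((hw k).sub hf.1).norm.aemeasurable.pow_const ζ).aestronglyMeasurable
  · have := (hb.add hf.norm).integrable_norm_rpow (by simp; linarith) ENNReal.ofReal_ne_top
    rwa [ENNReal.toReal_ofReal (by linarith)] at this
  · filter_upwards [hwb k] with x hx
    rw [Real.norm_of_nonneg (by positivity)]
    have h1 : ‖w k x - f x‖ ≤ b x + ‖f x‖ := (norm_sub_le _ _).trans (by gcongr)
    have h2 := h1.trans (le_abs_self _)
    rw [← Real.norm_eq_abs] at h2
    gcongr
  · filter_upwards [hlim] with x hx
    exact (hx.sub_const _).norm.rpow_const (Or.inr (by linarith))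

lemma fidelity_nonneg (hlam : 0 < lam) (hζ : 1 < ζ) (w : Vec n → Vec M) :
    0 ≤ fidelity Ω D f lam ζ w :=
  mul_nonneg (by have : 0 < ζ := by linarith
                 positivity) (integral_nonneg fun x => by positivity)

end Fidelity

end Inpainting

/-! ### Density of smooth functions in the class of `K`. -/

namespace Inpainting

variable {n M : ℕ} {Ω D : Set (Vec n)} {F : Tens n M → ℝ} {ν₁ ν₂ ν₃ : ℝ} {u : Vec n → Vec M}

lemma integrable_apply_gradOf (hΩ : IsBoundedLipschitzDomain Ω) (hF : IsDensity F ν₁ ν₂ ν₃)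
    {v : Vec n → Vec M} (hv : ContDiff ℝ 1 v) :
    Integrable (fun x => F (gradOf v x)) (volume.restrict Ω) :=
  memLp_one_iff_integrable.1 (memLp_of_continuous hΩ le_rfl
    (hF.continuous.comp (continuous_gradOf hv)) 1)

lemma integrable_norm_gradOf (hΩ : IsBoundedLipschitzDomain Ω) {v : Vec n → Vec M}
    (hv : ContDiff ℝ 1 v) : Integrable (fun x => ‖gradOf v x‖) (volume.restrict Ω) :=
  memLp_one_iff_integrable.1 (memLp_of_continuous hΩ le_rfl (continuous_gradOf hv).norm 1)

/-- The energy controls the `L¹`-norm of the gradient. -/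
lemma integral_norm_gradOf_le (hΩ : IsBoundedLipschitzDomain Ω) (hF : IsDensity F ν₁ ν₂ ν₃)
    (hν₂ : 0 < ν₂) {v : Vec n → Vec M} (hv : ContDiff ℝ 1 v) :
    ∫ x in Ω, ‖gradOf v x‖ ≤ ν₂⁻¹ * ((∫ x in Ω, F (gradOf v x)) + ν₃ * volume.real Ω) := by
  have : IsFiniteMeasure (volume.restrict Ω) := ⟨by simpa using hΩ.isBounded.measure_lt_top⟩
  calc ∫ x in Ω, ‖gradOf v x‖ ≤ ∫ x in Ω, ν₂⁻¹ * (F (gradOf v x) + ν₃) :=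
        integral_mono (integrable_norm_gradOf hΩ hv)
          (((integrable_apply_gradOf hΩ hF hv).add (integrable_const _)).const_mul _)
          fun x => hF.norm_le hν₂ _
    _ = _ := by
        rw [integral_const_mul, integral_add (integrable_apply_gradOf hΩ hF hv) (integrable_const _)]
        simp [mul_comm]

lemma MemBV.exists_contDiff_approx (hΩ : IsBoundedLipschitzDomain Ω) (hF : IsDensity F ν₁ ν₂ ν₃)
    (hu : MemBV Ω u) {δ : ℝ} (hδ : 0 < δ) :
    ∃ v : Vec n → Vec M, ContDiff ℝ 1 v ∧ ∫⁻ x in Ω, ‖v x - u x‖ₑ ≤ ENNReal.ofReal δ ∧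
      ∫ x in Ω, F (gradOf v x) ≤ energy Ω F u + δ := by
  obtain ⟨m, p, t, hrep, -, -⟩ := hu.exists_gradRep hΩ.isOpen hΩ.volume_ne_top
  obtain ⟨v, hv, h1, h2⟩ := hΩ.exists_contDiff_approx hF hu.1 hrep hδ
  have hv1 : ContDiff ℝ 1 v := hv.of_le (by simp)
  refine ⟨v, hv1, h1, ?_⟩
  rw [← ofReal_integral_eq_lintegral_ofReal (integrable_apply_gradOf hΩ hF hv1)
    (Eventually.of_forall fun x => hF.nonneg _),
    ← hrep.energy_eq hF hΩ.isOpen hΩ.volume_ne_top hu.1] at h2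
  exact (ENNReal.ofReal_le_ofReal_iff (by have := energy_nonneg (Ω := Ω) hF u
                                          positivity)).1 h2

lemma exists_subseq_tendsto_ae {μ : Measure (Vec n)} {w : ℕ → Vec n → Vec M}
    (hw : ∀ k, AEStronglyMeasurable (w k) μ) (hu : AEStronglyMeasurable u μ)
    (hlim : Tendsto (fun k => eLpNorm (w k - u) 1 μ) atTop (𝓝 0)) :
    ∃ φ : ℕ → ℕ, StrictMono φ ∧ ∀ᵐ x ∂μ, Tendsto (fun k => w (φ k) x) atTop (𝓝 (u x)) :=
  (tendstoInMeasure_of_tendsto_eLpNorm one_ne_zero hw hu hlim).exists_seq_tendsto_ae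

/-- Among many disjoint shells there is one with a small share of the gradient. -/
lemma exists_shell (hΩ : IsBoundedLipschitzDomain Ω) {v : Vec n → Vec M} (hv : ContDiff ℝ 1 v)
    (J : ℕ) {N : ℕ} (hN : 0 < N) : ∃ j ∈ Finset.Ico J (J + N),
      ∫ x in Ω, {x | (2 : ℝ) ^ j ≤ ‖v x‖ ∧ ‖v x‖ < 2 * 2 ^ j}.indicator
        (fun x => ‖gradOf v x‖) x ≤ (∫ x in Ω, ‖gradOf v x‖) / N := by
  have hmS : ∀ j : ℕ, MeasurableSet {x | (2 : ℝ) ^ j ≤ ‖v x‖ ∧ ‖v x‖ < 2 * 2 ^ j} := fun j =>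
    (measurableSet_le measurable_const hv.continuous.norm.measurable).inter
      (measurableSet_lt hv.continuous.norm.measurable measurable_const)
  have hi := integrable_norm_gradOf hΩ hv
  -- The `N` dyadic shells are disjoint, so their shares sum to at most the whole and one of them is
  -- at most the average.
  refine Finset.exists_le_of_sum_le (by simpa using hN) ?_
  rw [← integral_finsetSum _ fun j _ => hi.indicator (hmS j), Finset.sum_const, Nat.card_Ico,
    add_tsub_cancel_left, nsmul_eq_mul, mul_div_cancel₀ _ (by positivity)]
  refine integral_mono (integrable_finsetSum _ fun j _ => hi.indicator (hmS j)) hi fun x => ?_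
  by_cases h : ∃ j ∈ Finset.Ico J (J + N), x ∈ {x | (2 : ℝ) ^ j ≤ ‖v x‖ ∧ ‖v x‖ < 2 * 2 ^ j}
  · obtain ⟨j, hj, hx⟩ := h
    refine le_of_eq ?_
    simp only
    rw [Finset.sum_eq_single_of_mem j hj, indicator_of_mem hx]
    intro i _ hij
    refine indicator_of_notMem (fun hx' => hij ?_) _
    rw [← pow_succ'] at hx hx'
    have h1 := (pow_lt_pow_iff_right₀ (one_lt_two : (1 : ℝ) < 2)).1 (hx.1.trans_lt hx'.2)
    have h2 := (pow_lt_pow_iff_right₀ (one_lt_two : (1 : ℝ) < 2)).1 (hx'.1.trans_lt hx.2)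
    omega
  · push Not at h
    simp only
    rw [Finset.sum_eq_zero fun j hj => indicator_of_notMem (h j hj) _]
    positivity

/-- Smooth functions are dense in the class of the relaxed functional, with its values. -/
theorem exists_contDiff_functionalK_le (hΩ : IsBoundedLipschitzDomain Ω)
    (hF : IsDensity F ν₁ ν₂ ν₃) (hν₂ : 0 < ν₂) {f : Vec n → Vec M} {lam ζ : ℝ} (hζ : 1 < ζ)
    (hf : MemLp f (ENNReal.ofReal ζ) (volume.restrict (Ω \ D))) (hu : u ∈ classBV M Ω D ζ)
    {δ : ℝ} (hδ : 0 < δ) :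
    ∃ v : Vec n → Vec M, ContDiff ℝ 1 v ∧ ∫⁻ x in Ω, ‖v x - u x‖ₑ ≤ ENNReal.ofReal δ ∧
      functionalK Ω D f F lam ζ v ≤ functionalK Ω D f F lam ζ u + δ := by
  obtain ⟨κ, hκ, htr⟩ := exists_isTruncation M
  choose! Θ' hΘ' using htr
  set Θ : ℕ → Vec M → Vec M := fun j => Θ' (2 ^ j)
  have hΘ : ∀ j, IsTruncation κ (2 ^ j) (Θ j) := fun j => hΘ' _ (by positivity)
  obtain ⟨C, hC, hchain⟩ := exists_norm_gradOf_comp_le n M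
  have hD : volume.restrict (Ω \ D) ≤ volume.restrict Ω := Measure.restrict_mono sdiff_subset le_rfl
  have hfinD : IsFiniteMeasure (volume.restrict (Ω \ D)) :=
    ⟨by simpa using (measure_mono sdiff_subset).trans_lt hΩ.isBounded.measure_lt_top⟩
  have hum := hu.1.1.1
  have hΘu : ∀ x, Tendsto (fun j => Θ j (u x)) atTop (𝓝 (u x)) := fun x => by
    refine tendsto_const_nhds.congr' ?_
    filter_upwards [(tendsto_pow_atTop_atTop_of_one_lt (one_lt_two : (1 : ℝ) < 2)).eventually_gt_atTop
      ‖u x‖] with j hj using ((hΘ j).eq_self _ hj).symm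
  have hfid : Tendsto (fun j => fidelity Ω D f lam ζ (Θ j ∘ u)) atTop
      (𝓝 (fidelity Ω D f lam ζ u)) :=
    tendsto_fidelity hζ hf (fun j => ((hΘ j).contDiff.continuous.comp_aestronglyMeasurable
      hum).mono_measure hD) hu.2.norm (fun j => Eventually.of_forall fun x => (hΘ j).norm_le _)
      (Eventually.of_forall hΘu)
  have hL1 : Tendsto (fun j => ∫⁻ x in Ω, ‖Θ j (u x) - u x‖ₑ) atTop (𝓝 0) := by
    have := tendsto_lintegral_of_dominated_convergence' (μ := volume.restrict Ω)
      (F := fun j x => ‖Θ j (u x) - u x‖ₑ) (f := fun _ => 0) (fun x => 2 * ‖u x‖ₑ)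
      (fun j => (((hΘ j).contDiff.continuous.comp_aestronglyMeasurable hum).sub hum).enorm)
      (fun j => Eventually.of_forall fun x => ?_) ?_ (Eventually.of_forall fun x => ?_)
    · simpa using this
    · refine enorm_sub_le.trans ?_
      simp only [two_mul]
      gcongr
      rw [← ofReal_norm, ← ofReal_norm]
      exact ENNReal.ofReal_le_ofReal ((hΘ j).norm_le _)
    · rw [lintegral_const_mul' _ _ (by simp)]
      exact ENNReal.mul_ne_top (by simp) (memLp_one_iff_integrable.1 hu.1.1).2.ne
    · have := ((hΘu x).sub_const (u x)).enorm
      simpa using this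
  -- From level `J` on, truncating `u` itself changes fidelity and `L¹` norm only slightly.
  obtain ⟨J, hJ⟩ := ((hfid.eventually_lt_const (show fidelity Ω D f lam ζ u <
    fidelity Ω D f lam ζ u + δ / 4 by linarith)).and (hL1.eventually_lt_const
      (show (0 : ENNReal) < ENNReal.ofReal (δ / 2) by simpa using hδ))).exists_forall_of_atTop
  set A := energy Ω F u with hA
  have hA0 : 0 ≤ A := energy_nonneg hF u
  set T := ν₂⁻¹ * (A + 1 + ν₃ * volume.real Ω)
  have hν₁ := hF.nu_one_nonneg
  have hν₃ := hF.nu_three_nonneg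
  -- `T` bounds the gradient integrals of all approximants of energy at most `A + 1`, so the number
  -- of shells can be fixed before the approximant.
  obtain ⟨N, hN0, hN⟩ : ∃ N : ℕ, 0 < N ∧ ν₁ * (C * κ) * (T / N) ≤ δ / 4 := by
    obtain ⟨N, hN⟩ := exists_nat_gt (ν₁ * (C * κ) * T / (δ / 4))
    have hNpos : (0 : ℝ) < N := lt_of_le_of_lt (by positivity) hN
    refine ⟨N, by exact_mod_cast hNpos, ?_⟩
    rw [div_lt_iff₀ (by positivity)] at hN
    rw [mul_div_assoc', div_le_iff₀ hNpos]
    linarith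
  choose v hv hvu hvE using fun k : ℕ => hu.1.exists_contDiff_approx hΩ hF
    (show (0 : ℝ) < 1 / (k + 1) by positivity)
  have hlim : Tendsto (fun k => eLpNorm (v k - u) 1 (volume.restrict Ω)) atTop (𝓝 0) := by
    refine tendsto_of_tendsto_of_tendsto_of_le_of_le tendsto_const_nhds
      (h := fun k : ℕ => ENNReal.ofReal (1 / (k + 1))) ?_ (fun _ => zero_le) fun k => ?_
    · simpa using ENNReal.tendsto_ofReal (tendsto_one_div_add_atTop_nhds_zero_nat (𝕜 := ℝ))
    · rw [eLpNorm_one_eq_lintegral_enorm]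
      exact hvu k
  obtain ⟨φ, hφ, hae⟩ := exists_subseq_tendsto_ae
    (fun k => (hv k).continuous.aestronglyMeasurable) hum hlim
  have hfidk : ∀ j, ∀ᶠ k in atTop,
      -- At a fixed level the truncated approximants are bounded by `2 * 2 ^ j`, so the fidelity
      -- converges by domination although the approximants converge only in `L¹`.
      fidelity Ω D f lam ζ (Θ j ∘ v (φ k)) < fidelity Ω D f lam ζ (Θ j ∘ u) + δ / 4 := fun j => by
    have h1 : Tendsto (fun k => fidelity Ω D f lam ζ (Θ j ∘ v (φ k))) atTop
        (𝓝 (fidelity Ω D f lam ζ (Θ j ∘ u))) := by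
      refine tendsto_fidelity hζ hf (fun k => ((hΘ j).contDiff.continuous.comp
        (hv _).continuous).aestronglyMeasurable) (memLp_const (2 * (2 : ℝ) ^ j))
        (fun k => Eventually.of_forall fun x => (hΘ j).norm_le' _) ?_
      filter_upwards [ae_mono hD hae] with x hx
      exact ((hΘ j).contDiff.continuous.tendsto (u x)).comp hx
    exact h1.eventually_lt_const (by linarith)
  have hδk : Tendsto (fun k => 1 / ((φ k : ℝ) + 1)) atTop (𝓝 0) :=
    tendsto_one_div_add_atTop_nhds_zero_nat.comp hφ.tendsto_atTop
  -- The good level depends on the approximant, but it lies in a fixed finite range, so `k` can be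
  -- taken large for all these levels at once. The quarters of `δ` pay for the approximation of the
  -- energy, the shell, and the two fidelity errors.
  obtain ⟨k, hk1, hk2, hk3, hk4⟩ := (((Finset.Ico J (J + N)).eventually_all.2
    fun j _ => hfidk j).and ((hδk.eventually_lt_const (show (0 : ℝ) < δ / 4 by linarith)).and
      ((hδk.eventually_lt_const one_pos).and
        (hδk.eventually_lt_const (show (0 : ℝ) < δ / 2 / κ by positivity))))).exists
  obtain ⟨j, hj, hshell⟩ := exists_shell hΩ (hv (φ k)) J hN0
  have hΘv : ContDiff ℝ 1 (Θ j ∘ v (φ k)) := (hΘ j).contDiff.comp (hv _)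
  have hJj := hJ j (Finset.mem_Ico.1 hj).1
  refine ⟨Θ j ∘ v (φ k), hΘv, ?_, ?_⟩
  · calc ∫⁻ x in Ω, ‖(Θ j ∘ v (φ k)) x - u x‖ₑ
        ≤ ∫⁻ x in Ω, (ENNReal.ofReal κ * ‖v (φ k) x - u x‖ₑ + ‖Θ j (u x) - u x‖ₑ) := by
          refine lintegral_mono fun x => ?_
          rw [← sub_add_sub_cancel _ (Θ j (u x))]
          refine (enorm_add_le _ _).trans ?_
          gcongr
          rw [← ofReal_norm, ← ofReal_norm, ← ENNReal.ofReal_mul hκ.le]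
          exact ENNReal.ofReal_le_ofReal ((hΘ j).norm_sub_le _ _)
      _ = ENNReal.ofReal κ * (∫⁻ x in Ω, ‖v (φ k) x - u x‖ₑ) + ∫⁻ x in Ω, ‖Θ j (u x) - u x‖ₑ := by
          have hm : AEMeasurable (fun x => ‖v (φ k) x - u x‖ₑ) (volume.restrict Ω) :=
            ((hv _).continuous.aestronglyMeasurable.sub hum).enorm
          rw [lintegral_add_left' (hm.const_mul _), lintegral_const_mul' _ _ ENNReal.ofReal_ne_top]
      _ ≤ ENNReal.ofReal κ * ENNReal.ofReal (1 / (φ k + 1)) + ENNReal.ofReal (δ / 2) := by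
          gcongr
          · exact hvu _
          · exact hJj.2.le
      _ = ENNReal.ofReal (κ * (1 / (φ k + 1)) + δ / 2) := by
          rw [← ENNReal.ofReal_mul hκ.le, ← ENNReal.ofReal_add (by positivity) (by positivity)]
      _ ≤ _ := by
          refine ENNReal.ofReal_le_ofReal ?_
          rw [lt_div_iff₀ hκ] at hk4
          linarith
  · have h1 := (hΘ j).integral_le hΩ hF (hv (φ k)) (hchain (hΘ j) (hv (φ k)))
    have h2 := hvE (φ k)
    have h3 := integral_norm_gradOf_le hΩ hF hν₂ (hv (φ k))
    have h4 : ∫ x in Ω, ‖gradOf (v (φ k)) x‖ ≤ T := by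
      refine h3.trans ?_
      simp only [T]
      gcongr
      linarith
    have h5 : ν₁ * (C * κ) * (∫ x in Ω, {x | (2 : ℝ) ^ j ≤ ‖v (φ k) x‖ ∧
        ‖v (φ k) x‖ < 2 * 2 ^ j}.indicator (fun x => ‖gradOf (v (φ k)) x‖) x) ≤ δ / 4 := by
      refine le_trans ?_ hN
      gcongr
      refine hshell.trans ?_
      gcongr
    have h6 := hk1 j hj
    rw [functionalK_eq, functionalK_eq, energy_of_contDiff hΩ hF hΘv]
    linarith [hJj.1]

end Inpainting

/-! ### Compactness: translation estimates and Rellich's theorem. -/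

namespace Inpainting

variable {n M : ℕ} {Ω : Set (Vec n)}

lemma setLIntegral_comp_add_le (hΩ : MeasurableSet Ω) {A : Set (Vec n)} (hA : MeasurableSet A)
    {h : Vec n} (hAΩ : ∀ x ∈ A, x + h ∈ Ω) (g : Vec n → ENNReal) :
    ∫⁻ x in A, g (x + h) ≤ ∫⁻ x in Ω, g x := by
  rw [← lintegral_indicator hA, ← lintegral_indicator hΩ,
    ← lintegral_add_right_eq_self (Ω.indicator g) h]
  refine lintegral_mono fun x => ?_
  by_cases hx : x ∈ A
  · rw [indicator_of_mem hx, indicator_of_mem (hAΩ x hx)]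
  · rw [indicator_of_notMem hx]
    exact zero_le

/-- Translations of a differentiable function along segments that stay in `Ω`. -/
lemma setLIntegral_translate_sub_le (hΩ : MeasurableSet Ω) {v : Vec n → Vec M} (hv : ContDiff ℝ 1 v)
    {A : Set (Vec n)} (hA : MeasurableSet A) {h : Vec n}
    (hseg : ∀ x ∈ A, ∀ s : ℝ, 0 < s → s ≤ 1 → x + s • h ∈ Ω) :
    ∫⁻ x in A, ‖v (x + h) - v x‖ₑ ≤ ‖h‖ₑ * ∫⁻ x in Ω, ‖fderiv ℝ v x‖ₑ := by
  have hc : Continuous (fderiv ℝ v) := hv.continuous_fderiv (by norm_num)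
  have hpt : ∀ x, ‖v (x + h) - v x‖ₑ ≤
      ∫⁻ s in Ioc (0 : ℝ) 1, ‖h‖ₑ * ‖fderiv ℝ v (x + s • h)‖ₑ := fun x => by
    -- The difference is the integral of the derivative along the segment; exchanging integrals then
    -- translates `A` into `Ω` for each `s`.
    have hd : ∀ s ∈ uIcc (0 : ℝ) 1, HasDerivAt (fun s : ℝ => v (x + s • h))
        (fderiv ℝ v (x + s • h) h) s := fun s _ => by
      have h1 : HasDerivAt (fun s : ℝ => x + s • h) h s := by
        simpa using ((hasDerivAt_id s).smul_const h).const_add x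
      exact (hv.differentiable (by norm_num) (x + s • h)).hasFDerivAt.comp_hasDerivAt s h1
    have hi : Continuous fun s : ℝ => fderiv ℝ v (x + s • h) h :=
      (hc.comp (by fun_prop)).clm_apply continuous_const
    have := intervalIntegral.integral_eq_sub_of_hasDerivAt hd (hi.intervalIntegrable _ _)
    rw [one_smul, zero_smul, add_zero, intervalIntegral.integral_of_le zero_le_one] at this
    rw [← this]
    refine (enorm_integral_le_lintegral_enorm _).trans (lintegral_mono fun s => ?_)
    rw [mul_comm]
    exact (fderiv ℝ v (x + s • h)).le_opENorm h
  have hm : Measurable fun y : Vec n × ℝ => ‖h‖ₑ * ‖fderiv ℝ v (y.1 + y.2 • h)‖ₑ := by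
    have : Continuous fun y : Vec n × ℝ => fderiv ℝ v (y.1 + y.2 • h) := hc.comp (by fun_prop)
    exact this.measurable.enorm.const_mul _
  calc ∫⁻ x in A, ‖v (x + h) - v x‖ₑ
      ≤ ∫⁻ x in A, ∫⁻ s in Ioc (0 : ℝ) 1, ‖h‖ₑ * ‖fderiv ℝ v (x + s • h)‖ₑ :=
        lintegral_mono fun x => hpt x
    _ = ∫⁻ s in Ioc (0 : ℝ) 1, ∫⁻ x in A, ‖h‖ₑ * ‖fderiv ℝ v (x + s • h)‖ₑ :=
        lintegral_lintegral_swap hm.aemeasurable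
    _ ≤ ∫⁻ _s in Ioc (0 : ℝ) 1, ‖h‖ₑ * ∫⁻ x in Ω, ‖fderiv ℝ v x‖ₑ := by
        refine setLIntegral_mono' measurableSet_Ioc fun s hs => ?_
        rw [lintegral_const_mul' _ _ enorm_ne_top]
        exact mul_le_mul' le_rfl (setLIntegral_comp_add_le hΩ hA
          (fun x hx => hseg x hx s hs.1 hs.2) fun x => ‖fderiv ℝ v x‖ₑ)
    _ = _ := by simp

namespace IsMollifier

variable {ε : ℝ} {η : Vec n → ℝ} {g : Vec n → Vec M}

lemma norm_mollify_le {B : ℝ} (hB : ∀ z, ‖η z‖ ≤ B) (hg : Integrable g) (x : Vec n) :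
    ‖mollify η g x‖ ≤ B * ∫ z, ‖g z‖ := by
  rw [mollify_eq', ← integral_const_mul]
  refine norm_integral_le_of_norm_le (hg.norm.const_mul B) (Eventually.of_forall fun z => ?_)
  rw [norm_smul]
  gcongr
  exact hB _

lemma norm_mollify_sub_le (h : IsMollifier ε η) {L : ℝ} (hL : ∀ y z, ‖η y - η z‖ ≤ L * ‖y - z‖)
    (hg : Integrable g) (x y : Vec n) :
    ‖mollify η g x - mollify η g y‖ ≤ (L * ‖x - y‖) * ∫ z, ‖g z‖ := by
  have hi : ∀ x, Integrable fun z => η (x - z) • g z := fun x => by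
    have := (h.integrable_smul hg x).comp_sub_left x
    simpa using this
  rw [mollify_eq', mollify_eq', ← integral_sub (hi x) (hi y), ← integral_const_mul]
  refine norm_integral_le_of_norm_le (hg.norm.const_mul _) (Eventually.of_forall fun z => ?_)
  rw [← sub_smul, norm_smul]
  gcongr
  simpa using hL (x - z) (y - z)

lemma exists_lipschitz (h : IsMollifier ε η) : ∃ L : ℝ, ∀ y z, ‖η y - η z‖ ≤ L * ‖y - z‖ := by
  obtain ⟨L, hL⟩ := (h.hasCompactSupport.fderiv (𝕜 := ℝ)).exists_bound_of_continuous
    (h.contDiff.continuous_fderiv (by norm_num))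
  exact ⟨L, fun y z => convex_univ.norm_image_sub_le_of_norm_fderiv_le (𝕜 := ℝ)
    (fun x _ => h.contDiff.differentiable (by norm_num) x) (fun x _ => hL x) (mem_univ z) (mem_univ y)⟩

end IsMollifier

namespace InwardPartition

variable {ι : Type} [Fintype ι] (Ψ : InwardPartition Ω ι) {ε τ : ℝ} {η : Vec n → ℝ}

lemma exists_bound : ∃ B : ℝ, ∀ i x, ‖Ψ.χ i x‖ ≤ B := by
  choose B hB using fun i =>
    (Ψ.hasCompactSupport i).exists_bound_of_continuous (Ψ.contDiff i).continuous
  have hB0 : ∀ i, 0 ≤ B i := fun i => (norm_nonneg _).trans (hB i 0)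
  exact ⟨∑ i, B i, fun i x => (hB i x).trans
    (Finset.single_le_sum (fun j _ => hB0 j) (Finset.mem_univ i))⟩

/-- Regularization maps bounded sets of `L¹` to bounded sets of Lipschitz functions. -/
lemma exists_regularize_bounds (h : IsMollifier ε η) : ∃ B L : ℝ, 0 ≤ B ∧ 0 ≤ L ∧
    ∀ g : Vec n → Vec M, Integrable g → (∀ x, ‖Ψ.regularize η τ g x‖ ≤ B * ∫ z, ‖g z‖) ∧
      ∀ x y, ‖Ψ.regularize η τ g x - Ψ.regularize η τ g y‖ ≤ (L * ∫ z, ‖g z‖) * ‖x - y‖ := by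
  obtain ⟨b, hb⟩ := h.exists_bound
  obtain ⟨l, hl⟩ := h.exists_lipschitz
  obtain ⟨B, hB⟩ := Ψ.exists_bound
  obtain ⟨L, hL0, -, hL⟩ := Ψ.exists_lipschitz
  have hb0 : 0 ≤ b := (norm_nonneg _).trans (hb 0)
  refine ⟨∑ _i : ι, max B 0 * b, ∑ _i : ι, (max B 0 * max l 0 + L * b),
    Finset.sum_nonneg fun i _ => by positivity, Finset.sum_nonneg fun i _ => by positivity,
    fun g hg => ⟨fun x => ?_, fun x y => ?_⟩⟩
  · rw [Finset.sum_mul]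
    refine (norm_sum_le _ _).trans (Finset.sum_le_sum fun i _ => ?_)
    rw [norm_smul, mul_assoc]
    gcongr
    · exact (hB i x).trans (le_max_left _ _)
    · exact IsMollifier.norm_mollify_le hb hg _
  · rw [regularize, regularize, ← Finset.sum_sub_distrib, Finset.sum_mul, Finset.sum_mul]
    refine (norm_sum_le _ _).trans (Finset.sum_le_sum fun i _ => ?_)
    set S := mollify η g (x + τ • Ψ.e i)
    set S' := mollify η g (y + τ • Ψ.e i)
    have hI : 0 ≤ ∫ z, ‖g z‖ := integral_nonneg fun z => norm_nonneg _
    have h1 : ‖S - S'‖ ≤ (max l 0 * ‖x - y‖) * ∫ z, ‖g z‖ := by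
      have := h.norm_mollify_sub_le (L := max l 0) (fun y z => (hl y z).trans (by
        gcongr; exact le_max_left _ _)) hg (x + τ • Ψ.e i) (y + τ • Ψ.e i)
      simpa using this
    have h2 : ‖S'‖ ≤ b * ∫ z, ‖g z‖ := IsMollifier.norm_mollify_le hb hg _
    calc ‖Ψ.χ i x • S - Ψ.χ i y • S'‖ = ‖Ψ.χ i x • (S - S') + (Ψ.χ i x - Ψ.χ i y) • S'‖ := by
          congr 1; rw [smul_sub, sub_smul]; abel
      _ ≤ ‖Ψ.χ i x‖ * ‖S - S'‖ + ‖Ψ.χ i x - Ψ.χ i y‖ * ‖S'‖ := by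
          rw [← norm_smul, ← norm_smul]; exact norm_add_le _ _
      _ ≤ max B 0 * ((max l 0 * ‖x - y‖) * ∫ z, ‖g z‖) + (L * ‖x - y‖) * (b * ∫ z, ‖g z‖) := by
          gcongr
          · exact (hB i x).trans (le_max_left _ _)
          · exact hL i x y
      _ = _ := by ring

/-- For differentiable functions, the error of the regularization is bounded by the gradient. -/
lemma setLIntegral_regularize_sub_le (hΩ : IsOpen Ω) (hτ : 0 < τ) (hτ₀ : τ < Ψ.τ₀)
    (h : IsMollifier (Ψ.c * τ) η) {v : Vec n → Vec M} (hv : ContDiff ℝ 1 v)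
    (hvi : Integrable (Ω.indicator v)) :
    ∫⁻ x in Ω, ‖Ψ.regularize η τ (Ω.indicator v) x - v x‖ₑ ≤
      Fintype.card ι * (ENNReal.ofReal (2 * τ) * ∫⁻ x in Ω, ‖fderiv ℝ v x‖ₑ) := by
  have hm := hΩ.measurableSet
  have hgm : StronglyMeasurable (Ω.indicator v) := hv.continuous.stronglyMeasurable.indicator hm
  have hstep : ∀ i, ∫⁻ x, Ω.indicator (fun x => ENNReal.ofReal (Ψ.χ i x)) x *
      ‖mollify η (Ω.indicator v) (x + τ • Ψ.e i) - Ω.indicator v x‖ₑ ≤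
        ENNReal.ofReal (2 * τ) * ∫⁻ x in Ω, ‖fderiv ℝ v x‖ₑ := fun i => by
    have hχ := (Ψ.contDiff i).continuous.measurable
    refine h.lintegral_mollify_sub_le hvi hgm (hχ.ennreal_ofReal.indicator hm) _ fun z hz => ?_
    set A := Ω ∩ {x | Ψ.χ i x ≠ 0}
    have hA : MeasurableSet A := hm.inter (hχ (measurableSet_singleton 0)).compl
    have hseg : ∀ x ∈ A, ∀ s : ℝ, 0 < s → s ≤ 1 → x + s • (τ • Ψ.e i - z) ∈ Ω := by
      intro x hx s hs hs1
      -- The cone condition is invariant under scaling, so the whole segment stays in `Ω` and not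
      -- only its end.
      have := Ψ.inward i x hx.1 hx.2 (s * τ) (by positivity)
        ((mul_le_of_le_one_left hτ.le hs1).trans_lt hτ₀) (-(s • z)) (by
          rw [norm_neg, norm_smul, Real.norm_of_nonneg hs.le]
          calc s * ‖z‖ ≤ s * (Ψ.c * τ) := by gcongr
            _ = Ψ.c * (s * τ) := by ring)
      convert this using 2
      rw [smul_sub, smul_smul, sub_eq_add_neg]
    calc ∫⁻ x, Ω.indicator (fun x => ENNReal.ofReal (Ψ.χ i x)) x *
          ‖Ω.indicator v (x + τ • Ψ.e i - z) - Ω.indicator v x‖ₑ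
        ≤ ∫⁻ x in A, ‖v (x + (τ • Ψ.e i - z)) - v x‖ₑ := by
          rw [← lintegral_indicator hA]
          refine lintegral_mono fun x => ?_
          by_cases hx : x ∈ A
          · have hx1 := hseg x hx 1 one_pos le_rfl
            rw [one_smul] at hx1
            rw [indicator_of_mem hx.1, indicator_of_mem hx.1, indicator_of_mem hx, add_sub_assoc,
              indicator_of_mem hx1]
            exact mul_le_of_le_one_left' (ENNReal.ofReal_le_one.2 (le_one hx.1 i))
          · rw [indicator_of_notMem hx]
            by_cases hxΩ : x ∈ Ω
            · have : Ψ.χ i x = 0 := by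
                by_contra h0
                exact hx ⟨hxΩ, h0⟩
              simp [hxΩ, this]
            · simp [hxΩ]
      _ ≤ ‖τ • Ψ.e i - z‖ₑ * ∫⁻ x in Ω, ‖fderiv ℝ v x‖ₑ :=
          setLIntegral_translate_sub_le hm hv hA hseg
      _ ≤ _ := by
          gcongr
          rw [← ofReal_norm]
          refine ENNReal.ofReal_le_ofReal ((norm_sub_le _ _).trans ?_)
          rw [norm_smul, Real.norm_of_nonneg hτ.le]
          have h1 := mul_le_mul_of_nonneg_left (Ψ.norm_e i) hτ.le
          have h2 := mul_le_mul_of_nonneg_right Ψ.c_le hτ.le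
          linarith
  have hmm : ∀ i, Measurable fun x => Ω.indicator (fun x => ENNReal.ofReal (Ψ.χ i x)) x *
      ‖mollify η (Ω.indicator v) (x + τ • Ψ.e i) - Ω.indicator v x‖ₑ := fun i =>
    ((Ψ.contDiff i).continuous.measurable.ennreal_ofReal.indicator hm).mul
      ((measurable_mollify h hvi _).sub hgm.measurable).enorm
  calc ∫⁻ x in Ω, ‖Ψ.regularize η τ (Ω.indicator v) x - v x‖ₑ
      ≤ ∫⁻ x in Ω, ∑ i, Ω.indicator (fun x => ENNReal.ofReal (Ψ.χ i x)) x *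
          ‖mollify η (Ω.indicator v) (x + τ • Ψ.e i) - Ω.indicator v x‖ₑ := by
        refine setLIntegral_mono' hm fun x hx => ?_
        have := enorm_regularize_sub_le (Ψ := Ψ) (η := η) (τ := τ) (g := Ω.indicator v) hx
        simp_rw [indicator_of_mem hx] at this ⊢
        exact this
    _ ≤ ∫⁻ x, ∑ i, Ω.indicator (fun x => ENNReal.ofReal (Ψ.χ i x)) x *
          ‖mollify η (Ω.indicator v) (x + τ • Ψ.e i) - Ω.indicator v x‖ₑ :=
        setLIntegral_le_lintegral _ _
    _ = ∑ i, ∫⁻ x, Ω.indicator (fun x => ENNReal.ofReal (Ψ.χ i x)) x *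
          ‖mollify η (Ω.indicator v) (x + τ • Ψ.e i) - Ω.indicator v x‖ₑ :=
        lintegral_finsetSum _ fun i _ => hmm i
    _ ≤ ∑ _i : ι, ENNReal.ofReal (2 * τ) * ∫⁻ x in Ω, ‖fderiv ℝ v x‖ₑ :=
        Finset.sum_le_sum fun i _ => hstep i
    _ = _ := by rw [Finset.sum_const, nsmul_eq_mul, Finset.card_univ]

end InwardPartition

/-- Rellich's theorem: sequences of differentiable functions that are bounded in `W^{1,1}(Ω)` have
subsequences that converge in `L¹(Ω)`. -/
theorem exists_subseq_tendsto_eLpNorm (hΩ : IsBoundedLipschitzDomain Ω) {v : ℕ → Vec n → Vec M}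
    (hv : ∀ k, ContDiff ℝ 1 (v k)) {C : ℝ} (hC : ∀ k, ∫ x in Ω, ‖v k x‖ ≤ C)
    (hC' : ∀ k, ∫ x in Ω, ‖gradOf (v k) x‖ ≤ C) :
    ∃ u : Vec n → Vec M, MemLp u 1 (volume.restrict Ω) ∧ ∃ φ : ℕ → ℕ, StrictMono φ ∧
      Tendsto (fun k => eLpNorm (v (φ k) - u) 1 (volume.restrict Ω)) atTop (𝓝 0) := by
  have hm := hΩ.isOpen.measurableSet
  have hmem : ∀ k, MemLp (v k) 1 (volume.restrict Ω) := fun k =>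
    memLp_of_continuous hΩ le_rfl (hv k).continuous 1
  have hint : ∀ k, Integrable (Ω.indicator (v k)) := fun k =>
    (integrable_indicator_iff hm).2 (memLp_one_iff_integrable.1 (hmem k))
  have hnorm : ∀ k, ∫ z, ‖Ω.indicator (v k) z‖ ≤ C := fun k => by
    simp_rw [norm_indicator_eq_indicator_norm]
    rw [integral_indicator hm]
    exact hC k
  have hC0 : 0 ≤ C := (integral_nonneg fun x => norm_nonneg _).trans (hC 0)
  obtain ⟨E, hE, hle⟩ := exists_norm_le_toTens n M
  have hgrad : ∀ k, ∫⁻ x in Ω, ‖fderiv ℝ (v k) x‖ₑ ≤ ENNReal.ofReal (E * C) := fun k => by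
    calc ∫⁻ x in Ω, ‖fderiv ℝ (v k) x‖ₑ ≤ ∫⁻ x in Ω, ENNReal.ofReal E * ENNReal.ofReal ‖gradOf (v k) x‖ := by
          refine lintegral_mono fun x => ?_
          rw [← ofReal_norm, ← ENNReal.ofReal_mul hE.le]
          exact ENNReal.ofReal_le_ofReal (hle _)
      _ = ENNReal.ofReal E * ENNReal.ofReal (∫ x in Ω, ‖gradOf (v k) x‖) := by
          rw [lintegral_const_mul' _ _ ENNReal.ofReal_ne_top, ofReal_integral_eq_lintegral_ofReal
            (integrable_norm_gradOf hΩ (hv k)) (Eventually.of_forall fun x => norm_nonneg _)]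
      _ ≤ _ := by
          rw [← ENNReal.ofReal_mul hE.le]
          gcongr
          exact hC' k
  obtain ⟨ι, _, ⟨Ψ⟩⟩ := hΩ.exists_inwardPartition
  set N : ℝ := ((Fintype.card ι : ℕ) : ℝ) with hN
  set V : ℕ → Lp (Vec M) 1 (volume.restrict Ω) := fun k => (hmem k).toLp
  -- Convergence along an ultrafilter finer than `atTop` gives a cluster point, hence a convergent
  -- subsequence. Being Cauchy can be checked for each `ε` with its own regularization.
  set 𝒰 : Ultrafilter ℕ := Ultrafilter.of atTop
  have hcauchy : Cauchy (map V (𝒰 : Filter ℕ)) := by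
    refine Metric.cauchy_iff.2 ⟨inferInstance, fun ε hε => ?_⟩
    set b : ℝ := volume.real Ω
    have hb : 0 ≤ b := measureReal_nonneg
    -- Chosen so that the regularization error is at most `ε / 8` for every member of the sequence.
    obtain ⟨τ, hτ, hτ₀, hτε⟩ : ∃ τ > 0, τ < Ψ.τ₀ ∧ N * (2 * τ * (E * C)) ≤ ε / 8 := by
      have h0 := Ψ.τ₀_pos
      refine ⟨min (Ψ.τ₀ / 2) (ε / (16 * (N * E * C + 1))), by positivity,
        (min_le_left _ _).trans_lt (by linarith), ?_⟩
      calc N * (2 * min (Ψ.τ₀ / 2) (ε / (16 * (N * E * C + 1))) * (E * C))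
          ≤ N * (2 * (ε / (16 * (N * E * C + 1))) * (E * C)) := by
            gcongr; exact min_le_right _ _
        _ = N * E * C / (N * E * C + 1) * (ε / 8) := by field_simp; ring
        _ ≤ 1 * (ε / 8) := by
            gcongr
            rw [div_le_one (by positivity)]
            linarith
        _ = ε / 8 := one_mul _
    obtain ⟨η, hη⟩ := exists_isMollifier (n := n) (mul_pos Ψ.c_pos hτ)
    obtain ⟨B, L, hB0, hL0, hBL⟩ := Ψ.exists_regularize_bounds (M := M) (τ := τ) hη
    set w : ℕ → Vec n → Vec M := fun k => Ψ.regularize η τ (Ω.indicator (v k))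
    have hw : ∀ k, Continuous (w k) := fun k =>
      (InwardPartition.contDiff_regularize hη (hint k)).continuous
    have hwB : ∀ k x, ‖w k x‖ ≤ B * C := fun k x =>
      ((hBL _ (hint k)).1 x).trans (by gcongr; exact hnorm k)
    have hwL : ∀ k x y, ‖w k x - w k y‖ ≤ (L * C) * ‖x - y‖ := fun k x y =>
      ((hBL _ (hint k)).2 x y).trans (by gcongr; exact hnorm k)
    have happ : ∀ k, ∫⁻ x in Ω, ‖w k x - v k x‖ₑ ≤ ENNReal.ofReal (ε / 8) := fun k => by
      refine (Ψ.setLIntegral_regularize_sub_le hΩ.isOpen hτ hτ₀ hη (hv k) (hint k)).trans ?_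
      calc (Fintype.card ι : ENNReal) * (ENNReal.ofReal (2 * τ) * ∫⁻ x in Ω, ‖fderiv ℝ (v k) x‖ₑ)
          ≤ Fintype.card ι * (ENNReal.ofReal (2 * τ) * ENNReal.ofReal (E * C)) := by
            gcongr; exact hgrad k
        _ = ENNReal.ofReal (N * (2 * τ * (E * C))) := by
            rw [← ENNReal.ofReal_mul (by positivity), ← ENNReal.ofReal_natCast, ← hN,
              ← ENNReal.ofReal_mul (by positivity)]
        _ ≤ _ := ENNReal.ofReal_le_ofReal hτε
    have : CompactSpace (closure Ω) := isCompact_iff_compactSpace.1 hΩ.isBounded.isCompact_closure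
    -- At fixed `τ` the regularized functions are uniformly bounded and uniformly Lipschitz, so
    -- Arzelà–Ascoli gives a uniform limit along the ultrafilter.
    set W : ℕ → BoundedContinuousFunction (closure Ω) (Vec M) := fun k =>
      BoundedContinuousFunction.mkOfCompact ⟨fun x => w k x, (hw k).comp continuous_subtype_val⟩
    have hWcomp : IsCompact (closure (range W)) := by
      refine BoundedContinuousFunction.arzela_ascoli (Metric.closedBall 0 (B * C))
        (isCompact_closedBall _ _) _ ?_ ?_
      · rintro _ x ⟨k, rfl⟩
        rw [mem_closedBall_zero_iff]
        exact hwB k x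
      · refine Metric.equicontinuous_of_continuity_modulus (fun r => (L * C) * r) ?_ _ ?_
        · have : Tendsto (fun r : ℝ => (L * C) * r) (𝓝 0) (𝓝 ((L * C) * 0)) :=
            tendsto_id.const_mul _
          simpa using this
        · rintro x y ⟨_, k, rfl⟩
          rw [dist_eq_norm, Subtype.dist_eq, dist_eq_norm]
          exact hwL k x y
    obtain ⟨w₀, -, hw₀⟩ := hWcomp.ultrafilter_le_nhds (𝒰.map W) (le_principal_iff.2
      (mem_map.2 (Eventually.of_forall fun k => subset_closure (mem_range_self k))))
    have hball : ∀ᶠ k in (𝒰 : Filter ℕ), dist (W k) w₀ < ε / (8 * (b + 1)) :=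
      (tendsto_def.1 (show Tendsto W 𝒰 (𝓝 w₀) from hw₀)) _ (Metric.ball_mem_nhds _ (by positivity))
    refine ⟨_, image_mem_map hball, ?_⟩
    rintro _ ⟨k, hk, rfl⟩ _ ⟨l, hl, rfl⟩
    have hkl : ∀ x ∈ Ω, ‖w k x - w l x‖ ≤ ε / (4 * (b + 1)) := fun x hx => by
      have h1 := BoundedContinuousFunction.dist_coe_le_dist (f := W k) (g := W l)
        ⟨x, subset_closure hx⟩
      have h2 := dist_triangle_right (W k) (W l) w₀
      rw [dist_eq_norm] at h1
      have h3 : ε / (4 * (b + 1)) = ε / (8 * (b + 1)) + ε / (8 * (b + 1)) := by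
        field_simp; ring
      rw [h3]
      exact (h1.trans h2).trans (add_le_add hk.le hl.le)
    have hw1 : ∀ k, Measurable fun x => ‖w k x - v k x‖ₑ := fun k =>
      ((hw k).sub (hv k).continuous).measurable.enorm
    have hlt : ∫⁻ x in Ω, ‖v k x - v l x‖ₑ ≤ ENNReal.ofReal (ε / 2) := by
      calc ∫⁻ x in Ω, ‖v k x - v l x‖ₑ
          ≤ ∫⁻ x in Ω, (‖w k x - v k x‖ₑ + (‖w l x - v l x‖ₑ + ENNReal.ofReal (ε / (4 * (b + 1))))) := by
            refine setLIntegral_mono' hm fun x hx => ?_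
            have e : v k x - v l x = (w k x - w l x) - (w k x - v k x) + (w l x - v l x) := by abel
            rw [e]
            refine (enorm_add_le _ _).trans ((add_le_add enorm_sub_le le_rfl).trans ?_)
            have : ‖w k x - w l x‖ₑ ≤ ENNReal.ofReal (ε / (4 * (b + 1))) := by
              rw [← ofReal_norm]; exact ENNReal.ofReal_le_ofReal (hkl x hx)
            calc _ ≤ ENNReal.ofReal (ε / (4 * (b + 1))) + ‖w k x - v k x‖ₑ + ‖w l x - v l x‖ₑ := by
                  gcongr
              _ = _ := by ring
        _ = (∫⁻ x in Ω, ‖w k x - v k x‖ₑ) + ((∫⁻ x in Ω, ‖w l x - v l x‖ₑ) +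
              ENNReal.ofReal (ε / (4 * (b + 1))) * volume Ω) := by
            rw [lintegral_add_left (hw1 k), lintegral_add_left (hw1 l), setLIntegral_const]
        _ ≤ ENNReal.ofReal (ε / 8) + (ENNReal.ofReal (ε / 8) + ENNReal.ofReal (ε / 4)) := by
            gcongr
            · exact happ k
            · exact happ l
            · rw [← ENNReal.ofReal_toReal hΩ.volume_ne_top, ← ENNReal.ofReal_mul (by positivity)]
              refine ENNReal.ofReal_le_ofReal ?_
              change ε / (4 * (b + 1)) * b ≤ ε / 4
              rw [div_mul_eq_mul_div, div_le_div_iff₀ (by positivity) (by positivity)]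
              nlinarith
        _ = ENNReal.ofReal (ε / 2) := by
            rw [← ENNReal.ofReal_add (by positivity) (by positivity),
              ← ENNReal.ofReal_add (by positivity) (by positivity)]
            congr 1
            ring
    rw [Lp.dist_def]
    have hcongr : eLpNorm (⇑(V k) - ⇑(V l)) 1 (volume.restrict Ω) =
        ∫⁻ x in Ω, ‖v k x - v l x‖ₑ := by
      rw [eLpNorm_one_eq_lintegral_enorm]
      refine lintegral_congr_ae ?_
      filter_upwards [(hmem k).coeFn_toLp, (hmem l).coeFn_toLp] with x h1 h2
      simp only [V, Pi.sub_apply, h1, h2]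
    rw [hcongr]
    refine (ENNReal.toReal_mono ENNReal.ofReal_ne_top hlt).trans_lt ?_
    rw [ENNReal.toReal_ofReal (by positivity)]
    linarith
  obtain ⟨U, hU⟩ := CompleteSpace.complete hcauchy
  have hclust : MapClusterPt U atTop V :=
    (ClusterPt.of_le_nhds hU).mono (map_mono (Ultrafilter.of_le _))
  obtain ⟨φ, hφ, hlim⟩ := hclust.tendsto_subseq
  refine ⟨U, Lp.memLp U, φ, hφ, ?_⟩
  have := (Lp.tendsto_Lp_iff_tendsto_eLpNorm' _ _).1 hlim
  refine this.congr fun k => eLpNorm_congr_ae ?_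
  filter_upwards [(hmem (φ k)).coeFn_toLp] with x hx
  simp only [Function.comp_apply, Pi.sub_apply, V, hx]

end Inpainting

/-! ### Poincaré's inequality on connected domains. -/

namespace Inpainting

variable {n M : ℕ} {Ω : Set (Vec n)}

/-- `u` agrees almost everywhere with `c` near `x`. -/
def LocallyAE (u : Vec n → Vec M) (c : Vec M) (x : Vec n) : Prop :=
  ∃ U ∈ 𝓝 x, volume (U ∩ {y | u y ≠ c}) = 0

lemma isOpen_locallyAE (u : Vec n → Vec M) (c : Vec M) : IsOpen {x | LocallyAE u c x} := by
  refine isOpen_iff_mem_nhds.2 fun x ⟨U, hU, h⟩ => ?_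
  filter_upwards [eventually_mem_nhds_iff.2 hU] with y hy using ⟨U, hy, h⟩

lemma LocallyAE.eq {u : Vec n → Vec M} {c c' : Vec M} {x : Vec n} (h : LocallyAE u c x)
    (h' : LocallyAE u c' x) : c = c' := by
  obtain ⟨U, hU, h0⟩ := h
  obtain ⟨U', hU', h0'⟩ := h'
  by_contra hne
  have hpos := Measure.measure_pos_of_mem_nhds (volume : Measure (Vec n)) (inter_mem hU hU')
  refine hpos.ne' (measure_mono_null (fun y hy => ?_) (measure_union_null h0 h0'))
  by_cases hy' : u y = c
  · exact Or.inr ⟨hy.2, by rw [mem_ofPred_eq, hy']; exact hne⟩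
  · exact Or.inl ⟨hy.1, hy'⟩

/-- Unique continuation for functions that are locally constant almost everywhere. -/
lemma ae_eq_zero_of_locallyAE (hΩ : IsPreconnected Ω) {u : Vec n → Vec M}
    (hu : ∀ x ∈ Ω, ∃ c, LocallyAE u c x) {E : Set (Vec n)} (hE : E ⊆ Ω) (hE0 : volume E ≠ 0)
    (huE : volume (E ∩ {y | u y ≠ 0}) = 0) : volume (Ω ∩ {y | u y ≠ 0}) = 0 := by
  have hopen : IsOpen {x | ∃ c, c ≠ 0 ∧ LocallyAE u c x} := by
    have : {x | ∃ c, c ≠ 0 ∧ LocallyAE u c x} = ⋃ c ∈ {c : Vec M | c ≠ 0}, {x | LocallyAE u c x} := by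
      ext x; simp
    rw [this]
    exact isOpen_biUnion fun c _ => isOpen_locallyAE u c
  -- The points with local value zero and those with nonzero local value form disjoint open sets
  -- covering `Ω`. The former occur, since otherwise `E` would be a null set.
  have hsub : Ω ⊆ {x | LocallyAE u 0 x} := by
    refine hΩ.subset_left_of_subset_union (isOpen_locallyAE u 0) hopen
      (disjoint_left.2 fun x hx ⟨c, hc, hx'⟩ => hc (hx'.eq hx)) (fun x hx => ?_) ?_
    · obtain ⟨c, hc⟩ := hu x hx
      by_cases h0 : c = 0
      · exact Or.inl (h0 ▸ hc)
      · exact Or.inr ⟨c, h0, hc⟩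
    · by_contra hemp
      rw [not_nonempty_iff_eq_empty, eq_empty_iff_forall_notMem] at hemp
      refine hE0 (measure_mono_null (t := (E ∩ {y | u y ≠ 0}) ∪ (E ∩ {y | u y = 0})) (fun y hy => ?_)
        (measure_union_null huE (measure_null_of_locally_null _ fun x hx => ?_)))
      · by_cases h0 : u y = 0
        · exact Or.inr ⟨hy, h0⟩
        · exact Or.inl ⟨hy, h0⟩
      · obtain ⟨c, U, hU, h0⟩ := hu x (hE hx.1)
        have hc : c ≠ 0 := fun hc => hemp x ⟨hE hx.1, U, hU, hc ▸ h0⟩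
        refine ⟨U ∩ (E ∩ {y | u y = 0}), inter_mem (mem_nhdsWithin_of_mem_nhds hU)
          self_mem_nhdsWithin, measure_mono_null (t := U ∩ {y | u y ≠ c}) ?_ h0⟩
        rintro y ⟨hyU, -, hy⟩
        refine ⟨hyU, ?_⟩
        rw [mem_ofPred_eq] at hy ⊢
        rw [hy]
        exact hc.symm
  refine measure_null_of_locally_null _ fun x hx => ?_
  obtain ⟨U, hU, h0⟩ := hsub hx.1
  exact ⟨U ∩ (Ω ∩ {y | u y ≠ 0}), inter_mem (mem_nhdsWithin_of_mem_nhds hU) self_mem_nhdsWithin,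
    measure_mono_null (inter_subset_inter_right U inter_subset_right) h0⟩

/-- Limits of functions whose gradients tend to zero are locally constant. -/
lemma exists_locallyAE (hΩ : IsOpen Ω) {v : ℕ → Vec n → Vec M} (hv : ∀ k, ContDiff ℝ 1 (v k))
    {u : Vec n → Vec M} (hu : StronglyMeasurable u)
    (hlim : Tendsto (fun k => ∫⁻ x in Ω, ‖v k x - u x‖ₑ) atTop (𝓝 0))
    (hgrad : Tendsto (fun k => ∫⁻ x in Ω, ‖fderiv ℝ (v k) x‖ₑ) atTop (𝓝 0)) {x : Vec n}
    (hx : x ∈ Ω) : ∃ c, LocallyAE u c x := by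
  have hm := hΩ.measurableSet
  obtain ⟨r, hr, hsub⟩ := Metric.isOpen_iff.1 hΩ x hx
  -- Points within `ρ` of `x`, moved by less than `2 * ρ`, stay in the ball of radius `r`.
  set ρ := r / 3
  have hρ : 0 < ρ := by positivity
  set B := Metric.ball x ρ
  have hB : MeasurableSet B := measurableSet_ball
  have hin : ∀ h : Vec n, ‖h‖ < 2 * ρ → ∀ y ∈ B, ∀ s : ℝ, 0 ≤ s → s ≤ 1 → y + s • h ∈ Ω := by
    intro h hh y hy s hs hs1
    refine hsub ?_
    rw [Metric.mem_ball, dist_eq_norm] at hy ⊢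
    calc ‖y + s • h - x‖ = ‖(y - x) + s • h‖ := by congr 1; abel
      _ ≤ ‖y - x‖ + s * ‖h‖ := by
        refine (norm_add_le _ _).trans ?_
        rw [norm_smul, Real.norm_of_nonneg hs]
      _ ≤ ‖y - x‖ + 1 * ‖h‖ := by gcongr
      _ < r := by simp only [ρ] at hy hh; linarith
  -- The translation estimate for the approximants passes to the limit, where the gradient term is
  -- gone.
  have htrans : ∀ h : Vec n, ‖h‖ < 2 * ρ → ∫⁻ y in B, ‖u (y + h) - u y‖ₑ = 0 := by
    intro h hh
    have hle : ∀ k, ∫⁻ y in B, ‖u (y + h) - u y‖ₑ ≤ (∫⁻ y in Ω, ‖v k y - u y‖ₑ) +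
        (‖h‖ₑ * (∫⁻ y in Ω, ‖fderiv ℝ (v k) y‖ₑ) + ∫⁻ y in Ω, ‖v k y - u y‖ₑ) := fun k => by
      have hmk : Measurable fun y => ‖v k y - u y‖ₑ :=
        ((hv k).continuous.measurable.sub hu.measurable).enorm
      have hmk' : Measurable fun y => ‖v k (y + h) - v k y‖ₑ :=
        (((hv k).continuous.comp (continuous_id.add continuous_const)).sub
          (hv k).continuous).measurable.enorm
      calc ∫⁻ y in B, ‖u (y + h) - u y‖ₑ
          ≤ ∫⁻ y in B, (‖v k (y + h) - u (y + h)‖ₑ + (‖v k (y + h) - v k y‖ₑ + ‖v k y - u y‖ₑ)) := by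
            refine lintegral_mono fun y => ?_
            have e : u (y + h) - u y = (v k (y + h) - v k y + (v k y - u y)) -
              (v k (y + h) - u (y + h)) := by abel
            rw [e, add_comm ‖v k (y + h) - u (y + h)‖ₑ]
            exact enorm_sub_le.trans (add_le_add (enorm_add_le _ _) le_rfl)
        _ = (∫⁻ y in B, ‖v k (y + h) - u (y + h)‖ₑ) +
              ((∫⁻ y in B, ‖v k (y + h) - v k y‖ₑ) + ∫⁻ y in B, ‖v k y - u y‖ₑ) := by
            have hmk2 : Measurable fun y => ‖v k (y + h) - u (y + h)‖ₑ :=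
              hmk.comp (measurable_id.add_const h)
            rw [lintegral_add_left hmk2, lintegral_add_left hmk']
        _ ≤ _ := by
            refine add_le_add ?_ (add_le_add ?_ ?_)
            · refine setLIntegral_comp_add_le hm hB (fun y hy => ?_) fun y => ‖v k y - u y‖ₑ
              simpa using hin h hh y hy 1 zero_le_one le_rfl
            · exact setLIntegral_translate_sub_le hm (hv k) hB
                fun y hy s hs hs1 => hin h hh y hy s hs.le hs1
            · refine lintegral_mono_set fun y hy => ?_
              simpa using hin h hh y hy 0 le_rfl zero_le_one
    have hlim' := hlim.add ((ENNReal.Tendsto.const_mul (a := ‖h‖ₑ) hgrad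
      (Or.inr enorm_ne_top)).add hlim)
    simp only [mul_zero, add_zero] at hlim'
    exact le_antisymm (ge_of_tendsto' hlim' hle) zero_le
  set B' : Set (Vec n) := Metric.ball 0 (2 * ρ)
  have hjm : Measurable fun y : Vec n × Vec n => ‖u (y.1 + y.2) - u y.1‖ₑ :=
    ((hu.measurable.comp (measurable_fst.add measurable_snd)).sub
      (hu.measurable.comp measurable_fst)).enorm
  have hdouble : ∫⁻ y in B, ∫⁻ h in B', ‖u (y + h) - u y‖ₑ = 0 := by
    rw [lintegral_lintegral_swap hjm.aemeasurable]
    refine (setLIntegral_congr_fun measurableSet_ball fun h hh => htrans h ?_).trans (by simp)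
    rwa [mem_ball_zero_iff] at hh
  rw [lintegral_eq_zero_iff hjm.lintegral_prod_right'] at hdouble
  have hne : NeBot (ae (volume.restrict B)) := by
    rw [ae_neBot, Ne, Measure.restrict_eq_zero]
    exact (Metric.measure_ball_pos volume x hρ).ne'
  -- By Fubini some `y` satisfies `u (y + h) = u y` for almost all `h` at once. These `y + h` cover
  -- the ball, so `u y` is the local value.
  obtain ⟨y, hy0, hyB⟩ := (hdouble.and (ae_restrict_mem hB)).exists
  refine ⟨u y, B, Metric.ball_mem_nhds x hρ, ?_⟩
  have h1 := setLIntegral_comp_add_le (Ω := B') measurableSet_ball hB (h := -y) (fun z hz => by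
    rw [Metric.mem_ball] at hz hyB
    rw [mem_ball_zero_iff, ← sub_eq_add_neg, ← dist_eq_norm]
    linarith [dist_triangle_right z y x]) fun h => ‖u (y + h) - u y‖ₑ
  simp only [add_neg_cancel_comm_assoc] at h1
  have h2 : ∫⁻ z in B, ‖u z - u y‖ₑ = 0 := le_antisymm (h1.trans hy0.le) zero_le
  rw [lintegral_eq_zero_iff (hu.measurable.sub_const _).enorm, EventuallyEq,
    ae_restrict_iff' hB] at h2
  refine measure_mono_null (fun z hz => ?_) h2
  simp only [mem_compl_iff, mem_ofPred_eq, Classical.not_imp]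
  refine ⟨hz.1, ?_⟩
  simp only [Pi.zero_apply, enorm_eq_zero, sub_eq_zero]
  exact hz.2

lemma gradOf_const_smul {v : Vec n → Vec M} (hv : ContDiff ℝ 1 v) (a : ℝ) (x : Vec n) :
    gradOf (fun y => a • v y) x = a • gradOf v x := by
  rw [gradOf_eq, gradOf_eq, ← map_smul]
  congr 1
  exact ((hv.differentiable (by norm_num) x).hasFDerivAt.const_smul a).fderiv

lemma lintegral_enorm_eq_ofReal {E : Type*} [NormedAddCommGroup E] {μ : Measure (Vec n)}
    {g : Vec n → E} (hg : Integrable g μ) : ∫⁻ x, ‖g x‖ₑ ∂μ = ENNReal.ofReal (∫ x, ‖g x‖ ∂μ) := by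
  rw [ofReal_integral_eq_lintegral_ofReal hg.norm (Eventually.of_forall fun x => norm_nonneg _)]
  simp_rw [ofReal_norm]

/-- Poincaré's inequality for functions that are controlled on a set of positive measure. -/
theorem exists_poincare (hΩ : IsBoundedLipschitzDomain Ω) {E : Set (Vec n)} (hE : E ⊆ Ω)
    (hE0 : volume E ≠ 0) : ∃ C : ℝ, 0 ≤ C ∧ ∀ v : Vec n → Vec M, ContDiff ℝ 1 v →
      ∫ x in Ω, ‖v x‖ ≤ C * ((∫ x in Ω, ‖gradOf v x‖) + ∫ x in E, ‖v x‖) := by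
  by_contra hcon
  push Not at hcon
  -- Counterexamples with constants `k + 1`, normalized in `L¹`, have a limit of norm one that is
  -- locally constant and vanishes almost everywhere on `E`, which is absurd.
  choose v hv hlt using fun k : ℕ => hcon (k + 1) (by positivity)
  set a : ℕ → ℝ := fun k => ∫ x in Ω, ‖v k x‖ with ha
  have ha0 : ∀ k, 0 < a k := fun k => lt_of_le_of_lt (by positivity) (hlt k)
  set w : ℕ → Vec n → Vec M := fun k x => (a k)⁻¹ • v k x
  have hw : ∀ k, ContDiff ℝ 1 (w k) := fun k => (hv k).const_smul (a k)⁻¹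
  have hscale : ∀ k (S : Set (Vec n)) (G : Vec n → ℝ),
      ∫ x in S, (a k)⁻¹ * G x = (a k)⁻¹ * ∫ x in S, G x := fun k S G => integral_const_mul _ _
  have hnw : ∀ k x, ‖w k x‖ = (a k)⁻¹ * ‖v k x‖ := fun k x => by
    rw [norm_smul, Real.norm_of_nonneg (inv_nonneg.2 (ha0 k).le)]
  have hgw : ∀ k x, ‖gradOf (w k) x‖ = (a k)⁻¹ * ‖gradOf (v k) x‖ := fun k x => by
    rw [gradOf_const_smul (hv k), norm_smul, Real.norm_of_nonneg (inv_nonneg.2 (ha0 k).le)]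
  have hw1 : ∀ k, ∫ x in Ω, ‖w k x‖ = 1 := fun k => by
    simp_rw [hnw, hscale]
    exact inv_mul_cancel₀ (ha0 k).ne'
  have hwlt : ∀ k, (∫ x in Ω, ‖gradOf (w k) x‖) + ∫ x in E, ‖w k x‖ ≤ 1 / ((k : ℝ) + 1) := fun k => by
    simp_rw [hnw, hgw, hscale]
    rw [← mul_add, inv_mul_le_iff₀ (ha0 k), mul_one_div, le_div_iff₀ (by positivity), mul_comm]
    exact (hlt k).le
  have hwE0 : ∀ k, 0 ≤ ∫ x in E, ‖w k x‖ := fun k => integral_nonneg fun x => norm_nonneg _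
  have hwg0 : ∀ k, 0 ≤ ∫ x in Ω, ‖gradOf (w k) x‖ := fun k => integral_nonneg fun x => norm_nonneg _
  have hk1 : ∀ k : ℕ, 1 / ((k : ℝ) + 1) ≤ 1 := fun k => by
    rw [div_le_one (by positivity)]
    have : (0 : ℝ) ≤ k := by positivity
    linarith
  obtain ⟨u', hu', φ, hφ, hlim'⟩ := exists_subseq_tendsto_eLpNorm hΩ hw (C := 1)
    (fun k => (hw1 k).le) fun k => by linarith [hwlt k, hk1 k, hwE0 k]
  obtain ⟨u, hum, huu'⟩ := hu'.1
  have hlim : Tendsto (fun k => ∫⁻ x in Ω, ‖w (φ k) x - u x‖ₑ) atTop (𝓝 0) := by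
    refine hlim'.congr fun k => ?_
    rw [eLpNorm_one_eq_lintegral_enorm]
    refine lintegral_congr_ae ?_
    filter_upwards [huu'] with x hx
    rw [Pi.sub_apply, hx]
  have hφk : Tendsto (fun k => 1 / ((φ k : ℝ) + 1)) atTop (𝓝 0) :=
    tendsto_one_div_add_atTop_nhds_zero_nat.comp hφ.tendsto_atTop
  have hofReal : ∀ c : ℝ, Tendsto (fun k => ENNReal.ofReal (c * (1 / ((φ k : ℝ) + 1)))) atTop (𝓝 0) :=
    fun c => by simpa using ENNReal.tendsto_ofReal (hφk.const_mul c)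
  obtain ⟨B, hB, hle⟩ := exists_norm_le_toTens n M
  have hgrad : Tendsto (fun k => ∫⁻ x in Ω, ‖fderiv ℝ (w (φ k)) x‖ₑ) atTop (𝓝 0) := by
    refine tendsto_of_tendsto_of_tendsto_of_le_of_le tendsto_const_nhds (hofReal B)
      (fun _ => zero_le) fun k => ?_
    calc ∫⁻ x in Ω, ‖fderiv ℝ (w (φ k)) x‖ₑ
        ≤ ∫⁻ x in Ω, ENNReal.ofReal B * ‖gradOf (w (φ k)) x‖ₑ := by
          refine lintegral_mono fun x => ?_
          rw [← ofReal_norm, ← ofReal_norm, ← ENNReal.ofReal_mul hB.le]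
          exact ENNReal.ofReal_le_ofReal (hle _)
      _ = ENNReal.ofReal (B * ∫ x in Ω, ‖gradOf (w (φ k)) x‖) := by
          rw [lintegral_const_mul' _ _ ENNReal.ofReal_ne_top, lintegral_enorm_eq_ofReal
            (memLp_one_iff_integrable.1 (isWeakGrad_gradOf hΩ (hw _)).1), ENNReal.ofReal_mul hB.le]
      _ ≤ _ := by
          gcongr
          linarith [hwlt (φ k), hwE0 (φ k)]
  have huE : ∫⁻ x in E, ‖u x‖ₑ = 0 := by
    have hle : ∀ k, ∫⁻ x in E, ‖u x‖ₑ ≤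
        (∫⁻ x in Ω, ‖w (φ k) x - u x‖ₑ) + ENNReal.ofReal (1 * (1 / ((φ k : ℝ) + 1))) := fun k => by
      calc ∫⁻ x in E, ‖u x‖ₑ ≤ ∫⁻ x in E, (‖w (φ k) x - u x‖ₑ + ‖w (φ k) x‖ₑ) := by
            refine lintegral_mono fun x => ?_
            have e : u x = w (φ k) x - (w (φ k) x - u x) := by abel
            nth_rewrite 1 [e]
            rw [add_comm]
            exact enorm_sub_le
        _ = (∫⁻ x in E, ‖w (φ k) x - u x‖ₑ) + ∫⁻ x in E, ‖w (φ k) x‖ₑ :=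
            lintegral_add_left ((hw _).continuous.measurable.sub hum.measurable).enorm _
        _ ≤ _ := by
            refine add_le_add (lintegral_mono_set hE) ?_
            rw [lintegral_enorm_eq_ofReal (memLp_one_iff_integrable.1
              (memLp_of_continuous hΩ hE (hw _).continuous 1))]
            refine ENNReal.ofReal_le_ofReal ?_
            linarith [hwlt (φ k), hwg0 (φ k)]
    have := hlim.add (hofReal 1)
    rw [add_zero] at this
    exact le_antisymm (ge_of_tendsto' this hle) zero_le
  have huE' : volume (E ∩ {y | u y ≠ 0}) = 0 := by
    rw [lintegral_eq_zero_iff hum.measurable.enorm] at huE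
    have hms : MeasurableSet {y | u y ≠ 0} := hum.measurable (measurableSet_singleton 0).compl
    rw [inter_comm, ← Measure.restrict_apply hms]
    refine measure_mono_null (fun y hy => ?_) huE
    simpa using hy
  have hzero := ae_eq_zero_of_locallyAE hΩ.isConnected.isPreconnected
    (fun x hx => exists_locallyAE hΩ.isOpen (fun k => hw (φ k)) hum hlim hgrad hx) hE hE0 huE'
  have huz : ∀ᵐ x ∂volume.restrict Ω, u x = 0 := by
    rw [ae_restrict_iff' hΩ.isOpen.measurableSet]
    refine measure_mono_null (fun y hy => ?_) hzero
    simpa using hy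
  have hone : Tendsto (fun _ : ℕ => (1 : ENNReal)) atTop (𝓝 0) := by
    refine hlim.congr fun k => ?_
    rw [← ENNReal.ofReal_one, ← hw1 (φ k), ← lintegral_enorm_eq_ofReal (memLp_one_iff_integrable.1
      (memLp_of_continuous hΩ le_rfl (hw _).continuous 1))]
    refine lintegral_congr_ae ?_
    filter_upwards [huz] with x hx
    rw [hx, sub_zero]
  exact one_ne_zero (tendsto_nhds_unique tendsto_const_nhds hone)

end Inpainting

/-! ### Strict convexity, semicontinuity and minimizing sequences. -/

namespace Inpainting

section StrictConvexity

variable {E : Type*} [NormedAddCommGroup E] [NormedSpace ℝ E] {ζ : ℝ}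

lemma norm_midpoint_rpow_le (hζ : 1 < ζ) (a b : E) :
    ‖(2⁻¹ : ℝ) • (a + b)‖ ^ ζ ≤ 2⁻¹ * ‖a‖ ^ ζ + 2⁻¹ * ‖b‖ ^ ζ := by
  have h1 : ‖(2⁻¹ : ℝ) • (a + b)‖ ≤ 2⁻¹ * ‖a‖ + 2⁻¹ * ‖b‖ := by
    rw [norm_smul, ← mul_add, Real.norm_of_nonneg (by norm_num)]
    gcongr
    exact norm_add_le _ _
  have h2 := (convexOn_rpow hζ.le).2 (norm_nonneg a) (norm_nonneg b)
    (show (0 : ℝ) ≤ 2⁻¹ by norm_num) (show (0 : ℝ) ≤ 2⁻¹ by norm_num) (by norm_num)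
  simp only [smul_eq_mul] at h2
  exact (Real.rpow_le_rpow (norm_nonneg _) h1 (by linarith)).trans h2

/-- For equal norms the strictness comes from the norm of the strictly convex space, for different
norms from the power `ζ > 1`. -/
lemma norm_midpoint_rpow_lt [StrictConvexSpace ℝ E] (hζ : 1 < ζ) {a b : E} (hab : a ≠ b) :
    ‖(2⁻¹ : ℝ) • (a + b)‖ ^ ζ < 2⁻¹ * ‖a‖ ^ ζ + 2⁻¹ * ‖b‖ ^ ζ := by
  by_cases h : ‖a‖ = ‖b‖
  · have h1 : ‖(2⁻¹ : ℝ) • (a + b)‖ < ‖b‖ := by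
      have := (norm_midpoint_lt_iff h).2 hab
      rwa [one_div, h] at this
    rw [h, ← add_mul]
    norm_num
    exact Real.rpow_lt_rpow (norm_nonneg _) (by simpa using h1) (by linarith)
  · have h1 : ‖(2⁻¹ : ℝ) • (a + b)‖ ≤ 2⁻¹ * ‖a‖ + 2⁻¹ * ‖b‖ := by
      rw [norm_smul, ← mul_add, Real.norm_of_nonneg (by norm_num)]
      gcongr
      exact norm_add_le _ _
    have h2 := (strictConvexOn_rpow hζ).2 (norm_nonneg a) (norm_nonneg b) h
      (show (0 : ℝ) < 2⁻¹ by norm_num) (show (0 : ℝ) < 2⁻¹ by norm_num) (by norm_num)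
    simp only [smul_eq_mul] at h2
    exact (Real.rpow_le_rpow (norm_nonneg _) h1 (by linarith)).trans_lt h2

end StrictConvexity

variable {n M : ℕ} {Ω D : Set (Vec n)} {F : Tens n M → ℝ} {ν₁ ν₂ ν₃ : ℝ} {u v : Vec n → Vec M}
  {f : Vec n → Vec M} {lam ζ : ℝ}

lemma integrable_mul_partialDeriv {φ : Vec n → ℝ} (hφ : IsTest Ω φ)
    (hu : MemLp u 1 (volume.restrict Ω)) (j : Fin M) (i : Fin n) :
    Integrable (fun x => u x j * partialDeriv i φ x) (volume.restrict Ω) := by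
  obtain ⟨C, hC⟩ := hφ.exists_bound_partialDeriv i
  exact (integrable_apply (memLp_one_iff_integrable.1 hu) j).mul_bdd
    (hφ.continuous_partialDeriv i).aestronglyMeasurable (Eventually.of_forall hC)

/-- Representations of the midpoint. -/
lemma GradRep.midpoint {m : Measure (Vec n)} {p q : Vec n → Tens n M} {t t' : Vec n → ℝ}
    (h : GradRep Ω u m p t) (h' : GradRep Ω v m q t') (hu : MemLp u 1 (volume.restrict Ω))
    (hv : MemLp v 1 (volume.restrict Ω)) :
    GradRep Ω ((2⁻¹ : ℝ) • (u + v)) m ((2⁻¹ : ℝ) • (p + q)) t :=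
  { h with
    int_p := (h.int_p.add h'.int_p).smul _
    grad := fun φ hφ j i => by
      have h1 : ∀ x, ((2⁻¹ : ℝ) • (u + v)) x j * partialDeriv i φ x =
          2⁻¹ * (u x j * partialDeriv i φ x + v x j * partialDeriv i φ x) := fun x => by
        simp only [Pi.smul_apply, Pi.add_apply, PiLp.smul_apply, PiLp.add_apply, smul_eq_mul]
        ring
      have h2 : ∀ x, φ x * ((2⁻¹ : ℝ) • (p + q)) x (j, i) =
          2⁻¹ * (φ x * p x (j, i) + φ x * q x (j, i)) := fun x => by
        simp only [Pi.smul_apply, Pi.add_apply, PiLp.smul_apply, PiLp.add_apply, smul_eq_mul]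
        ring
      simp_rw [h1, h2, integral_const_mul]
      rw [integral_add (integrable_mul_partialDeriv hφ hu j i) (integrable_mul_partialDeriv hφ hv j i),
        integral_add (hφ.integrable_mul (integrable_apply h.int_p _))
          (hφ.integrable_mul (integrable_apply h'.int_p _)), h.grad φ hφ, h'.grad φ hφ]
      ring }

/-- Minimizers are unique up to the singular part of the gradient. -/
theorem minimizers_unique (hΩ : IsOpen Ω) (hfin : volume Ω ≠ ⊤) (hF : IsDensity F ν₁ ν₂ ν₃)
    (hζ : 1 < ζ) (hlam : 0 < lam) (hf : MemLp f (ENNReal.ofReal ζ) (volume.restrict (Ω \ D)))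
    (hu : u ∈ minimizers (functionalK Ω D f F lam ζ) (classBV M Ω D ζ))
    (hv : v ∈ minimizers (functionalK Ω D f F lam ζ) (classBV M Ω D ζ)) :
    u =ᵐ[volume.restrict (Ω \ D)] v ∧ gradAC Ω u =ᵐ[volume.restrict Ω] gradAC Ω v := by
  obtain ⟨⟨huBV, huζ⟩, humin⟩ := hu
  obtain ⟨⟨hvBV, hvζ⟩, hvmin⟩ := hv
  obtain ⟨m₁, p₁, t₁, h₁, -, -⟩ := huBV.exists_gradRep hΩ hfin
  obtain ⟨m₂, p₂, t₂, h₂, -, -⟩ := hvBV.exists_gradRep hΩ hfin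
  have := h₁.finite
  have := h₂.finite
  have h0 : (m₁ + m₂) Ωᶜ = 0 := by simp [h₁.compl, h₂.compl]
  have c₁ := h₁.change (Measure.le_add_right le_rfl : m₁ ≤ m₁ + m₂) h0
  have c₂ := h₂.change (Measure.le_add_left le_rfl : m₂ ≤ m₁ + m₂) h0
  clear h₁ h₂
  set m := m₁ + m₂
  generalize (fun x => relDensity m₁ m x • p₁ x) = p at c₁
  generalize (fun x => relDensity m₁ m x * t₁ x) = t at c₁
  generalize (fun x => relDensity m₂ m x • p₂ x) = q at c₂
  generalize (fun x => relDensity m₂ m x * t₂ x) = s at c₂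
  -- Both gradients are now represented over one measure, with the same Lebesgue density.
  have hts := c₁.density_eq c₂
  have cw := c₁.midpoint c₂ huBV.1 hvBV.1
  set w : Vec n → Vec M := (2⁻¹ : ℝ) • (u + v)
  have hw1 : MemLp w 1 (volume.restrict Ω) := (huBV.1.add hvBV.1).const_smul _
  have hwζ : MemLp w (ENNReal.ofReal ζ) (volume.restrict (Ω \ D)) := (huζ.add hvζ).const_smul _
  have hw : w ∈ classBV M Ω D ζ := ⟨cw.memBV hw1, hwζ⟩
  have hi₁ := hF.integrable_persp c₁.int_p c₁.int_t.aemeasurable c₁.t_nonneg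
  have hi₂ := hF.integrable_persp c₂.int_p c₂.int_t.aemeasurable c₂.t_nonneg
  have hiw := hF.integrable_persp cw.int_p cw.int_t.aemeasurable cw.t_nonneg
  have hfu := integrable_rpow_norm_sub hζ hf huζ
  have hfv := integrable_rpow_norm_sub hζ hf hvζ
  have hfw := integrable_rpow_norm_sub hζ hf hwζ
  have hwf : ∀ x, w x - f x = (2⁻¹ : ℝ) • ((u x - f x) + (v x - f x)) := fun x => by
    simp only [w, Pi.smul_apply, Pi.add_apply]
    module
  have hpersp : ∀ᵐ x ∂m, persp F (((2⁻¹ : ℝ) • (p + q)) x) (t x) ≤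
      2⁻¹ * persp F (p x) (t x) + 2⁻¹ * persp F (q x) (s x) := by
    filter_upwards [hts, c₁.t_nonneg] with x hx h0
    rw [← hx]
    exact hF.persp_add_le _ _ h0
  have hfid : ∀ x, ‖w x - f x‖ ^ ζ ≤ 2⁻¹ * ‖u x - f x‖ ^ ζ + 2⁻¹ * ‖v x - f x‖ ^ ζ := fun x => by
    rw [hwf]
    exact norm_midpoint_rpow_le hζ _ _
  have hI1 := integral_mono_ae hiw ((hi₁.const_mul 2⁻¹).add (hi₂.const_mul 2⁻¹)) hpersp
  have hI2 := integral_mono hfw ((hfu.const_mul 2⁻¹).add (hfv.const_mul 2⁻¹)) hfid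
  have e1 := integral_add (hi₁.const_mul 2⁻¹) (hi₂.const_mul 2⁻¹)
  have e2 := integral_add (hfu.const_mul 2⁻¹) (hfv.const_mul 2⁻¹)
  rw [integral_const_mul, integral_const_mul] at e1 e2
  have hKw := humin w hw
  have hKuv := humin v ⟨hvBV, hvζ⟩
  have hKvu := hvmin u ⟨huBV, huζ⟩
  rw [functionalK_eq, functionalK_eq, c₁.energy_eq hF hΩ hfin huBV.1] at hKw hKuv hKvu
  rw [c₂.energy_eq hF hΩ hfin hvBV.1] at hKuv hKvu
  rw [cw.energy_eq hF hΩ hfin hw1] at hKw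
  simp only [fidelity] at hKw hKuv hKvu
  have hl : 0 < lam / ζ := by
    have : 0 < ζ := by linarith
    positivity
  have hI2' := mul_le_mul_of_nonneg_left hI2 hl.le
  simp only [Pi.add_apply] at hI1 hI2 hI2' e1 e2
  rw [e1] at hI1
  rw [e2] at hI2'
  -- Minimality rules out that the midpoint has less than the average value, so neither convexity
  -- inequality can be strict after integration, and both are equalities almost everywhere.
  have hE1 : ∫ x, persp F (((2⁻¹ : ℝ) • (p + q)) x) (t x) ∂m =
      ∫ x, (2⁻¹ * persp F (p x) (t x) + 2⁻¹ * persp F (q x) (s x)) ∂m := by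
    rw [e1]
    nlinarith
  have hE2 : ∫ x in Ω \ D, ‖w x - f x‖ ^ ζ =
      ∫ x in Ω \ D, (2⁻¹ * ‖u x - f x‖ ^ ζ + 2⁻¹ * ‖v x - f x‖ ^ ζ) := by
    rw [e2]
    refine mul_left_cancel₀ hl.ne' ?_
    nlinarith
  have hA1 := (integral_eq_iff_of_ae_le hiw ((hi₁.const_mul 2⁻¹).add (hi₂.const_mul 2⁻¹)) hpersp).1 hE1
  have hA2 := (integral_eq_iff_of_ae_le hfw ((hfu.const_mul 2⁻¹).add (hfv.const_mul 2⁻¹))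
    (Eventually.of_forall hfid)).1 hE2
  constructor
  · filter_upwards [hA2] with x hx
    by_contra hne
    have := norm_midpoint_rpow_lt hζ (a := u x - f x) (b := v x - f x)
      (fun h => hne (sub_left_injective h))
    rw [← hwf] at this
    exact this.ne hx
  · have hac := c₁.absolutelyContinuous
    -- Lebesgue almost everywhere on `Ω` the density `t` is positive, where `persp F` is strictly
    -- convex in its first argument.
    filter_upwards [c₁.gradAC_eq hΩ hfin huBV.1, c₂.gradAC_eq hΩ hfin hvBV.1, c₁.t_pos,
      hac.ae_le hA1, hac.ae_le hts] with x h1 h2 h3 h4 h5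
    rw [h1, h2, ← h5]
    congr 1
    by_contra hne
    have := hF.persp_add_lt h3 hne
    simp only [Pi.add_apply] at h4
    rw [← h5] at h4
    exact this.ne h4

/-- Lower semicontinuity along sequences from the Sobolev class. -/
theorem mem_classBV_of_tendsto (hΩ : IsBoundedLipschitzDomain Ω) (hF : IsDensity F ν₁ ν₂ ν₃)
    (hν₂ : 0 < ν₂) (hζ : 1 < ζ) (hlam : 0 < lam)
    (hf : MemLp f (ENNReal.ofReal ζ) (volume.restrict (Ω \ D))) {w : ℕ → Vec n → Vec M}
    (hw : ∀ k, w k ∈ classW M Ω D ζ) (hu : MemLp u 1 (volume.restrict Ω))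
    (hlim : Tendsto (fun k => eLpNorm (w k - u) 1 (volume.restrict Ω)) atTop (𝓝 0)) {c : ℝ}
    (hc : Tendsto (fun k => functionalI Ω D f F lam ζ (w k)) atTop (𝓝 c)) :
    u ∈ classBV M Ω D ζ ∧ functionalK Ω D f F lam ζ u ≤ c := by
  have hl : 0 < lam / ζ := by
    have : 0 < ζ := by linarith
    positivity
  have hD : volume.restrict (Ω \ D) ≤ volume.restrict Ω := Measure.restrict_mono sdiff_subset le_rfl
  obtain ⟨φ, hφ, hae⟩ := exists_subseq_tendsto_ae (fun k => (hw k).1.1.1) hu.1 hlim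
  set e : ℕ → ℝ := fun k => ∫ x in Ω, F (weakGrad Ω (w (φ k)) x)
  have he0 : ∀ k, 0 ≤ e k := fun k => integral_nonneg fun x => hF.nonneg _
  have hIe : ∀ k, functionalI Ω D f F lam ζ (w (φ k)) = e k + fidelity Ω D f lam ζ (w (φ k)) :=
    fun k => rfl
  have hcφ := hc.comp hφ.tendsto_atTop
  obtain ⟨b, hb⟩ := hcφ.bddAbove_range
  have heb : ∀ k, e k ∈ Icc 0 b := fun k => by
    refine ⟨he0 k, le_trans ?_ (hb (mem_range_self k))⟩
    have := fidelity_nonneg (Ω := Ω) (D := D) (f := f) hlam hζ (w (φ k))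
    change e k ≤ e k + fidelity Ω D f lam ζ (w (φ k))
    linarith
  -- Along a further subsequence energy and fidelity converge separately, to `a` and `c - a`, and
  -- each is treated by its own semicontinuity.
  obtain ⟨a, -, ψ, hψ, ha⟩ := isCompact_Icc.tendsto_subseq heb
  have hfid : Tendsto (fun k => fidelity Ω D f lam ζ (w (φ (ψ k)))) atTop (𝓝 (c - a)) := by
    refine ((hcφ.comp hψ.tendsto_atTop).sub ha).congr fun k => ?_
    simp only [Function.comp_apply, hIe]
    ring
  have hlim' : Tendsto (fun k => eLpNorm (w (φ (ψ k)) - u) 1 (volume.restrict Ω)) atTop (𝓝 0) :=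
    hlim.comp (hφ.comp hψ).tendsto_atTop
  have hE : ∀ δ > 0, MemBV Ω u ∧ energy Ω F u ≤ a + δ := fun δ hδ => by
    -- `exists_gradRep_of_tendsto` wants a bound for all members, so the first `N` are dropped.
    obtain ⟨N, hN⟩ := (ha.eventually_le_const (show a < a + δ by linarith)).exists_forall_of_atTop
    obtain ⟨m, p, t, hrep, hle⟩ := exists_gradRep_of_tendsto hF hν₂ hΩ.isOpen hΩ.volume_ne_top
      (fun k => (hw (φ (ψ (k + N)))).1.1) (fun k => (hw (φ (ψ (k + N)))).1.isWeakGrad) hu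
      (hlim'.comp (tendsto_add_atTop_nat N)) (A := a + δ) fun k => hN (k + N) (Nat.le_add_left _ _)
    exact ⟨hrep.memBV hu, (hrep.energy_eq hF hΩ.isOpen hΩ.volume_ne_top hu).trans_le hle⟩
  have hEa : energy Ω F u ≤ a := le_of_forall_pos_le_add fun δ hδ => (hE δ hδ).2
  have hint : ∀ k, Integrable (fun x => ‖w (φ (ψ k)) x - f x‖ ^ ζ) (volume.restrict (Ω \ D)) :=
    fun k => integrable_rpow_norm_sub hζ hf (hw _).2
  have huD : AEStronglyMeasurable (fun x => u x - f x) (volume.restrict (Ω \ D)) :=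
    (hu.1.mono_measure hD).sub hf.1
  -- Fatou's lemma in `[0, ∞]` also shows that `u` belongs to `L^ζ`, which is not known beforehand.
  have hfatou : ∫⁻ x in Ω \ D, ENNReal.ofReal (‖u x - f x‖ ^ ζ) ≤
      ENNReal.ofReal ((lam / ζ)⁻¹ * (c - a)) := by
    calc ∫⁻ x in Ω \ D, ENNReal.ofReal (‖u x - f x‖ ^ ζ)
        ≤ ∫⁻ x in Ω \ D, liminf (fun k => ENNReal.ofReal (‖w (φ (ψ k)) x - f x‖ ^ ζ)) atTop := by
          refine lintegral_mono_ae ?_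
          filter_upwards [ae_mono hD hae] with x hx
          have h1 : Tendsto (fun k => w (φ (ψ k)) x) atTop (𝓝 (u x)) := hx.comp hψ.tendsto_atTop
          exact (ENNReal.tendsto_ofReal ((h1.sub_const _).norm.rpow_const
            (Or.inr (by linarith)))).liminf_eq.ge
      _ ≤ liminf (fun k => ∫⁻ x in Ω \ D, ENNReal.ofReal (‖w (φ (ψ k)) x - f x‖ ^ ζ)) atTop :=
          lintegral_liminf_le' fun k => (hint k).aemeasurable.ennreal_ofReal
      _ = ENNReal.ofReal ((lam / ζ)⁻¹ * (c - a)) := by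
          refine Tendsto.liminf_eq ((ENNReal.tendsto_ofReal (hfid.const_mul (lam / ζ)⁻¹)).congr
            fun k => ?_)
          rw [fidelity, inv_mul_cancel_left₀ hl.ne', ofReal_integral_eq_lintegral_ofReal (hint k)
            (Eventually.of_forall fun x => by positivity)]
  have hiu : Integrable (fun x => ‖u x - f x‖ ^ ζ) (volume.restrict (Ω \ D)) := by
    refine ⟨(huD.norm.aemeasurable.pow_const ζ).aestronglyMeasurable, ?_⟩
    rw [hasFiniteIntegral_iff_ofReal (Eventually.of_forall fun x => by positivity)]
    exact hfatou.trans_lt ENNReal.ofReal_lt_top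
  have huζ : MemLp (fun x => u x - f x) (ENNReal.ofReal ζ) (volume.restrict (Ω \ D)) := by
    refine (integrable_norm_rpow_iff huD (by simp; linarith) ENNReal.ofReal_ne_top).1 ?_
    rwa [ENNReal.toReal_ofReal (by linarith)]
  refine ⟨⟨(hE 1 one_pos).1, ?_⟩, ?_⟩
  · have := huζ.add hf
    convert this using 1
    ext1 x
    simp
  · have hca : 0 ≤ c - a := ge_of_tendsto' hfid fun k => fidelity_nonneg hlam hζ _
    rw [← ofReal_integral_eq_lintegral_ofReal hiu (Eventually.of_forall fun x => by positivity),
      ENNReal.ofReal_le_ofReal_iff (by positivity), ← div_eq_inv_mul, le_div_iff₀ hl] at hfatou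
    rw [functionalK_eq, fidelity]
    linarith

lemma functionalK_nonneg (hF : IsDensity F ν₁ ν₂ ν₃) (hζ : 1 < ζ) (hlam : 0 < lam)
    (w : Vec n → Vec M) : 0 ≤ functionalK Ω D f F lam ζ w := by
  rw [functionalK_eq]
  exact add_nonneg (energy_nonneg hF w) (fidelity_nonneg hlam hζ w)

lemma classW_subset_classBV (hΩ : IsBoundedLipschitzDomain Ω) :
    classW M Ω D ζ ⊆ classBV M Ω D ζ :=
  fun _ hw => ⟨hw.1.memBV hΩ.isOpen hΩ.volume_ne_top, hw.2⟩

/-- Both functionals have the same infimum. -/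
lemma isGLB_functionalI (hΩ : IsBoundedLipschitzDomain Ω) (hF : IsDensity F ν₁ ν₂ ν₃)
    (hν₂ : 0 < ν₂) (hζ : 1 < ζ) (hf : MemLp f (ENNReal.ofReal ζ) (volume.restrict (Ω \ D))) {c : ℝ}
    (hc : IsGLB (functionalK Ω D f F lam ζ '' classBV M Ω D ζ) c) :
    IsGLB (functionalI Ω D f F lam ζ '' classW M Ω D ζ) c := by
  constructor
  · rintro _ ⟨w, hw, rfl⟩
    rw [hw.1.functionalI_eq hF hΩ.isOpen hΩ.volume_ne_top]
    exact hc.1 ⟨w, classW_subset_classBV hΩ hw, rfl⟩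
  · intro b hb
    refine hc.2 ?_
    rintro _ ⟨u, hu, rfl⟩
    refine le_of_forall_pos_le_add fun δ hδ => ?_
    obtain ⟨v, hv, -, hle⟩ := exists_contDiff_functionalK_le (lam := lam) hΩ hF hν₂ hζ hf hu hδ
    have hvW : v ∈ classW M Ω D ζ := mem_classW_of_contDiff hΩ hv ζ
    refine (hb ⟨v, hvW, rfl⟩).trans ?_
    rwa [hvW.1.functionalI_eq hF hΩ.isOpen hΩ.volume_ne_top]

/-- Every minimizer of the relaxed functional is the limit of a minimizing sequence from the Sobolev
class. -/
lemma exists_isMinimizingSeq_of_mem_minimizers (hΩ : IsBoundedLipschitzDomain Ω) (hF : IsDensity F ν₁ ν₂ ν₃)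
    (hν₂ : 0 < ν₂) (hζ : 1 < ζ) (hf : MemLp f (ENNReal.ofReal ζ) (volume.restrict (Ω \ D)))
    (hu : u ∈ minimizers (functionalK Ω D f F lam ζ) (classBV M Ω D ζ)) :
    ∃ w, IsMinimizingSeq (functionalI Ω D f F lam ζ) (classW M Ω D ζ) w ∧ IsL1ClusterPt Ω w u := by
  have hc : IsGLB (functionalK Ω D f F lam ζ '' classBV M Ω D ζ) (functionalK Ω D f F lam ζ u) :=
    IsLeast.isGLB ⟨⟨u, hu.1, rfl⟩, by rintro _ ⟨w, hw, rfl⟩; exact hu.2 w hw⟩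
  choose w hw hwu hwK using fun k : ℕ => exists_contDiff_functionalK_le (lam := lam) hΩ hF hν₂ hζ hf
    hu.1 (show (0 : ℝ) < 1 / (k + 1) by positivity)
  have hwW : ∀ k, w k ∈ classW M Ω D ζ := fun k => mem_classW_of_contDiff hΩ (hw k) ζ
  refine ⟨w, ⟨hwW, _, isGLB_functionalI hΩ hF hν₂ hζ hf hc, ?_⟩, hu.1.1.1, id, strictMono_id, ?_⟩
  · refine tendsto_of_tendsto_of_tendsto_of_le_of_le tendsto_const_nhds
      (h := fun k : ℕ => functionalK Ω D f F lam ζ u + 1 / ((k : ℝ) + 1)) ?_ (fun k => ?_)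
      fun k => ?_
    · simpa using tendsto_one_div_add_atTop_nhds_zero_nat.const_add (functionalK Ω D f F lam ζ u)
    · rw [(hwW k).1.functionalI_eq hF hΩ.isOpen hΩ.volume_ne_top]
      exact hu.2 _ (classW_subset_classBV hΩ (hwW k))
    · rw [(hwW k).1.functionalI_eq hF hΩ.isOpen hΩ.volume_ne_top]
      exact hwK k
  · refine tendsto_of_tendsto_of_tendsto_of_le_of_le tendsto_const_nhds
      (h := fun k : ℕ => ENNReal.ofReal (1 / (k + 1))) ?_ (fun _ => zero_le) fun k => ?_
    · simpa using ENNReal.tendsto_ofReal (tendsto_one_div_add_atTop_nhds_zero_nat (𝕜 := ℝ))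
    · rw [eLpNorm_one_eq_lintegral_enorm]
      exact hwu k

/-- The relaxed functional attains its minimum. -/
theorem minimizers_nonempty (hΩ : IsBoundedLipschitzDomain Ω) (hF : IsDensity F ν₁ ν₂ ν₃)
    (hν₂ : 0 < ν₂) (hζ : 1 < ζ) (hlam : 0 < lam)
    (hf : MemLp f (ENNReal.ofReal ζ) (volume.restrict (Ω \ D))) (hD : volume (Ω \ D) ≠ 0) {c : ℝ}
    (hc : IsGLB (functionalK Ω D f F lam ζ '' classBV M Ω D ζ) c) :
    (minimizers (functionalK Ω D f F lam ζ) (classBV M Ω D ζ)).Nonempty := by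
  have hl : 0 < lam / ζ := by
    have : 0 < ζ := by linarith
    positivity
  have hfinD : IsFiniteMeasure (volume.restrict (Ω \ D)) :=
    ⟨by simpa using (measure_mono sdiff_subset).trans_lt hΩ.isBounded.measure_lt_top⟩
  have hv : ∀ k : ℕ, ∃ v : Vec n → Vec M, ContDiff ℝ 1 v ∧
      functionalK Ω D f F lam ζ v ≤ c + 1 / ((k : ℝ) + 1) := fun k => by
    have hk : (0 : ℝ) < 1 / ((k : ℝ) + 1) / 2 := by positivity
    obtain ⟨_, ⟨u, hu, rfl⟩, -, hlt⟩ := hc.exists_between (show c < c + 1 / ((k : ℝ) + 1) / 2 by linarith)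
    obtain ⟨v, hv, -, hle⟩ := exists_contDiff_functionalK_le (lam := lam) hΩ hF hν₂ hζ hf hu hk
    exact ⟨v, hv, by linarith⟩
  choose v hv hvK using hv
  have hvW : ∀ k, v k ∈ classW M Ω D ζ := fun k => mem_classW_of_contDiff hΩ (hv k) ζ
  have hk1 : ∀ k : ℕ, 1 / ((k : ℝ) + 1) ≤ 1 := fun k => by
    rw [div_le_one (by positivity)]
    have : (0 : ℝ) ≤ k := by positivity
    linarith
  have hbound : ∀ k, (∫ x in Ω, F (gradOf (v k) x)) + fidelity Ω D f lam ζ (v k) ≤ c + 1 := fun k => by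
    have := hvK k
    rw [functionalK_eq, energy_of_contDiff hΩ hF (hv k)] at this
    linarith [hk1 k]
  have hgrad : ∀ k, ∫ x in Ω, ‖gradOf (v k) x‖ ≤ ν₂⁻¹ * (c + 1 + ν₃ * volume.real Ω) := fun k => by
    refine (integral_norm_gradOf_le hΩ hF hν₂ (hv k)).trans ?_
    gcongr
    linarith [hbound k, fidelity_nonneg (Ω := Ω) (D := D) (f := f) hlam hζ (v k)]
  have hfi : Integrable f (volume.restrict (Ω \ D)) :=
    hf.integrable (by rw [← ENNReal.ofReal_one]; exact ENNReal.ofReal_le_ofReal hζ.le)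
  -- From `s ≤ 1 + s ^ ζ`: the fidelity bounds the `L¹` norm on `Ω \ D`.
  have hE : ∀ k, ∫ x in Ω \ D, ‖v k x‖ ≤
      (∫ x in Ω \ D, (‖f x‖ + 1)) + (lam / ζ)⁻¹ * (c + 1) := fun k => by
    have hi := integrable_rpow_norm_sub hζ hf (hvW k).2
    have hi1 : Integrable (fun x => ‖f x‖ + 1) (volume.restrict (Ω \ D)) :=
      hfi.norm.add (integrable_const 1)
    calc ∫ x in Ω \ D, ‖v k x‖ ≤ ∫ x in Ω \ D, ((‖f x‖ + 1) + ‖v k x - f x‖ ^ ζ) := by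
          refine integral_mono (memLp_one_iff_integrable.1
            (memLp_of_continuous hΩ sdiff_subset (hv k).continuous.norm 1)) (hi1.add hi) fun x => ?_
          have h1 : ‖v k x‖ ≤ ‖v k x - f x‖ + ‖f x‖ := by
            simpa using norm_add_le (v k x - f x) (f x)
          have h2 : ‖v k x - f x‖ ≤ 1 + ‖v k x - f x‖ ^ ζ := by
            rcases le_total ‖v k x - f x‖ 1 with h | h
            · have : 0 ≤ ‖v k x - f x‖ ^ ζ := by positivity
              linarith
            · have := Real.rpow_le_rpow_of_exponent_le h hζ.le
              rw [Real.rpow_one] at this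
              linarith
          simp only
          linarith
      _ = (∫ x in Ω \ D, (‖f x‖ + 1)) + ∫ x in Ω \ D, ‖v k x - f x‖ ^ ζ := integral_add hi1 hi
      _ ≤ _ := by
          gcongr
          rw [← div_eq_inv_mul, le_div_iff₀ hl, mul_comm]
          have h1 := hbound k
          have h2 : 0 ≤ ∫ x in Ω, F (gradOf (v k) x) := integral_nonneg fun x => hF.nonneg _
          rw [fidelity] at h1
          linarith
  -- Bounds on the gradients over `Ω` and on the functions over `Ω \ D` combine to a bound in
  -- `L¹(Ω)`, as Rellich's theorem requires.
  obtain ⟨C, hC0, hC⟩ := exists_poincare (M := M) hΩ sdiff_subset hD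
  set C₁ := ν₂⁻¹ * (c + 1 + ν₃ * volume.real Ω)
  set C₂ := (∫ x in Ω \ D, (‖f x‖ + 1)) + (lam / ζ)⁻¹ * (c + 1)
  obtain ⟨u, hu, φ, hφ, hlim⟩ := exists_subseq_tendsto_eLpNorm hΩ hv (C := max (C * (C₁ + C₂)) C₁)
    (fun k => ((hC _ (hv k)).trans (by gcongr; exacts [hgrad k, hE k])).trans (le_max_left _ _))
    fun k => (hgrad k).trans (le_max_right _ _)
  have hIlim : Tendsto (fun k => functionalI Ω D f F lam ζ (v (φ k))) atTop (𝓝 c) := by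
    refine tendsto_of_tendsto_of_tendsto_of_le_of_le tendsto_const_nhds
      (h := fun k : ℕ => c + 1 / ((φ k : ℝ) + 1)) ?_ (fun k => ?_) fun k => ?_
    · simpa using (tendsto_one_div_add_atTop_nhds_zero_nat.comp hφ.tendsto_atTop).const_add c
    · exact (isGLB_functionalI hΩ hF hν₂ hζ hf hc).1 ⟨_, hvW _, rfl⟩
    · rw [(hvW _).1.functionalI_eq hF hΩ.isOpen hΩ.volume_ne_top]
      exact hvK _
  obtain ⟨huB, huK⟩ := mem_classBV_of_tendsto hΩ hF hν₂ hζ hlam hf (fun k => hvW (φ k)) hu hlim hIlim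
  exact ⟨u, huB, fun w hw => huK.trans (hc.1 ⟨w, hw, rfl⟩)⟩

end Inpainting

/-! ### Assembly of the four statements. -/

theorem theorem1p1 {n M : ℕ} (hn : 2 ≤ n) (hM : 1 ≤ M)
    (Ω D : Set (Inpainting.Vec n)) (hΩ : Inpainting.IsBoundedLipschitzDomain Ω)
    (hDΩ : D ⊆ Ω) (hD : NullMeasurableSet D volume) (hvol : volume D < volume Ω)
    (ζ : ℝ) (hζ : 1 < ζ) (lam : ℝ) (hlam : 0 < lam)
    (f : Inpainting.Vec n → Inpainting.Vec M)
    (hf : MemLp f (ENNReal.ofReal ζ) (volume.restrict (Ω \ D)))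
    (F : Inpainting.Tens n M → ℝ) (ν₁ ν₂ ν₃ : ℝ) (hν₁ : 0 < ν₁) (hν₂ : 0 < ν₂)
    (hF : Inpainting.IsDensity F ν₁ ν₂ ν₃) :
    let W := Inpainting.classW M Ω D ζ
    let B := Inpainting.classBV M Ω D ζ
    let I := Inpainting.functionalI Ω D f F lam ζ
    let K := Inpainting.functionalK Ω D f F lam ζ
    -- existence of a minimizer
    (Inpainting.minimizers K B).Nonempty ∧
    -- uniqueness outside of `D`, and of the absolutely continuous part of the gradient
    (∀ u ∈ Inpainting.minimizers K B, ∀ v ∈ Inpainting.minimizers K B,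
      u =ᵐ[volume.restrict (Ω \ D)] v ∧
      Inpainting.gradAC Ω u =ᵐ[volume.restrict Ω] Inpainting.gradAC Ω v) ∧
    -- equality of the two infima
    (∃ c : ℝ, IsGLB (I '' W) c ∧ IsGLB (K '' B) c) ∧
    -- generalized minimizers of `I` are exactly the minimizers of `K`
    {u | ∃ w, Inpainting.IsMinimizingSeq I W w ∧ Inpainting.IsL1ClusterPt Ω w u} =
      Inpainting.minimizers K B := by
  intro W B I K
  have hΩD : volume (Ω \ D) ≠ 0 := fun h0 => by
    refine hvol.not_ge ((measure_le_inter_add_sdiff volume Ω D).trans ?_)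
    rw [h0, add_zero]
    exact measure_mono inter_subset_right
  have h0B : (0 : Inpainting.Vec n → Inpainting.Vec M) ∈ B :=
    Inpainting.classW_subset_classBV hΩ (Inpainting.mem_classW_of_contDiff hΩ contDiff_const ζ)
  -- The real infimum is a genuine one, since the class contains `0` and `K` is nonnegative.
  have hc : IsGLB (K '' B) (sInf (K '' B)) := Real.isGLB_sInf ⟨_, mem_image_of_mem K h0B⟩
    ⟨0, by rintro _ ⟨w, -, rfl⟩; exact Inpainting.functionalK_nonneg hF hζ hlam w⟩
  have hcI : IsGLB (I '' W) (sInf (K '' B)) := Inpainting.isGLB_functionalI hΩ hF hν₂ hζ hf hc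
  refine ⟨Inpainting.minimizers_nonempty hΩ hF hν₂ hζ hlam hf hΩD hc, fun u hu v hv =>
    Inpainting.minimizers_unique hΩ.isOpen hΩ.volume_ne_top hF hζ hlam hf hu hv, ⟨_, hcI, hc⟩,
    Subset.antisymm ?_ fun u hu => Inpainting.exists_isMinimizingSeq_of_mem_minimizers hΩ hF hν₂ hζ hf hu⟩
  rintro u ⟨w, ⟨hw, c, hcw, hlimI⟩, hu, φ, hφ, hlim⟩
  obtain ⟨huB, huK⟩ := Inpainting.mem_classBV_of_tendsto hΩ hF hν₂ hζ hlam hf (fun k => hw (φ k)) hu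
    hlim (hlimI.comp hφ.tendsto_atTop)
  -- The limit of the minimizing sequence is the infimum of `I`, which is also that of `K`; so the
  -- cluster point is a minimizer.
  rw [hcw.unique hcI] at huK
  exact ⟨huB, fun v hv => huK.trans (hc.1 ⟨v, hv, rfl⟩)⟩
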